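/- Let $R$ be an irreducible, reduced, finite (crystallographic) root system in a finite-dimensional $\mathbb Q$-vector space $V$ with a fixed system of simple roots $\Pi$, let $X$ be its weight lattice, and let $\mathbb F$ be a field of characteristic different from $2$. Let $\widehat{\mathcal W}$ be the affine Weyl group, i.e. the group of transformations of $V^*$ generated by all $s_{\alpha,n}(v)=v-(\langle\alpha,v\rangle-n)\alpha^\vee$ ($\alpha\in R$, $n\in\mathbb Z$), and let $\widehat{\mathcal S}=\{s_{\alpha,0}\mid\alpha\in\Pi\}\cup\{s_{\tilde\alpha,1}\}$ with $\tilde\alpha$ the highest root; let $\ell$ be the length and $\le$ the Bruhat order of $(\widehat{\mathcal W},\widehat{\mathcal S})$. For an affine root $\gamma=(\alpha,n)\in\widehat R=R\times\mathbb Z$ put $s_\gamma:=s_{\alpha,-n}$; $\gamma$ is positive if $n>0$, or $n=0$ and $\alpha$ is positive. Let $V_{\mathbb F}=(X\oplus\mathbb Z)\otimes_{\mathbb Z}\mathbb F$ and let $S$ be the symmetric algebra of $V_{\mathbb F}$, $\mathbb Z$-graded with $V_{\mathbb F}$ in degree $2$. Let $\widehat{\mathcal G}$ be the moment graph with vertex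 set $\widehat{\mathcal W}$, order $\le$, and an edge $x\to y$ labelled $\bar\gamma=\gamma\otimes1\in V_{\mathbb F}$ whenever $x<y$ and $y=s_\gamma x$ with $\gamma$ a positive affine root. For $s\in\widehat{\mathcal S}$ let $\widehat{\mathcal G}^s$ be the quotient moment graph on the left cosets $\bar x=\{x,xs\}$: $\bar x<\bar y$ if $\bar x\ne\bar y$ and $u<v$ for some $u\in\bar x$, $v\in\bar y$, and $\bar x\to\bar y$ is an edge labelled $\bar\gamma$ if $\bar x\neq\bar y$ and some $u\in\bar x$, $v\in\bar y$ are joined by an edge $u\to v$ labelled $\bar\gamma$. If $E:x\to y$ is an edge of $\widehat{\mathcal G}$ with $\bar x\ne\bar y$, let $\bar E:\bar x\to\bar y$ be the corresponding edge of $\widehat{\mathcal G}^s$ and $Es$ the edge $xs\to ys$. A full subgraph on a set $\mathcal I$ of vertices has the GKM-property if the labels of any two different edges in it with a common vertex are not proportional over $\mathbb F$. A sheaf $\mathcal M$ on a moment graph consists of graded $S$-modules $\mathcal M^x$ for all vertices $x$, graded $S$-modules $\mathcal M^E$ annihilated by the label for all edges $E$, and homogeneous degree-$0$ homomorphisms $\rho_{x,E}:\mathcal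 M^x\to\mathcal M^E$ for all vertices $x$ on $E$. Put $\operatorname{supp}\mathcal M=\{x\mid\mathcal M^x\neq0\}$ and let $\Gamma(\mathcal I,\mathcal M)$ be the set of $m\in\prod_{x\in\mathcal I}\mathcal M^x$ with $\rho_{x,E}(m_x)=\rho_{y,E}(m_y)$ for all edges $E$ between vertices $x,y\in\mathcal I$. Put $M\langle r\rangle_i=M_{i+r}$. The sheaf is projective if its support is finite, all $\mathcal M^x$ are isomorphic to finite direct sums of modules $S\langle r\rangle$, for each edge $E:x\to y$ with label $\alpha$ the map $\rho_{y,E}$ is surjective with kernel $\alpha\mathcal M^y$, every element of every $\mathcal M^x$ is the value of a global section, and sections over upward closed sets of vertices extend to all bigger upward closed sets. For a projective sheaf $\mathcal P$ on $\widehat{\mathcal G}$, the sheaf $\vartheta^s_{on}\mathcal P$ on $\widehat{\mathcal G}^s$ has stalk $\Gamma(\{x,xs\},\mathcal P)$ at $\bar x$; on an edge $\bar E:\bar x\to\bar y$ its module is the image of $\Gamma(\{y,ys\},\mathcal P)$ in $\mathcal P^E\oplus\mathcal P^{Es}$, and the restrictions are $\rho_{x,E}\oplus\rho_{xs,Es}$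 and $\rho_{y,E}\oplus\rho_{ys,Es}$; it is well defined if $\rho_{x,E}\oplus\rho_{xs,Es}$ maps $\Gamma(\{x,xs\},\mathcal P)$ into that module for all such edges. For a sheaf $\mathcal Q$ on $\widehat{\mathcal G}^s$, the sheaf $\vartheta^s_{out}\mathcal Q$ on $\widehat{\mathcal G}$ has stalk $\mathcal Q^{\bar x}$ at $x$; on edges $E$ joining $x$ and $xs$ its module is $\mathcal Q^{\bar x}/l(E)\mathcal Q^{\bar x}$, where $l(E)$ is the label, with the natural projections; on all other edges $E$ its module and restrictions are those of $\mathcal Q$ on $\bar E$. Let $\vartheta^s=\vartheta^s_{out}\circ\vartheta^s_{on}$; it is applicable to those projective $\mathcal P$ for which $\vartheta^s_{on}\mathcal P$ is well defined and projective. For a sequence $\mathbf s=(s_1,\dots,s_l)$ in $\widehat{\mathcal S}$, let $\mathcal B(\mathbf s)=\vartheta^{s_l}\circ\cdots\circ\vartheta^{s_1}\mathcal B(e)$, where $\mathcal B(e)$ has stalk $S$ at the unit $e$ and is zero elsewhere, and let $J(\mathbf s)$ be the set of products of all subsequences of $\mathbf s$ (taken in order). Let $\mathcal H$ be the Hecke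 algebra of $(\widehat{\mathcal W},\widehat{\mathcal S})$: the $\mathbb Z[v,v^{-1}]$-algebra with basis $(T_x)_{x\in\widehat{\mathcal W}}$, unit $T_e$, and $T_xT_y=T_{xy}$ if $\ell(xy)=\ell(x)+\ell(y)$, $T_s^2=v^{-2}T_e+(v^{-2}-1)T_s$ for $s\in\widehat{\mathcal S}$. Put $H_x=v^{\ell(x)}T_x$. For a sheaf $\mathcal M$ on $\widehat{\mathcal G}$ with finite support and free stalks put $h(\mathcal M)=\sum_xv^{-\ell(x)}\operatorname{grk}(\mathcal M^x)\,H_x$, where $\operatorname{grk}(S\langle r_1\rangle\oplus\cdots\oplus S\langle r_n\rangle)=v^{r_1}+\cdots+v^{r_n}$. **Lemma 9.** Let $\mathbf s=(s_1,\dots,s_l)$ be a sequence in $\widehat{\mathcal S}$ such that the full subgraph $\widehat{\mathcal G}_{J(\mathbf s)}$ has the GKM-property. Then $\mathcal B(\mathbf s)$ is well defined (every translation functor in its definition is applicable), it is projective with support contained in $J(\mathbf s)$, and $$v^l\,h(\mathcal B(\mathbf s))=(H_{s_1}+v)\cdots(H_{s_l}+v)\quad\text{in }\mathcal H.$$ 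-/

import Mathlib

open scoped TensorProduct DirectSum

universe u

noncomputable section

namespace BottSamelson

/-! ### Graded modules over a symmetric algebra -/

section GradedModules

/-- A family of additive endomorphisms that behaves like the family of projections onto the
homogeneous components shows that a grading is internal. -/
theorem isInternal_of_comp {M : Type u} [AddCommGroup M] (deg : ℤ → AddSubgroup M)
    (c : ℤ → M →+ M) (h1 : ∀ i m, c i m ∈ deg i) (h2 : ∀ i m, m ∈ deg i → c i m = m)
    (h3 : ∀ i j m, i ≠ j → m ∈ deg j → c i m = 0)
    (h4 : ∀ m, ∃ s : Finset ℤ, ∑ i ∈ s, c i m = m) : DirectSum.IsInternal deg := by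
  have key : ∀ (x : ⨁ i, deg i) (i : ℤ),
      c i (DirectSum.coeAddMonoidHom deg x) = (x i : M) := by
    intro x i
    induction x using DirectSum.induction_on with
    | zero => simp
    | of j y =>
      rw [DirectSum.coeAddMonoidHom_of]
      by_cases hij : i = j
      · subst hij
        rw [h2 i _ y.2, DirectSum.of_eq_same]
      · rw [h3 i j _ hij y.2, DirectSum.of_eq_of_ne _ _ _ hij]
        rfl
    | add x y hx hy => simp [hx, hy]
  refine ⟨?_, ?_⟩
  · intro x y hxy
    refine DFinsupp.ext fun i => Subtype.ext ?_
    rw [← key x i, ← key y i, hxy]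
  · intro m
    obtain ⟨s, hs⟩ := h4 m
    refine ⟨∑ i ∈ s, DirectSum.of (fun i => deg i) i ⟨c i m, h1 i m⟩, ?_⟩
    rw [map_sum]
    simpa [DirectSum.coeAddMonoidHom_of] using hs

variable (k U : Type u) [Field k] [AddCommGroup U] [Module k U]

/-- The homogeneous component of degree `i` of the symmetric algebra of `U`, where `U` has
degree `2`. -/
def symDeg (i : ℤ) : Submodule k (SymmetricAlgebra k U) :=
  if 0 ≤ i ∧ Even i then LinearMap.range (SymmetricAlgebra.ι k U) ^ (i / 2).toNat else ⊥

/-- A `ℤ`-graded module over the symmetric algebra of `U`. -/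
structure GrMod where
  carrier : Type u
  [addCommGroup : AddCommGroup carrier]
  [module : Module (SymmetricAlgebra k U) carrier]
  /-- the homogeneous components -/
  deg : ℤ → AddSubgroup carrier
  isInternal : DirectSum.IsInternal deg
  smul_mem : ∀ (i j : ℤ) (a : SymmetricAlgebra k U) (m : carrier),
    a ∈ symDeg k U i → m ∈ deg j → a • m ∈ deg (i + j)

instance : CoeSort (GrMod k U) (Type u) := ⟨GrMod.carrier⟩

attribute [instance] GrMod.addCommGroup GrMod.module

variable {k U}

/-- Homomorphisms of graded modules: linear maps that are homogeneous of degree zero. -/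
structure GrHom (M N : GrMod k U) extends M.carrier →ₗ[SymmetricAlgebra k U] N.carrier where
  map_deg : ∀ (i : ℤ) (m : M.carrier), m ∈ M.deg i → toLinearMap m ∈ N.deg i

instance (M N : GrMod k U) : CoeFun (GrHom M N) (fun _ => M.carrier → N.carrier) :=
  ⟨fun f => f.toLinearMap⟩

namespace GrMod

/-- The projection of a graded module to its component of degree `i`. -/
def comp (M : GrMod k U) (i : ℤ) : M.carrier →+ M.carrier :=
  (M.deg i).subtype.comp ((DFinsupp.evalAddMonoidHom (β := fun i => M.deg i) i).comp
    (AddEquiv.ofBijective (DirectSum.coeAddMonoidHom M.deg) M.isInternal).symm.toAddMonoidHom)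

theorem comp_mem (M : GrMod k U) (i : ℤ) (m : M) : M.comp i m ∈ M.deg i :=
  SetLike.coe_mem _

theorem comp_of_mem (M : GrMod k U) (i j : ℤ) (m : M) (hm : m ∈ M.deg j) :
    M.comp i m = if i = j then m else 0 := by
  have h : (AddEquiv.ofBijective (DirectSum.coeAddMonoidHom M.deg) M.isInternal).symm m =
      DirectSum.of (fun i => M.deg i) j ⟨m, hm⟩ := by
    rw [AddEquiv.symm_apply_eq]
    exact (DirectSum.coeAddMonoidHom_of M.deg j ⟨m, hm⟩).symm
  change (((AddEquiv.ofBijective (DirectSum.coeAddMonoidHom M.deg) M.isInternal).symm m) i : M) = _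
  rw [h]
  split_ifs with hij
  · subst hij
    rw [DirectSum.of_eq_same]
  · rw [DirectSum.of_eq_of_ne _ _ _ hij]
    rfl

theorem comp_same (M : GrMod k U) (i : ℤ) (m : M) (hm : m ∈ M.deg i) : M.comp i m = m := by
  rw [M.comp_of_mem i i m hm, if_pos rfl]

theorem comp_ne (M : GrMod k U) (i j : ℤ) (m : M) (hij : i ≠ j) (hm : m ∈ M.deg j) :
    M.comp i m = 0 := by
  rw [M.comp_of_mem i j m hm, if_neg hij]

theorem exists_sum (M : GrMod k U) (m : M) : ∃ s : Finset ℤ, ∑ i ∈ s, M.comp i m = m := by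
  classical
  have hm : DirectSum.coeAddMonoidHom M.deg
      ((AddEquiv.ofBijective (DirectSum.coeAddMonoidHom M.deg) M.isInternal).symm m) = m :=
    (AddEquiv.ofBijective (DirectSum.coeAddMonoidHom M.deg) M.isInternal).apply_symm_apply m
  refine ⟨DFinsupp.support
    ((AddEquiv.ofBijective (DirectSum.coeAddMonoidHom M.deg) M.isInternal).symm m), ?_⟩
  conv_rhs => rw [← hm, DirectSum.coeAddMonoidHom_eq_dfinsuppSum]
  rfl

theorem sum_of_subset (M : GrMod k U) (m : M) (s t : Finset ℤ) (hst : s ⊆ t)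
    (hs : ∑ i ∈ s, M.comp i m = m) : ∑ i ∈ t, M.comp i m = m := by
  rw [← Finset.sum_subset hst, hs]
  intro i _ hi
  rw [← hs, map_sum]
  refine Finset.sum_eq_zero fun j hj => M.comp_ne i j _ ?_ (M.comp_mem j m)
  rintro rfl
  exact hi hj

theorem map_comp {M N : GrMod k U} (f : GrHom M N) (i : ℤ) (m : M) :
    f (M.comp i m) = N.comp i (f m) := by
  obtain ⟨s, hs⟩ := M.exists_sum m
  have h : ∀ j, N.comp i (f (M.comp j m)) = f (M.comp i (M.comp j m)) := by
    intro j
    rw [N.comp_of_mem i j _ (f.map_deg j _ (M.comp_mem j m)),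
      M.comp_of_mem i j _ (M.comp_mem j m)]
    split_ifs <;> simp
  conv_rhs => rw [← hs, map_sum, map_sum]
  conv_lhs => rw [← hs, map_sum, map_sum]
  exact (Finset.sum_congr rfl fun j _ => h j).symm

theorem smul_comp (M : GrMod k U) (i j : ℤ) (a : SymmetricAlgebra k U) (ha : a ∈ symDeg k U i)
    (m : M) : M.comp (i + j) (a • m) = a • M.comp j m := by
  obtain ⟨s, hs⟩ := M.exists_sum m
  have h : ∀ l, M.comp (i + j) (a • M.comp l m) = a • M.comp j (M.comp l m) := by
    intro l
    rw [M.comp_of_mem (i + j) (i + l) _ (M.smul_mem i l a _ ha (M.comp_mem l m)),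
      M.comp_of_mem j l _ (M.comp_mem l m)]
    by_cases hjl : j = l <;> simp [hjl]
  conv_lhs => rw [← hs, Finset.smul_sum, map_sum]
  conv_rhs => rw [← hs, map_sum, Finset.smul_sum]
  exact Finset.sum_congr rfl fun l _ => h l

/-- The zero module. -/
def zero : GrMod k U where
  carrier := PUnit.{u + 1}
  deg _ := ⊤
  isInternal := isInternal_of_comp _ (fun _ => 0) (fun _ _ => trivial) (fun _ _ _ => rfl)
    (fun _ _ _ _ _ => rfl) (fun _ => ⟨∅, rfl⟩)
  smul_mem _ _ _ _ _ _ := trivial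

/-- A submodule that contains the homogeneous components of its elements, as a graded module. -/
def ofSubmodule (M : GrMod k U) (p : Submodule (SymmetricAlgebra k U) M.carrier)
    (hp : ∀ (i : ℤ), ∀ m ∈ p, M.comp i m ∈ p) : GrMod k U where
  carrier := p
  deg i := (M.deg i).comap p.subtype.toAddMonoidHom
  isInternal := isInternal_of_comp _
    (fun i => ((M.comp i).comp p.subtype.toAddMonoidHom).codRestrict p (fun m => hp i m m.2))
    (fun i m => M.comp_mem i m)
    (fun i m hm => Subtype.ext (M.comp_same i m hm))
    (fun i j m hij hm => Subtype.ext (M.comp_ne i j m hij hm))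
    (fun m => by
      obtain ⟨s, hs⟩ := M.exists_sum m
      refine ⟨s, Subtype.ext ?_⟩
      rw [AddSubmonoidClass.coe_finsetSum]
      exact hs)
  smul_mem i j a m ha hm := M.smul_mem i j a m ha hm

/-- The product of a finite family of graded modules. -/
def pi {I : Type u} [Finite I] (M : I → GrMod k U) : GrMod k U where
  carrier := ∀ x, (M x).carrier
  deg i := AddSubgroup.pi Set.univ (fun x => (M x).deg i)
  isInternal := isInternal_of_comp _
    (fun i => AddMonoidHom.mk' (fun m x => (M x).comp i (m x))
      (fun a b => funext fun x => map_add _ _ _))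
    (fun i m x _ => (M x).comp_mem i (m x))
    (fun i m hm => funext fun x => (M x).comp_same i (m x) (hm x trivial))
    (fun i j m hij hm => funext fun x => (M x).comp_ne i j (m x) hij (hm x trivial))
    (fun m => by
      classical
      choose s hs using fun x => (M x).exists_sum (m x)
      have := Fintype.ofFinite I
      refine ⟨Finset.univ.biUnion s, funext fun x => ?_⟩
      rw [Finset.sum_apply]
      exact (M x).sum_of_subset (m x) (s x) _ (Finset.subset_biUnion_of_mem s (Finset.mem_univ x))
        (hs x))
  smul_mem i j a m ha hm x _ := (M x).smul_mem i j a (m x) ha (hm x trivial)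

theorem pi_comp {I : Type u} [Finite I] (M : I → GrMod k U) (i : ℤ) (m : pi M) (x : I) :
    (pi M).comp i m x = (M x).comp i (m x) :=
  map_comp (M := pi M) (N := M x)
    { toLinearMap := LinearMap.proj x, map_deg := fun _ _ hm => hm x trivial } i m

/-- The submodule `a M` of a module `M`. -/
def mulSubmodule (M : GrMod k U) (a : U) : Submodule (SymmetricAlgebra k U) M.carrier :=
  LinearMap.range (LinearMap.lsmul (SymmetricAlgebra k U) M.carrier (SymmetricAlgebra.ι k U a))

theorem ι_mem (a : U) : SymmetricAlgebra.ι k U a ∈ symDeg k U 2 := by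
  have h : (0 : ℤ) ≤ 2 ∧ Even (2 : ℤ) := by decide
  have h1 : ((2 : ℤ) / 2).toNat = 1 := by decide
  rw [symDeg, if_pos h, h1, pow_one]
  exact LinearMap.mem_range_self _ a

theorem comp_mem_mulSubmodule (M : GrMod k U) (a : U) (i : ℤ) (m : M)
    (hm : m ∈ M.mulSubmodule a) : M.comp i m ∈ M.mulSubmodule a := by
  obtain ⟨n, rfl⟩ := hm
  refine ⟨M.comp (i - 2) n, ?_⟩
  have h := M.smul_comp 2 (i - 2) _ (ι_mem a) n
  rw [show (2 : ℤ) + (i - 2) = i by ring] at h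
  exact h.symm

/-- The quotient `M / a M`. -/
def quot (M : GrMod k U) (a : U) : GrMod k U where
  carrier := M.carrier ⧸ M.mulSubmodule a
  deg i := (M.deg i).map (M.mulSubmodule a).mkQ.toAddMonoidHom
  isInternal := isInternal_of_comp _
    (fun i => QuotientAddGroup.map (M.mulSubmodule a).toAddSubgroup
      (M.mulSubmodule a).toAddSubgroup (M.comp i) (fun m hm => M.comp_mem_mulSubmodule a i m hm))
    (fun i m => by
      obtain ⟨m, rfl⟩ := (M.mulSubmodule a).mkQ_surjective m
      exact ⟨M.comp i m, M.comp_mem i m, rfl⟩)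
    (fun i m hm => by
      obtain ⟨m, hm, rfl⟩ := hm
      exact congrArg (M.mulSubmodule a).mkQ (M.comp_same i m hm))
    (fun i j m hij hm => by
      obtain ⟨m, hm, rfl⟩ := hm
      exact congrArg (M.mulSubmodule a).mkQ (M.comp_ne i j m hij hm))
    (fun m => by
      obtain ⟨m, rfl⟩ := (M.mulSubmodule a).mkQ_surjective m
      obtain ⟨s, hs⟩ := M.exists_sum m
      refine ⟨s, ?_⟩
      conv_rhs => rw [← hs, map_sum]
      rfl)
  smul_mem i j b m hb hm := by
    obtain ⟨m, hm, rfl⟩ := hm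
    exact ⟨b • m, M.smul_mem i j b m hb hm, rfl⟩


section Self

variable (k U)

/-- The inclusion of `U` into the direct sum of the symmetric powers. -/
def symGradedι : U →ₗ[k] ⨁ i : ℕ, ↥(LinearMap.range (SymmetricAlgebra.ι k U) ^ i) :=
  DirectSum.lof k ℕ (fun i => ↥(LinearMap.range (SymmetricAlgebra.ι k U) ^ i)) 1 ∘ₗ
    (SymmetricAlgebra.ι k U).codRestrict _
      fun m => by simpa only [pow_one] using LinearMap.mem_range_self _ m

theorem symGradedι_apply (m : U) : symGradedι k U m =
    DirectSum.of (fun i : ℕ => ↥(LinearMap.range (SymmetricAlgebra.ι k U) ^ i)) 1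
      ⟨SymmetricAlgebra.ι k U m, by simpa only [pow_one] using LinearMap.mem_range_self _ m⟩ :=
  rfl

/-- The symmetric powers of `U` form a grading of the symmetric algebra. -/
instance symGradedAlgebra :
    GradedAlgebra ((LinearMap.range (SymmetricAlgebra.ι k U) ^ ·) : ℕ → Submodule k _) :=
  GradedAlgebra.ofAlgHom _ (SymmetricAlgebra.lift (symGradedι k U))
    (by
      ext m
      change DirectSum.coeAlgHom _ (SymmetricAlgebra.lift (symGradedι k U)
        (SymmetricAlgebra.ι k U m)) = SymmetricAlgebra.ι k U m
      rw [SymmetricAlgebra.lift_ι_apply, symGradedι_apply, DirectSum.coeAlgHom_of, Subtype.coe_mk])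
    fun i x => by
    obtain ⟨x, hx⟩ := x
    dsimp only [Subtype.coe_mk, DirectSum.lof_eq_of]
    induction hx using Submodule.pow_induction_on_left' with
    | algebraMap r =>
      rw [AlgHom.commutes, DirectSum.algebraMap_apply]; rfl
    | add x y i hx hy ihx ihy =>
      rw [map_add, ihx, ihy, ← map_add]
      rfl
    | mem_mul m hm i x hx ih =>
      obtain ⟨_, rfl⟩ := hm
      rw [map_mul, ih, SymmetricAlgebra.lift_ι_apply, symGradedι_apply, DirectSum.of_mul_of]
      exact DirectSum.of_eq_of_gradedMonoid_eq (Sigma.subtype_ext (add_comm _ _) rfl)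

/-- The projection of the symmetric algebra to its component of degree `i`. -/
def symComp (i : ℤ) : SymmetricAlgebra k U →+ SymmetricAlgebra k U :=
  if 0 ≤ i ∧ Even i then
    (GradedRing.proj (fun n : ℕ => LinearMap.range (SymmetricAlgebra.ι k U) ^ n) (i / 2).toNat)
  else 0

theorem mul_mem_symDeg (i j : ℤ) (a b : SymmetricAlgebra k U) (ha : a ∈ symDeg k U i)
    (hb : b ∈ symDeg k U j) : a * b ∈ symDeg k U (i + j) := by
  unfold symDeg at ha hb ⊢
  by_cases hi : 0 ≤ i ∧ Even i
  · by_cases hj : 0 ≤ j ∧ Even j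
    · rw [if_pos hi] at ha
      rw [if_pos hj] at hb
      rw [if_pos ⟨add_nonneg hi.1 hj.1, hi.2.add hj.2⟩]
      have h : ((i + j) / 2).toNat = (i / 2).toNat + (j / 2).toNat := by
        obtain ⟨⟨hi, x, rfl⟩, ⟨hj, y, rfl⟩⟩ := And.intro hi hj
        omega
      rw [h, pow_add]
      exact Submodule.mul_mem_mul ha hb
    · rw [if_neg hj, Submodule.mem_bot] at hb
      rw [hb, mul_zero]
      exact zero_mem _
  · rw [if_neg hi, Submodule.mem_bot] at ha
    rw [ha, zero_mul]
    exact zero_mem _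

/-- The symmetric algebra as a graded module over itself. -/
def self : GrMod k U where
  carrier := SymmetricAlgebra k U
  deg i := (symDeg k U i).toAddSubgroup
  isInternal := by
    refine isInternal_of_comp _ (symComp k U) ?_ ?_ ?_ ?_
    · intro i m
      change _ ∈ symDeg k U i
      unfold symComp symDeg
      split_ifs with h
      · rw [GradedRing.proj_apply]
        exact SetLike.coe_mem _
      · exact zero_mem _
    · intro i m hm
      change m ∈ symDeg k U i at hm
      unfold symComp
      unfold symDeg at hm
      split_ifs at hm ⊢ with h
      · rw [GradedRing.proj_apply, DirectSum.decompose_of_mem_same _ hm]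
      · rw [Submodule.mem_bot] at hm
        rw [hm, map_zero]
    · intro i j m hij hm
      change m ∈ symDeg k U j at hm
      unfold symComp
      unfold symDeg at hm
      split_ifs at hm ⊢ with h h'
      · rw [GradedRing.proj_apply, DirectSum.decompose_of_mem_ne _ hm]
        obtain ⟨⟨hi, x, rfl⟩, ⟨hj, y, rfl⟩⟩ := And.intro h h'
        omega
      · rw [Submodule.mem_bot] at hm
        rw [hm, map_zero]
      · rfl
      · rfl
    · intro m
      classical
      refine ⟨(DirectSum.decompose (fun n : ℕ => LinearMap.range (SymmetricAlgebra.ι k U) ^ n)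
        m).support.image (fun n : ℕ => 2 * (n : ℤ)), ?_⟩
      rw [Finset.sum_image (fun a _ b _ h => by simpa using h)]
      conv_rhs => rw [← DirectSum.sum_support_decompose
        (fun n : ℕ => LinearMap.range (SymmetricAlgebra.ι k U) ^ n) m]
      refine Finset.sum_congr rfl fun n _ => ?_
      have h : 0 ≤ 2 * (n : ℤ) ∧ Even (2 * (n : ℤ)) := ⟨by positivity, even_two_mul _⟩
      have h2 : (2 * (n : ℤ) / 2).toNat = n := by omega
      unfold symComp
      rw [if_pos h, h2, GradedRing.proj_apply]
  smul_mem i j a m ha hm := mul_mem_symDeg k U i j a m ha hm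

end Self

/-- `M.FreeOn r` says that `M` is isomorphic, as a graded module, to the direct sum of the shifts
`S⟨r_1⟩, …, S⟨r_n⟩`, where `S⟨r⟩_i = S_{i + r}`. -/
def FreeOn (M : GrMod k U) {n : ℕ} (r : Fin n → ℤ) : Prop :=
  ∃ e : (Fin n → SymmetricAlgebra k U) ≃ₗ[SymmetricAlgebra k U] M.carrier,
    ∀ (i : ℤ) (f : Fin n → SymmetricAlgebra k U),
      (∀ j, f j ∈ symDeg k U (i + r j)) ↔ e f ∈ M.deg i

/-- Free objects in the category of finitely generated graded modules. -/
def IsFree (M : GrMod k U) : Prop := ∃ (n : ℕ) (r : Fin n → ℤ), M.FreeOn r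

open Classical in
/-- The graded character `v ^ r_1 + ⋯ + v ^ r_n` of a module isomorphic to
`S⟨r_1⟩ ⊕ ⋯ ⊕ S⟨r_n⟩` (and `0` for modules that are not free). -/
def grk (M : GrMod k U) : LaurentPolynomial ℤ :=
  if h : M.IsFree then ∑ j, LaurentPolynomial.T (h.choose_spec.choose j) else 0

/-- The image of a homomorphism. -/
def range {M N : GrMod k U} (f : GrHom M N) : GrMod k U :=
  N.ofSubmodule (LinearMap.range f.toLinearMap) (by
    rintro i _ ⟨m, rfl⟩
    exact ⟨M.comp i m, map_comp f i m⟩)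

end GrMod

end GradedModules

/-! ### Sheaves on moment graphs -/

section MomentGraphs

/-- The data of a moment graph with labels in `U`: an oriented graph, a labelling of the edges and
a relation on the vertices. The conditions on these data are `MomentGraphData.IsMomentGraph`. -/
structure MomentGraphData (U : Type u) where
  Vertex : Type u
  Edge : Type u
  /-- the vertex at which an edge starts -/
  src : Edge → Vertex
  /-- the vertex at which an edge ends -/
  tgt : Edge → Vertex
  label : Edge → U
  le : Vertex → Vertex → Prop

namespace MomentGraphData

variable {U : Type u}

/-- The conditions of the definition of a moment graph: the labels are nonzero, the relation on the
vertices is a partial order, and edges go from smaller to bigger vertices. -/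
structure IsMomentGraph [AddCommGroup U] (G : MomentGraphData U) : Prop where
  label_ne_zero : ∀ E, G.label E ≠ 0
  le_refl : ∀ x, G.le x x
  le_trans : ∀ x y z, G.le x y → G.le y z → G.le x z
  le_antisymm : ∀ x y, G.le x y → G.le y x → x = y
  src_le_tgt : ∀ E, G.le (G.src E) (G.tgt E)
  src_ne_tgt : ∀ E, G.src E ≠ G.tgt E

/-- The GKM-property of the full moment subgraph with set of vertices `I`: the labels of any two
different edges between elements of `I` that have a common vertex are not proportional. -/
def GKMOn (k : Type u) [Field k] [AddCommGroup U] [Module k U] (G : MomentGraphData U)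
    (I : Set G.Vertex) : Prop :=
  ∀ E E' : G.Edge, E ≠ E' → G.src E ∈ I → G.tgt E ∈ I → G.src E' ∈ I → G.tgt E' ∈ I →
    (G.src E = G.src E' ∨ G.src E = G.tgt E' ∨ G.tgt E = G.src E' ∨ G.tgt E = G.tgt E') →
    ∀ c : k, G.label E' ≠ c • G.label E

/-- Open subsets of the set of vertices: the upper sets. -/
def IsOpenSet (G : MomentGraphData U) (I : Set G.Vertex) : Prop :=
  ∀ x y, x ∈ I → G.le x y → y ∈ I

end MomentGraphData

variable {k U : Type u} [Field k] [AddCommGroup U] [Module k U]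

/-- The part of a sheaf that belongs to an edge with label `a` from a vertex with stalk `A` to a
vertex with stalk `B`: a graded module annihilated by `a`, and the two restriction maps. -/
structure EdgeModule (A B : GrMod k U) (a : U) where
  mod : GrMod k U
  label_smul : ∀ m : mod, SymmetricAlgebra.ι k U a • m = 0
  resSrc : GrHom A mod
  resTgt : GrHom B mod

/-- The zero module on an edge. -/
def EdgeModule.zero (A B : GrMod k U) (a : U) : EdgeModule A B a where
  mod := GrMod.zero
  label_smul _ := rfl
  resSrc := { toLinearMap := 0, map_deg := fun _ _ _ => trivial }
  resTgt := { toLinearMap := 0, map_deg := fun _ _ _ => trivial }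

/-- The module `A / a A` with the natural projections. -/
def EdgeModule.quot (A : GrMod k U) (a : U) : EdgeModule A A a where
  mod := A.quot a
  label_smul m := by
    obtain ⟨m, rfl⟩ := (A.mulSubmodule a).mkQ_surjective m
    exact (Submodule.Quotient.mk_eq_zero _).2 ⟨m, rfl⟩
  resSrc := { toLinearMap := (A.mulSubmodule a).mkQ, map_deg := fun _ m hm => ⟨m, hm, rfl⟩ }
  resTgt := { toLinearMap := (A.mulSubmodule a).mkQ, map_deg := fun _ m hm => ⟨m, hm, rfl⟩ }

/-- The same module, for a family of graded modules and an equality of indices. -/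
def EdgeModule.quotOfEq {X : Type u} (f : X → GrMod k U) {x y : X} (h : x = y) (a : U) :
    EdgeModule (f x) (f y) a :=
  h ▸ EdgeModule.quot (f x) a

variable (k) in
/-- A sheaf on a moment graph. -/
structure MGSheaf (G : MomentGraphData U) where
  stalk : G.Vertex → GrMod k U
  edge : ∀ E : G.Edge, EdgeModule (stalk (G.src E)) (stalk (G.tgt E)) (G.label E)

namespace MGSheaf

variable {G : MomentGraphData U} (M : MGSheaf k G)

/-- The support of a sheaf. -/
def supp : Set G.Vertex := {x | Nontrivial (M.stalk x)}

/-- The sections of a sheaf over a set of vertices. -/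
def sections (I : Set G.Vertex) :
    Submodule (SymmetricAlgebra k U) (∀ x : I, (M.stalk x.1).carrier) where
  carrier := {m | ∀ (E : G.Edge) (hs : G.src E ∈ I) (ht : G.tgt E ∈ I),
    (M.edge E).resSrc (m ⟨G.src E, hs⟩) = (M.edge E).resTgt (m ⟨G.tgt E, ht⟩)}
  add_mem' {m n} hm hn E hs ht := by
    simpa only [Pi.add_apply, map_add] using congrArg₂ (· + ·) (hm E hs ht) (hn E hs ht)
  zero_mem' E hs ht := by simp only [Pi.zero_apply, map_zero]
  smul_mem' a m hm E hs ht := by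
    simpa only [Pi.smul_apply, map_smul] using congrArg (a • ·) (hm E hs ht)

/-- The graded module of sections over a finite set of vertices. -/
def grSections (I : Set G.Vertex) [Finite I] : GrMod k U :=
  (GrMod.pi fun x : I => M.stalk x.1).ofSubmodule (M.sections I) (by
    intro i m hm E hs ht
    rw [GrMod.pi_comp, GrMod.pi_comp, GrMod.map_comp, GrMod.map_comp, hm E hs ht])

/-- A sheaf is generated by global sections if any element of any stalk is the value of a global
section. -/
def GeneratedByGlobalSections : Prop :=
  ∀ (x : G.Vertex) (a : M.stalk x), ∃ m ∈ M.sections Set.univ, m ⟨x, trivial⟩ = a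

/-- A sheaf is flabby if sections over open sets can be extended to bigger open sets. -/
def Flabby : Prop :=
  ∀ (I' I : Set G.Vertex) (h : I' ⊆ I), G.IsOpenSet I' → G.IsOpenSet I →
    ∀ m' ∈ M.sections I', ∃ m ∈ M.sections I, ∀ x : I', m ⟨x.1, h x.2⟩ = m' x

/-- Projective sheaves. -/
structure IsProjective : Prop where
  finite_supp : M.supp.Finite
  free : ∀ x, (M.stalk x).IsFree
  surjective_resTgt : ∀ E, Function.Surjective (M.edge E).resTgt
  ker_resTgt : ∀ E, LinearMap.ker (M.edge E).resTgt.toLinearMap =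
    (M.stalk (G.tgt E)).mulSubmodule (G.label E)
  generated : M.GeneratedByGlobalSections
  flabby : M.Flabby

end MGSheaf

end MomentGraphs

/-! ### Affine Weyl groups -/

section AffineWeyl

variable {ι V N : Type u} [AddCommGroup V] [Module ℚ V] [AddCommGroup N] [Module ℚ N]

theorem affineReflection_involutive (R : RootPairing ι ℚ V N) (i : ι) (n : ℤ) :
    Function.Involutive
      (fun v : N => v - (R.toLinearMap (R.root i) v - (n : ℚ)) • R.coroot i) := fun v => by
  simp only [map_sub, map_smul, R.root_coroot_two, smul_eq_mul]
  module

/-- The affine reflection `v ↦ v - (⟨α, v⟩ - n) α^∨` of the dual space. -/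
def affineReflection (R : RootPairing ι ℚ V N) (i : ι) (n : ℤ) : Equiv.Perm N :=
  Function.Involutive.toPerm
    (fun v => v - (R.toLinearMap (R.root i) v - (n : ℚ)) • R.coroot i)
    (affineReflection_involutive R i n)

/-- The affine Weyl group, generated by all affine reflections. -/
def affineWeylGroup (R : RootPairing ι ℚ V N) : Subgroup (Equiv.Perm N) :=
  Subgroup.closure {g | ∃ (i : ι) (n : ℤ), g = affineReflection R i n}

/-- The affine reflections as elements of the affine Weyl group. -/
def reflectionElt (R : RootPairing ι ℚ V N) (i : ι) (n : ℤ) : affineWeylGroup R :=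
  ⟨affineReflection R i n, Subgroup.subset_closure ⟨i, n, rfl⟩⟩

theorem reflectionElt_mul_self (R : RootPairing ι ℚ V N) (i : ι) (n : ℤ) :
    reflectionElt R i n * reflectionElt R i n = 1 :=
  Subtype.ext (Equiv.ext (affineReflection_involutive R i n))

/-- The affine roots `(α, n)`, where the root `α` is given by its index. -/
abbrev AffineRoot (_R : RootPairing ι ℚ V N) : Type u := ι × ℤ

/-- The reflection `s_(α, n) = s_{α, -n}` that belongs to an affine root `(α, n)`. -/
def AffineRoot.refl {R : RootPairing ι ℚ V N} (γ : AffineRoot R) : affineWeylGroup R :=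
  reflectionElt R γ.1 (-γ.2)

variable {R : RootPairing ι ℚ V N} (b : R.Base)

/-- Positive roots with respect to a system of simple roots. -/
def IsPosRoot (i : ι) : Prop := R.root i ∈ AddSubmonoid.closure (R.root '' b.support)

/-- Positive affine roots. -/
def IsPosAffine (γ : AffineRoot R) : Prop := 0 < γ.2 ∨ (γ.2 = 0 ∧ IsPosRoot b γ.1)

/-- The highest root: its difference with any root is a sum of simple roots. -/
def IsHighestRoot (i : ι) : Prop :=
  ∀ j : ι, R.root i - R.root j ∈ AddSubmonoid.closure (R.root '' b.support)

/-- The simple reflections: `s_{α, 0}` for the simple roots `α`, and `s_{α, 1}` for the highest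
root `α`. -/
def simpleReflections : Set (affineWeylGroup R) :=
  {s | ∃ i ∈ b.support, s = reflectionElt R i 0} ∪ {s | ∃ i, IsHighestRoot b i ∧
    s = reflectionElt R i 1}

theorem simpleReflections_mul_self (s : simpleReflections b) : s.1 * s.1 = 1 := by
  obtain ⟨s, ⟨i, _, rfl⟩ | ⟨i, _, rfl⟩⟩ := s <;> exact reflectionElt_mul_self R i _

/-- The length function: the least number of factors in an expression as a product of simple
reflections. -/
def length (w : affineWeylGroup R) : ℕ :=
  sInf {n | ∃ L : List (simpleReflections b), L.length = n ∧ (L.map Subtype.val).prod = w}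

/-- A step in the Bruhat order: multiplication by a reflection (a conjugate of a simple reflection)
that increases the length. -/
def BruhatStep (x y : affineWeylGroup R) : Prop :=
  length b x < length b y ∧
    ∃ (s : simpleReflections b) (w : affineWeylGroup R), y = w * s.1 * w⁻¹ * x

/-- The Bruhat order. -/
def bruhatLE (x y : affineWeylGroup R) : Prop := Relation.ReflTransGen (BruhatStep b) x y

theorem bruhatLE_length {x y : affineWeylGroup R} (h : bruhatLE b x y) :
    x = y ∨ length b x < length b y := by
  induction h with
  | refl => exact Or.inl rfl
  | tail _ h ih =>
    rcases ih with rfl | ih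
    · exact Or.inr h.1
    · exact Or.inr (ih.trans h.1)

variable (R) in
/-- The weight lattice. -/
def weightLattice : AddSubgroup V where
  carrier := {l | ∀ i, ∃ z : ℤ, R.toLinearMap l (R.coroot i) = (z : ℚ)}
  add_mem' {l m} hl hm i := by
    obtain ⟨⟨x, hx⟩, ⟨y, hy⟩⟩ := And.intro (hl i) (hm i)
    exact ⟨x + y, by rw [map_add, LinearMap.add_apply, hx, hy]; push_cast; rfl⟩
  zero_mem' i := ⟨0, by simp⟩
  neg_mem' {l} hl i := by
    obtain ⟨x, hx⟩ := hl i
    exact ⟨-x, by rw [map_neg, LinearMap.neg_apply, hx]; push_cast; rfl⟩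

variable (R) in
/-- The lattice of affine weights. -/
abbrev AffineWeight : Type u := weightLattice R × ℤ

/-- An affine root as an affine weight. -/
def AffineRoot.toWeight [R.IsCrystallographic] (γ : AffineRoot R) : AffineWeight R :=
  (⟨R.root γ.1, fun i => by
    obtain ⟨z, hz⟩ := RootPairing.IsValuedIn.exists_value (P := R) (S := ℤ) γ.1 i
    exact ⟨z, hz.symm⟩⟩, γ.2)

variable (k : Type u) [Field k]

variable (R) in
/-- The space of labels: the lattice of affine weights tensored with the ground field. -/
abbrev LabelSpace : Type u := k ⊗[ℤ] AffineWeight R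

/-- An edge of the moment graph of the affine Weyl group: it goes from `x` to `y` with label
`α ⊗ 1` if `x < y` and `y = s_α x` with a positive affine root `α`. -/
@[ext] structure AffineEdge where
  src : affineWeylGroup R
  tgt : affineWeylGroup R
  root : AffineRoot R
  pos : IsPosAffine b root
  src_le : bruhatLE b src tgt
  src_ne : src ≠ tgt
  eq_mul : tgt = root.refl * src

/-- The set of left cosets `{x, xs}` of the subgroup generated by a simple reflection. -/
abbrev Cosets (s : simpleReflections b) : Type u := affineWeylGroup R ⧸ Subgroup.zpowers s.1

/-- An edge of the quotient graph: it goes from `x` to `y` with label `α ⊗ 1` if `x ≠ y` and there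
is an edge with this label from a representative of `x` to a representative of `y`. -/
@[ext] structure QuotientEdge (s : simpleReflections b) where
  src : Cosets b s
  tgt : Cosets b s
  root : AffineRoot R
  src_ne : src ≠ tgt
  exists_edge : ∃ E : AffineEdge b, (E.src : Cosets b s) = src ∧ (E.tgt : Cosets b s) = tgt ∧
    E.root = root

variable {b} in
/-- The edge of the quotient graph that corresponds to an edge. -/
def AffineEdge.bar (s : simpleReflections b) (E : AffineEdge b)
    (h : (E.src : Cosets b s) ≠ E.tgt) : QuotientEdge b s :=
  ⟨E.src, E.tgt, E.root, h, E, rfl, rfl, rfl⟩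

/-- The elements of a coset. -/
def cosetSet (s : simpleReflections b) (c : Cosets b s) : Set (affineWeylGroup R) :=
  {x | (x : Cosets b s) = c}

theorem eq_or_eq_mul (s : simpleReflections b) (x y : affineWeylGroup R)
    (h : (x : Cosets b s) = y) : y = x ∨ y = x * s.1 := by
  rw [QuotientGroup.eq, Subgroup.mem_zpowers_iff] at h
  obtain ⟨n, hn⟩ := h
  have hs : s.1 ^ (2 : ℤ) = 1 := by rw [zpow_ofNat, pow_two, simpleReflections_mul_self]
  rcases Int.even_or_odd' n with ⟨m, rfl | rfl⟩
  · rw [zpow_mul, hs, one_zpow] at hn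
    exact Or.inl (by rw [eq_comm, inv_mul_eq_one] at hn; exact hn.symm)
  · rw [zpow_add, zpow_mul, hs, one_zpow, one_mul, zpow_one] at hn
    exact Or.inr (by rw [hn, mul_inv_cancel_left])

instance finite_cosetSet (s : simpleReflections b) (c : Cosets b s) : Finite (cosetSet b s c) := by
  obtain ⟨x, rfl⟩ := QuotientGroup.mk_surjective c
  refine Set.Finite.subset (Set.toFinite {x, x * s.1}) fun y hy => ?_
  rcases eq_or_eq_mul b s x y hy.symm with h | h
  · exact Or.inl h
  · exact Or.inr h

/-- The edges that correspond to a given edge of the quotient graph. -/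
def edgesOver (s : simpleReflections b) (E : QuotientEdge b s) : Set (AffineEdge b) :=
  {D | (D.src : Cosets b s) = E.src ∧ (D.tgt : Cosets b s) = E.tgt ∧ D.root = E.root}

instance finite_edgesOver (s : simpleReflections b) (E : QuotientEdge b s) :
    Finite (edgesOver b s E) := by
  refine Finite.of_injective (β := cosetSet b s E.src × cosetSet b s E.tgt)
    (fun D => (⟨D.1.src, D.2.1⟩, ⟨D.1.tgt, D.2.2.1⟩)) fun D D' h => ?_
  rw [Prod.mk.injEq] at h
  exact Subtype.ext (AffineEdge.ext (congrArg Subtype.val h.1) (congrArg Subtype.val h.2) (D.2.2.2.trans D'.2.2.2.symm))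

variable [R.IsCrystallographic]

/-- The moment graph of the affine Weyl group. -/
abbrev affineGraph : MomentGraphData (LabelSpace R k) where
  Vertex := affineWeylGroup R
  Edge := AffineEdge b
  src := AffineEdge.src
  tgt := AffineEdge.tgt
  label E := 1 ⊗ₜ E.root.toWeight
  le := bruhatLE b

theorem label_ne_zero (hk : ringChar k ≠ 2) (γ : AffineRoot R) :
    (1 ⊗ₜ[ℤ] γ.toWeight : LabelSpace R k) ≠ 0 := by
  intro h
  have hex : ∀ l : weightLattice R, ∃ z : ℤ, R.toLinearMap l.1 (R.coroot γ.1) = (z : ℚ) :=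
    fun l => l.2 γ.1
  choose z hz using hex
  let f : weightLattice R →+ ℤ := AddMonoidHom.mk' z (fun l m => by
    have h1 := hz (l + m)
    rw [AddSubgroup.coe_add, map_add, LinearMap.add_apply, hz l, hz m] at h1
    exact_mod_cast h1.symm)
  let g : LabelSpace R k →ₗ[ℤ] k := TensorProduct.lift
    (LinearMap.flip ((LinearMap.toSpanSingleton ℤ (k →ₗ[ℤ] k) LinearMap.id) ∘ₗ
      f.toIntLinearMap ∘ₗ LinearMap.fst ℤ (weightLattice R) ℤ))
  have h2 : g (1 ⊗ₜ[ℤ] γ.toWeight) = ((z γ.toWeight.1 : ℤ) : k) := by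
    change ((LinearMap.toSpanSingleton ℤ (k →ₗ[ℤ] k) LinearMap.id) (z γ.toWeight.1)) 1 = _
    simp
  have h3 : z γ.toWeight.1 = 2 := by
    have := hz γ.toWeight.1
    change R.toLinearMap (R.root γ.1) (R.coroot γ.1) = _ at this
    rw [R.root_coroot_two] at this
    exact_mod_cast this.symm
  rw [h, map_zero, h3] at h2
  exact Ring.two_ne_zero hk (by exact_mod_cast h2.symm)

/-- The data defining `affineGraph` are indeed a moment graph. -/
theorem affineGraph_isMomentGraph (hk : ringChar k ≠ 2) : (affineGraph b k).IsMomentGraph where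
  label_ne_zero E := label_ne_zero k hk E.root
  le_refl _ := Relation.ReflTransGen.refl
  le_trans _ _ _ := Relation.ReflTransGen.trans
  le_antisymm x y h h' := by
    rcases bruhatLE_length b h with h1 | h1
    · exact h1
    · rcases bruhatLE_length b h' with h2 | h2
      · exact h2.symm
      · omega
  src_le_tgt E := E.src_le
  src_ne_tgt E := E.src_ne

/-- The quotient of the moment graph of the affine Weyl group by a simple reflection. -/
abbrev quotientGraph (s : simpleReflections b) : MomentGraphData (LabelSpace R k) where
  Vertex := Cosets b s
  Edge := QuotientEdge b s
  src := QuotientEdge.src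
  tgt := QuotientEdge.tgt
  label E := 1 ⊗ₜ E.root.toWeight
  le x y := x = y ∨ (x ≠ y ∧ ∃ u v : affineWeylGroup R, (u : Cosets b s) = x ∧
    (v : Cosets b s) = y ∧ bruhatLE b u v ∧ u ≠ v)



/-! ### Translation functors and Bott-Samelson sheaves -/

variable {b} {k}

/-- For an edge `E` of the quotient graph, a section `m` over the coset where `E` starts gives the
family of the elements `ρ(m_x)` for all edges `x → y` that lie over `E`. -/
def onResSrc (s : simpleReflections b) (P : MGSheaf k (affineGraph b k)) (E : QuotientEdge b s) :
    GrHom (P.grSections (cosetSet b s E.src))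
      (GrMod.pi fun D : edgesOver b s E => (P.edge D.1).mod) where
  toLinearMap := LinearMap.pi (fun D => (P.edge D.1).resSrc.toLinearMap ∘ₗ
    LinearMap.proj (⟨D.1.src, D.2.1⟩ : cosetSet b s E.src)) ∘ₗ (P.sections _).subtype
  map_deg i _ hm D _ := (P.edge D.1).resSrc.map_deg i _ (hm ⟨D.1.src, D.2.1⟩ trivial)

/-- For an edge `E` of the quotient graph, a section `m` over the coset where `E` ends gives the
family of the elements `ρ(m_y)` for all edges `x → y` that lie over `E`. -/
def onResTgt (s : simpleReflections b) (P : MGSheaf k (affineGraph b k)) (E : QuotientEdge b s) :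
    GrHom (P.grSections (cosetSet b s E.tgt))
      (GrMod.pi fun D : edgesOver b s E => (P.edge D.1).mod) where
  toLinearMap := LinearMap.pi (fun D => (P.edge D.1).resTgt.toLinearMap ∘ₗ
    LinearMap.proj (⟨D.1.tgt, D.2.2.1⟩ : cosetSet b s E.tgt)) ∘ₗ (P.sections _).subtype
  map_deg i _ hm D _ := (P.edge D.1).resTgt.map_deg i _ (hm ⟨D.1.tgt, D.2.2.1⟩ trivial)

/-- The condition under which `thetaOn` is well defined: the families that come from the source of
an edge of the quotient graph lie in the module on this edge, which is the module of the families
that come from its target. -/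
def OnCompatible (s : simpleReflections b) (P : MGSheaf k (affineGraph b k)) : Prop :=
  ∀ (E : QuotientEdge b s) (m : P.grSections (cosetSet b s E.src)),
    onResSrc s P E m ∈ LinearMap.range (onResTgt s P E).toLinearMap

/-- Translation of a sheaf onto the wall: the stalk at a coset is the module of sections over this
coset. -/
def thetaOn (s : simpleReflections b) (P : MGSheaf k (affineGraph b k)) (h : OnCompatible s P) :
    MGSheaf k (quotientGraph b k s) where
  stalk c := P.grSections (cosetSet b s c)
  edge E :=
    { mod := GrMod.range (onResTgt s P E)
      label_smul := fun m => Subtype.ext <| funext fun D => by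
        have hD := (P.edge D.1).label_smul (m.1 D)
        have hl : (quotientGraph b k s).label E = (affineGraph b k).label D.1 :=
          congrArg (fun γ : AffineRoot R => (1 ⊗ₜ γ.toWeight : LabelSpace R k)) D.2.2.2.symm
        change SymmetricAlgebra.ι k (LabelSpace R k) ((quotientGraph b k s).label E) • m.1 D = 0
        rw [hl]
        exact hD
      resSrc :=
        { toLinearMap := (onResSrc s P E).toLinearMap.codRestrict _ (h E)
          map_deg := (onResSrc s P E).map_deg }
      resTgt :=
        { toLinearMap := (onResTgt s P E).toLinearMap.rangeRestrict
          map_deg := (onResTgt s P E).map_deg } }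

open Classical in
/-- Translation of a sheaf out of the wall. The stalk at `x` is the stalk at the coset of `x`. For
the edges that connect `x` and `xs`, the module is the quotient of this stalk by the label, and for
the other edges it is the module on the corresponding edge of the quotient graph. -/
def thetaOut (s : simpleReflections b) (Q : MGSheaf k (quotientGraph b k s)) :
    MGSheaf k (affineGraph b k) where
  stalk x := Q.stalk (x : Cosets b s)
  edge E :=
    if h : (E.src : Cosets b s) = E.tgt then
      EdgeModule.quotOfEq Q.stalk h ((affineGraph b k).label E)
    else Q.edge (E.bar s h)

/-- The translation functor, which is applicable to a projective sheaf `P` if translation of `P`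
onto the wall is well defined and gives a projective sheaf on the quotient moment graph. -/
def theta (s : simpleReflections b) (P : MGSheaf k (affineGraph b k)) :
    Part (MGSheaf k (affineGraph b k)) where
  Dom := P.IsProjective ∧ (quotientGraph b k s).IsMomentGraph ∧
    ∃ h : OnCompatible s P, (thetaOn s P h).IsProjective
  get h := thetaOut s (thetaOn s P h.2.2.choose)

variable (b k)

open Classical in
/-- The sheaf with stalk `S` at the unit element and zero everywhere else. -/
def unitSheaf : MGSheaf k (affineGraph b k) where
  stalk x := if x = 1 then GrMod.self k (LabelSpace R k) else GrMod.zero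
  edge _ := EdgeModule.zero _ _ _

variable {b}

/-- The Bott-Samelson sheaf of a sequence of simple reflections, obtained from the unit sheaf by
applying the translation functors of the entries of the sequence one after the other. -/
def bottSamelson (s : List (simpleReflections b)) : Part (MGSheaf k (affineGraph b k)) :=
  s.foldl (fun P t => P.bind (theta t)) (Part.some (unitSheaf b k))

/-- The products of all subsequences of a sequence of simple reflections. -/
def subwordProducts (s : List (simpleReflections b)) : Set (affineWeylGroup R) :=
  {x | ∃ σ : List (simpleReflections b), σ.Sublist s ∧ (σ.map Subtype.val).prod = x}

end AffineWeyl

/-! ### The Hecke algebra -/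

section Hecke

variable {ι V N : Type u} [AddCommGroup V] [Module ℚ V] [AddCommGroup N] [Module ℚ N]
variable {R : RootPairing ι ℚ V N} (b : R.Base)

/-- The relations between the generators `T_x` of the Hecke algebra over `ℤ[v, v⁻¹]`. -/
inductive HeckeRel : FreeAlgebra (LaurentPolynomial ℤ) (affineWeylGroup R) →
    FreeAlgebra (LaurentPolynomial ℤ) (affineWeylGroup R) → Prop
  | one : HeckeRel (FreeAlgebra.ι _ 1) 1
  | mul (x y : affineWeylGroup R) (h : length b (x * y) = length b x + length b y) :
      HeckeRel (FreeAlgebra.ι _ x * FreeAlgebra.ι _ y) (FreeAlgebra.ι _ (x * y))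
  | quadratic (s : simpleReflections b) :
      HeckeRel (FreeAlgebra.ι _ s.1 * FreeAlgebra.ι _ s.1)
        ((LaurentPolynomial.T (-2) : LaurentPolynomial ℤ) • FreeAlgebra.ι _ 1 +
          (LaurentPolynomial.T (-2) - 1 : LaurentPolynomial ℤ) • FreeAlgebra.ι _ s.1)

/-- The Hecke algebra of the affine Weyl group. -/
abbrev HeckeAlgebra : Type u := RingQuot (HeckeRel b)

/-- The elements `T_x` of the Hecke algebra. -/
def heckeT (x : affineWeylGroup R) : HeckeAlgebra b :=
  RingQuot.mkAlgHom (LaurentPolynomial ℤ) (HeckeRel b) (FreeAlgebra.ι _ x)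

/-- The elements `H_x = v ^ ℓ(x) T_x` of the Hecke algebra. -/
def heckeH (x : affineWeylGroup R) : HeckeAlgebra b :=
  (LaurentPolynomial.T (length b x : ℤ) : LaurentPolynomial ℤ) • heckeT b x

/-- The element `v` of the Hecke algebra. -/
def heckeV : HeckeAlgebra b :=
  algebraMap (LaurentPolynomial ℤ) (HeckeAlgebra b) (LaurentPolynomial.T 1)

variable {b} {k : Type u} [Field k] [R.IsCrystallographic]

/-- The character of a sheaf with finite support and free stalks. -/
def character (M : MGSheaf k (affineGraph b k)) : HeckeAlgebra b :=
  ∑ᶠ x : affineWeylGroup R,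
    (LaurentPolynomial.T (-(length b x : ℤ)) * (M.stalk x).grk : LaurentPolynomial ℤ) • heckeH b x

end Hecke

end BottSamelson

end

/-! The proof is an induction on the sequence that splits off its last reflection `s`. Let `P` be a
projective sheaf supported on the products of subsequences of the earlier entries. Everything rests
on one function on the vertices, `x ↦ x(α_s)`, where `α_s` is the simple affine root of `s`
(`wallLabel`). Along an edge it changes by a multiple of the label, so multiplication by it
preserves sections; it changes sign under `x ↦ xs`; and up to sign it is the label of the edge
inside the coset of `x`. As 2 is invertible, sections can be split into a part symmetric under `x ↦
xs` and `x(α_s)` times a symmetric part.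

Onto the wall, this function is used to extend sections of `P` over a coset to global sections
(`exists_global_extension`). Hence the translation is well defined and generated by global sections;
flabbiness is inherited, since sections over a set of cosets are sections of `P` over the preimage.
A stalk is a fibre product of two free modules over a quotient `B / β B`, so it is free with
character `p + v^{-2} q` (`freeOn_fibreProduct`). The kernel condition (`ker_resTgt_thetaOn`) needs
the GKM-property: the label of an edge between cosets acts injectively on a free module modulo the
label inside the coset.

Out of the wall, only flabbiness is not immediate (`flabby_thetaOut`). Given a section over an open
set, its differences inside cosets, divided by `x(α_s)`, form a section on the quotient graph, again
by GKM. Subtracting half of `x(α_s)` times an extension of it leaves a symmetric section, which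
comes from the quotient graph.

Translation replaces the characters `p`, `q` of the two stalks in a coset by `p + v^{-2} q` twice.
Up to the factor `v` this is right multiplication by `H_s + v` (`coset_mul`).

The combinatorial input is read off from a point in the fundamental alcove: the sign of a positive
affine root `γ` at the image of this point under `w` decides whether `s_γ w` is longer than `w`.
This gives the exchange property, the edges `xs → ys` parallel to `x → y`, and the fact that the
products of subsequences contain with the target of an edge also its source, so that the
GKM-hypothesis covers all edges that matter. -/

noncomputable section

namespace BottSamelson

set_option linter.unusedSectionVars false

/-! ### Root systems: heights, dominance and the highest root -/

section RootSystem

variable {ι V N : Type u} [AddCommGroup V] [Module ℚ V] [AddCommGroup N] [Module ℚ N]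
variable {R : RootPairing ι ℚ V N} (b : R.Base)

/-- The cone of the nonnegative integral combinations of simple roots. -/
abbrev simpleCone : AddSubmonoid V := AddSubmonoid.closure (R.root '' b.support)

theorem simple_mem_simpleCone {i : ι} (hi : i ∈ b.support) : R.root i ∈ simpleCone b :=
  AddSubmonoid.subset_closure (Set.mem_image_of_mem _ hi)

/-- The simple roots form a basis and the pairing is perfect, so the functional with value 1 on this
basis is evaluation at a vector. -/
theorem exists_coweight [R.IsRootSystem] :
    ∃ ρ : N, ∀ i ∈ b.support, R.toLinearMap (R.root i) ρ = 1 := by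
  obtain ⟨ρ, hρ⟩ := R.flip.toPerfPair.surjective (b.toWeightBasis.constr ℚ fun _ => (1 : ℚ))
  refine ⟨ρ, fun i hi => ?_⟩
  have h := LinearMap.congr_fun hρ (R.root i)
  rw [show R.root i = b.toWeightBasis ⟨i, hi⟩ by simp, Module.Basis.constr_basis] at h
  simpa using h

/-- A point at which all simple roots take the value `1`. -/
def coweight [R.IsRootSystem] : N := (exists_coweight b).choose

/-- The height of an element of the root space. -/
def heightFun [R.IsRootSystem] : V →ₗ[ℚ] ℚ := R.toLinearMap.flip (coweight b)

variable [R.IsRootSystem]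

theorem heightFun_simple {i : ι} (hi : i ∈ b.support) : heightFun b (R.root i) = 1 :=
  (exists_coweight b).choose_spec i hi

/-- Every simple root contributes 1, so the height vanishes on the cone only at zero. This gap lets
the sign of a root be read from its height. -/
theorem eq_zero_or_one_le_heightFun {x : V} (hx : x ∈ simpleCone b) :
    x = 0 ∨ 1 ≤ heightFun b x := by
  refine AddSubmonoid.closure_induction (motive := fun x _ => x = 0 ∨ 1 ≤ heightFun b x) ?_ (Or.inl rfl)
    ?_ hx
  · rintro _ ⟨i, hi, rfl⟩
    exact Or.inr (heightFun_simple b hi).ge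
  · rintro x y _ _ (rfl | hx) (rfl | hy)
    · exact Or.inl (add_zero 0)
    · exact Or.inr (by rwa [zero_add])
    · exact Or.inr (by rwa [add_zero])
    · exact Or.inr (by rw [map_add]; linarith)

theorem heightFun_nonneg {x : V} (hx : x ∈ simpleCone b) : 0 ≤ heightFun b x := by
  rcases eq_zero_or_one_le_heightFun b hx with rfl | h
  · rw [map_zero]
  · linarith

theorem isPosRoot_iff_one_le {i : ι} : IsPosRoot b i ↔ 1 ≤ heightFun b (R.root i) := by
  refine ⟨fun h => (eq_zero_or_one_le_heightFun b h).resolve_left (R.ne_zero i), fun h => ?_⟩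
  refine (b.root_mem_or_neg_mem i).resolve_right fun h' => ?_
  have := heightFun_nonneg b h'
  rw [map_neg] at this
  linarith

theorem isPosRoot_iff {i : ι} : IsPosRoot b i ↔ 0 < heightFun b (R.root i) := by
  refine ⟨fun h => by linarith [(isPosRoot_iff_one_le b).1 h], fun h => ?_⟩
  refine (b.root_mem_or_neg_mem i).resolve_right fun h' => ?_
  have := heightFun_nonneg b h'
  rw [map_neg] at this
  linarith

theorem heightFun_le_neg_one {i : ι} (h : ¬ IsPosRoot b i) : heightFun b (R.root i) ≤ -1 := by
  have h' := (b.root_mem_or_neg_mem i).resolve_left h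
  have := (eq_zero_or_one_le_heightFun b h').resolve_left (neg_ne_zero.2 (R.ne_zero i))
  rw [map_neg] at this
  linarith

theorem map_nonneg_of_simple {f : V →ₗ[ℚ] ℚ} (hf : ∀ i ∈ b.support, 0 ≤ f (R.root i)) {x : V}
    (hx : x ∈ simpleCone b) : 0 ≤ f x := by
  refine AddSubmonoid.closure_induction (motive := fun x _ => 0 ≤ f x) ?_ (map_zero f).ge ?_ hx
  · rintro _ ⟨i, hi, rfl⟩
    exact hf i hi
  · intro x y _ _ hx hy
    rw [map_add]
    exact add_nonneg hx hy

/-- A vector of the cone that is not in the span of a subset of the simple roots has a positive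
coefficient outside of this subset. -/
theorem exists_coeff {x : V} (hx : x ∈ simpleCone b) :
    ∃ c : ι → ℕ, x = ∑ j ∈ b.support, c j • R.root j := by
  classical
  refine AddSubmonoid.closure_induction
    (motive := fun x _ => ∃ c : ι → ℕ, x = ∑ j ∈ b.support, c j • R.root j) ?_ ⟨0, by simp⟩ ?_ hx
  · rintro _ ⟨i, hi, rfl⟩
    refine ⟨Pi.single i 1, ?_⟩
    rw [Finset.sum_eq_single_of_mem i hi (fun j _ hj => by simp [hj])]
    simp
  · rintro _ _ _ _ ⟨c, rfl⟩ ⟨d, rfl⟩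
    exact ⟨c + d, by simp [add_smul, Finset.sum_add_distrib]⟩

section Finite

variable [Finite ι] [R.IsCrystallographic]

theorem pairing_pos_iff {i j : ι} : 0 < R.pairing i j ↔ 0 < R.pairing j i := by
  rw [← R.algebraMap_pairingIn ℤ i j, ← R.algebraMap_pairingIn ℤ j i]
  simpa using R.zero_lt_pairingIn_iff' ℤ (i := i) (j := j)

theorem pairing_nonneg_iff {i j : ι} : 0 ≤ R.pairing i j ↔ 0 ≤ R.pairing j i := by
  rcases lt_trichotomy (R.pairing i j) 0 with h | h | h
  -- `R.reflectionPerm i i` is the index of `-R.root i`, which turns the negative case into the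
  -- positive one.
  · have h' : 0 < R.pairing (R.reflectionPerm i i) j := by simpa using h
    rw [pairing_pos_iff] at h'
    have h'' : R.pairing j i < 0 := by simpa using h'
    exact iff_of_false h.not_ge h''.not_ge
  · exact iff_of_true h.ge (R.pairing_eq_zero_iff.1 h).ge
  · exact iff_of_true h.le (pairing_pos_iff.1 h).le

theorem pairing_nonpos_iff {i j : ι} : R.pairing i j ≤ 0 ↔ R.pairing j i ≤ 0 := by
  rw [← not_lt, ← not_lt, pairing_pos_iff]

/-- A root of maximal height among the roots `≥ β` is dominant. -/
theorem pairing_simple_nonneg_of_isMax {θ : ι} (β : V) (hβ : R.root θ - β ∈ simpleCone b)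
    (hθ : ∀ i, R.root i - β ∈ simpleCone b → heightFun b (R.root i) ≤ heightFun b (R.root θ))
    {j : ι} (hj : j ∈ b.support) : 0 ≤ R.pairing θ j := by
  by_contra! h
  obtain ⟨z, hz⟩ := RootPairing.IsValuedIn.exists_value (P := R) (S := ℤ) θ j
  have hz' : R.pairing θ j = z := by simpa using hz.symm
  rw [hz'] at h
  have hz0 : z < 0 := by exact_mod_cast h
  obtain ⟨n, rfl⟩ : ∃ n : ℕ, z = -n := ⟨z.natAbs, by omega⟩
  -- If the pairing were `-n < 0`, the reflected root would be `θ + n α_j`, which is still above `β`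
  -- and higher than `θ`.
  have hr : R.root (R.reflectionPerm j θ) = R.root θ + n • R.root j := by
    rw [R.root_reflectionPerm, R.reflection_apply_root, hz']
    simp [Nat.cast_smul_eq_nsmul]
  have h1 := hθ (R.reflectionPerm j θ) (by
    rw [hr, add_sub_right_comm]
    exact add_mem hβ (nsmul_mem (simple_mem_simpleCone b hj) n))
  rw [hr, map_add, map_nsmul, heightFun_simple b hj] at h1
  simp at h1
  omega

/-- A dominant positive root involves all simple roots, and hence has a positive product with
any other dominant positive root. -/
theorem pairing_pos_of_dominant [R.IsReduced] [R.IsIrreducible] {θ θ' : ι} (h : IsPosRoot b θ)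
    (hd : ∀ i ∈ b.support, 0 ≤ R.pairing θ i)
    (hd' : ∀ i ∈ b.support, 0 ≤ R.pairing θ' i) : 0 < R.pairing θ θ' := by
  obtain ⟨c, hc⟩ := exists_coeff b h
  have hfull : ∀ i ∈ b.support, 0 < c i := by
    let q : Submodule ℚ V := Submodule.span ℚ (R.root '' {i | i ∈ b.support ∧ 0 < c i})
    -- The span `q` of the simple roots occurring in `θ` is invariant: for a simple `α_j` that does
    -- not occur, the nonnegative number `⟨θ, α_j^∨⟩` is a sum of nonpositive terms. All of them
    -- vanish, so `α_j` is orthogonal to the simple roots that occur. Irreducibility then forces `q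
    -- = ⊤`.
    have hq : ∀ i, q ∈ Module.End.invtSubmodule (R.reflection i).toLinearMap := by
      rw [← b.forall_mem_support_invtSubmodule_iff]
      intro j hj
      rw [Module.End.mem_invtSubmodule, Submodule.span_le]
      rintro _ ⟨i, ⟨hi, hci⟩, rfl⟩
      change R.reflection j (R.root i) ∈ q
      rw [R.reflection_apply_root]
      have hiq : R.root i ∈ q := Submodule.subset_span ⟨i, ⟨hi, hci⟩, rfl⟩
      refine sub_mem hiq ?_
      by_cases hcj : 0 < c j
      · exact Submodule.smul_mem _ _ (Submodule.subset_span ⟨j, ⟨hj, hcj⟩, rfl⟩)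
      suffices R.pairing i j = 0 by rw [this, zero_smul]; exact zero_mem _
      have h1 : R.pairing θ j = ∑ l ∈ b.support, c l * R.pairing l j := by
        rw [← R.root_coroot_eq_pairing, hc, map_sum, LinearMap.sum_apply]
        simp
      have h2 : ∀ l ∈ b.support, (c l : ℚ) * R.pairing l j ≤ 0 := by
        intro l hl
        by_cases hlj : l = j
        · subst hlj
          simp [Nat.eq_zero_of_not_pos hcj]
        · have := b.pairingIn_le_zero_of_ne hlj hl hj
          refine mul_nonpos_of_nonneg_of_nonpos (by positivity) ?_
          rw [← R.algebraMap_pairingIn ℤ, eq_intCast]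
          exact_mod_cast this
      have h3 := (Finset.sum_eq_zero_iff_of_nonpos h2).1
        (le_antisymm (Finset.sum_nonpos h2) (h1 ▸ hd j hj)) i hi
      rcases mul_eq_zero.1 h3 with h3 | h3
      · rw [Nat.cast_eq_zero] at h3
        omega
      · exact h3
    have hq0 : q ≠ ⊥ := by
      intro hq0
      have : R.root θ = 0 := by
        rw [hc]
        refine Finset.sum_eq_zero fun j hj => ?_
        by_cases hcj : 0 < c j
        · have : R.root j ∈ q := Submodule.subset_span ⟨j, ⟨hj, hcj⟩, rfl⟩
          rw [hq0, Submodule.mem_bot] at this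
          rw [this, smul_zero]
        · rw [Nat.eq_zero_of_not_pos hcj, zero_smul]
      exact R.ne_zero θ this
    have hq1 := RootPairing.IsIrreducible.eq_top_of_invtSubmodule_reflection q hq hq0
    intro i hi
    by_contra hci
    have h4 : R.root i ∈ q := hq1 ▸ Submodule.mem_top
    have h5 : q ≤ LinearMap.ker (b.toWeightBasis.coord ⟨i, hi⟩) := by
      rw [Submodule.span_le]
      rintro _ ⟨j, ⟨hj, hcj⟩, rfl⟩
      have hji : (⟨j, hj⟩ : b.support) ≠ ⟨i, hi⟩ := by
        rintro h
        rw [Subtype.mk.injEq] at h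
        exact hci (h ▸ hcj)
      have h6 := b.toWeightBasis_repr_root ⟨j, hj⟩
      simp only at h6
      simp [h6, hji]
    have h6 := b.toWeightBasis_repr_root ⟨i, hi⟩
    simp only at h6
    have h7 := h5 h4
    simp [h6] at h7
  have h1 : R.pairing θ θ' = ∑ l ∈ b.support, c l * R.pairing l θ' := by
    rw [← R.root_coroot_eq_pairing, hc, map_sum, LinearMap.sum_apply]
    simp
  -- All coefficients of `θ` are positive and all pairings of simple roots with `θ'` are
  -- nonnegative, so one nonzero pairing suffices.
  obtain ⟨j, hj, hj'⟩ := b.exists_mem_support_pos_pairingIn_ne_zero θ'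
  rw [h1]
  have hnn : ∀ l ∈ b.support, 0 ≤ R.pairing l θ' := fun l hl => pairing_nonneg_iff.1 (hd' l hl)
  refine Finset.sum_pos' (fun l hl => mul_nonneg (by positivity) (hnn l hl))
    ⟨j, hj, mul_pos (by exact_mod_cast hfull j hj) (lt_of_le_of_ne (hnn j hj) ?_)⟩
  rw [← R.algebraMap_pairingIn ℤ, eq_intCast]
  exact fun h => hj' (by exact_mod_cast h.symm)

/-- Let `θ` be a root of maximal height and, for a given `β`, let `θ'` be of maximal height among
the roots above `β`. Both are dominant, so their product is positive and `θ - θ'`, if nonzero, is a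
root. By maximality of `θ` this root is not negative, and `θ - β = (θ - θ') + (θ' - β)` lies in the
cone. -/
theorem exists_isHighestRoot [R.IsReduced] [R.IsIrreducible] : ∃ θ, IsHighestRoot b θ := by
  have hV := RootPairing.IsIrreducible.nontrivial R
  have hι : Nonempty ι := by
    by_contra hι
    rw [not_nonempty_iff] at hι
    have := RootPairing.IsRootSystem.span_root_eq_top (P := R)
    rw [Set.range_eq_empty, Submodule.span_empty] at this
    exact bot_ne_top this
  have hmax : ∀ β : V, (∃ i, R.root i - β ∈ simpleCone b) → ∃ θ, R.root θ - β ∈ simpleCone b ∧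
      ∀ i, R.root i - β ∈ simpleCone b → heightFun b (R.root i) ≤ heightFun b (R.root θ) := by
    rintro β ⟨i, hi⟩
    obtain ⟨θ, h1, h2⟩ := Set.exists_max_image {i | R.root i - β ∈ simpleCone b}
      (fun i => heightFun b (R.root i)) (Set.toFinite _) ⟨i, hi⟩
    exact ⟨θ, h1, h2⟩
  obtain ⟨i₀, hi₀⟩ := b.support_nonempty
  have hp₀ : IsPosRoot b i₀ := simple_mem_simpleCone b hi₀
  obtain ⟨θ, -, hθ⟩ := Set.exists_max_image Set.univ (fun i => heightFun b (R.root i))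
    (Set.toFinite _) ⟨i₀, trivial⟩
  have hθpos : IsPosRoot b θ := by
    rw [isPosRoot_iff_one_le, ← heightFun_simple b hi₀]
    exact hθ i₀ trivial
  refine ⟨θ, fun β => ?_⟩
  obtain ⟨θ', h1, h2⟩ := hmax (R.root β) ⟨β, by rw [sub_self]; exact zero_mem _⟩
  have hpair := pairing_pos_of_dominant b hθpos
    (fun i hi => pairing_simple_nonneg_of_isMax b (R.root θ) (by rw [sub_self]; exact zero_mem _)
      (fun i _ => hθ i trivial) hi)
    (fun i hi => pairing_simple_nonneg_of_isMax b _ h1 h2 hi)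
  by_cases hne : θ = θ'
  · rwa [hne]
  obtain ⟨δ, hδ⟩ := R.root_sub_root_mem_of_pairingIn_pos (i := θ) (j := θ') (by
    rw [← R.algebraMap_pairingIn ℤ] at hpair
    simpa using hpair) hne
  have hadd : R.root θ - R.root β = R.root δ + (R.root θ' - R.root β) := by rw [hδ]; abel
  by_cases hδp : IsPosRoot b δ
  · rw [hadd]
    exact add_mem hδp h1
  · have := heightFun_le_neg_one b hδp
    rw [hδ, map_sub] at this
    have := hθ θ' trivial
    linarith

end Finite

end RootSystem

/-! ### Affine roots as affine functions, and the action of the affine Weyl group -/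

section AffineRoots

variable {ι V N : Type u} [AddCommGroup V] [Module ℚ V] [AddCommGroup N] [Module ℚ N]
variable {R : RootPairing ι ℚ V N}

/-- An affine root as an affine function. -/
def AffineRoot.eval (γ : AffineRoot R) (v : N) : ℚ := R.toLinearMap (R.root γ.1) v + γ.2

theorem AffineRoot.refl_apply (γ : AffineRoot R) (v : N) :
    γ.refl.1 v = v - γ.eval v • R.coroot γ.1 := by
  change v - (R.toLinearMap (R.root γ.1) v - ((-γ.2 : ℤ) : ℚ)) • R.coroot γ.1 = _
  rw [AffineRoot.eval, Int.cast_neg, sub_neg_eq_add]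

theorem AffineRoot.refl_mul_self (γ : AffineRoot R) : γ.refl * γ.refl = 1 :=
  reflectionElt_mul_self R _ _

theorem AffineRoot.refl_inv (γ : AffineRoot R) : γ.refl⁻¹ = γ.refl :=
  inv_eq_of_mul_eq_one_left γ.refl_mul_self

/-- The value at the origin recovers the integer and the linear part recovers the root. Identities
between affine roots are therefore checked pointwise. -/
theorem AffineRoot.eval_ext {γ δ : AffineRoot R} (h : ∀ v, γ.eval v = δ.eval v) : γ = δ := by
  have h0 := h 0
  simp only [AffineRoot.eval, map_zero, zero_add] at h0
  have h0' : γ.2 = δ.2 := by exact_mod_cast h0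
  refine Prod.ext (R.root.injective ?_) h0'
  refine R.toPerfPair.injective (LinearMap.ext fun v => ?_)
  have h1 := h v
  simp only [AffineRoot.eval, h0', add_left_inj] at h1
  simpa using h1

/-- The negative of an affine root. -/
def AffineRoot.neg (γ : AffineRoot R) : AffineRoot R := (R.reflectionPerm γ.1 γ.1, -γ.2)

theorem AffineRoot.eval_neg (γ : AffineRoot R) (v : N) : γ.neg.eval v = -γ.eval v := by
  simp [AffineRoot.neg, AffineRoot.eval]
  ring

theorem AffineRoot.refl_neg (γ : AffineRoot R) : γ.neg.refl = γ.refl := by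
  refine Subtype.ext (Equiv.ext fun v => ?_)
  rw [AffineRoot.refl_apply, AffineRoot.refl_apply, AffineRoot.eval_neg]
  simp [AffineRoot.neg]

variable [R.IsCrystallographic]

theorem exists_int_pairing (i j : ι) : ∃ c : ℤ, R.pairing i j = c := by
  obtain ⟨z, hz⟩ := RootPairing.IsValuedIn.exists_value (P := R) (S := ℤ) i j
  exact ⟨z, by simpa using hz.symm⟩

theorem AffineRoot.toWeight_eq_sub {γ δ ε : AffineRoot R} (c : ℤ)
    (h : ∀ v, ε.eval v = δ.eval v - c * γ.eval v) :
    ε.toWeight = δ.toWeight - c • γ.toWeight := by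
  have h0 := h 0
  simp only [AffineRoot.eval, map_zero, zero_add] at h0
  have h0' : ε.2 = δ.2 - c * γ.2 := by exact_mod_cast h0
  refine Prod.ext (Subtype.ext ?_) (by simpa [AffineRoot.toWeight] using h0')
  change R.root ε.1 = R.root δ.1 - c • R.root γ.1
  refine R.toPerfPair.injective (LinearMap.ext fun v => ?_)
  have h1 := h v
  simp only [AffineRoot.eval, h0'] at h1
  push_cast at h1
  simp
  linarith

theorem AffineRoot.toWeight_neg (γ : AffineRoot R) : γ.neg.toWeight = -γ.toWeight := by
  have := AffineRoot.toWeight_eq_sub (γ := γ) (δ := γ) (ε := γ.neg) 2 fun v => by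
    rw [AffineRoot.eval_neg]; push_cast; ring
  rw [this, two_smul]
  abel

theorem AffineRoot.eval_refl (γ δ : AffineRoot R) (v : N) :
    δ.eval (γ.refl.1 v) = δ.eval v - R.pairing δ.1 γ.1 * γ.eval v := by
  rw [AffineRoot.refl_apply]
  simp only [AffineRoot.eval, map_sub, map_smul, R.root_coroot_eq_pairing, smul_eq_mul]
  ring

/-- The function `δ ∘ s_γ` is `δ - ⟨δ, γ^∨⟩ γ`; its linear part is a reflected root and its constant
term is an integer because the root system is crystallographic. -/
theorem exists_act_refl (γ δ : AffineRoot R) :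
    ∃ ε : AffineRoot R, (∀ v, ε.eval (γ.refl.1 v) = δ.eval v) ∧
      ε.refl = γ.refl * δ.refl * γ.refl⁻¹ := by
  obtain ⟨c, hc⟩ := exists_int_pairing (R := R) δ.1 γ.1
  have key : ∀ v, AffineRoot.eval (R := R) (R.reflectionPerm γ.1 δ.1, δ.2 - c * γ.2) v =
      δ.eval (γ.refl.1 v) := by
    intro v
    rw [AffineRoot.eval_refl, AffineRoot.eval, AffineRoot.eval, AffineRoot.eval,
      R.root_reflectionPerm, R.reflection_apply_root, hc]
    simp
    ring
  have hinv : ∀ v, γ.refl.1 (γ.refl.1 v) = v := fun v =>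
    congrArg (fun x : affineWeylGroup R => x.1 v) γ.refl_mul_self
  refine ⟨(R.reflectionPerm γ.1 δ.1, δ.2 - c * γ.2), fun v => ?_, ?_⟩
  · rw [key, hinv]
  · rw [γ.refl_inv]
    refine Subtype.ext (Equiv.ext fun v => ?_)
    change _ = γ.refl.1 (δ.refl.1 (γ.refl.1 v))
    rw [AffineRoot.refl_apply, key, δ.refl_apply, γ.refl_apply (γ.refl.1 v - _)]
    have h1 : γ.eval (γ.refl.1 v - δ.eval (γ.refl.1 v) • R.coroot δ.1) =
        γ.eval (γ.refl.1 v) - δ.eval (γ.refl.1 v) * R.pairing γ.1 δ.1 := by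
      simp only [AffineRoot.eval, map_sub, map_smul, R.root_coroot_eq_pairing, smul_eq_mul]
      ring
    have h2 : v = γ.refl.1 v - γ.eval (γ.refl.1 v) • R.coroot γ.1 := by
      rw [← γ.refl_apply, hinv]
    rw [h1, R.coroot_reflectionPerm, R.coreflection_apply_coroot]
    generalize γ.refl.1 v = w at h2 ⊢
    rw [h2]
    module

theorem exists_act (x : affineWeylGroup R) (γ : AffineRoot R) :
    ∃ δ : AffineRoot R, (∀ v, δ.eval (x.1 v) = γ.eval v) ∧ δ.refl = x * γ.refl * x⁻¹ := by
  -- The claims for `g` and `g⁻¹` are proved together, so that the case of inverses only swaps the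
  -- two halves.
  have key : ∀ g (hg : g ∈ affineWeylGroup R),
      (∀ γ : AffineRoot R, ∃ δ : AffineRoot R, (∀ v, δ.eval (g v) = γ.eval v) ∧
        δ.refl = ⟨g, hg⟩ * γ.refl * ⟨g, hg⟩⁻¹) ∧
      (∀ γ : AffineRoot R, ∃ δ : AffineRoot R, (∀ v, δ.eval (g⁻¹ v) = γ.eval v) ∧
        δ.refl = ⟨g, hg⟩⁻¹ * γ.refl * ⟨g, hg⟩) := by
    intro g hg
    induction hg using Subgroup.closure_induction with
    | mem g hg =>
      obtain ⟨i, n, rfl⟩ := hg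
      let β : AffineRoot R := (i, -n)
      have h : β.refl = ⟨affineReflection R i n, Subgroup.subset_closure ⟨i, n, rfl⟩⟩ := by
        simp [β, AffineRoot.refl, reflectionElt]
      have h' : affineReflection R i n = β.refl.1 := by rw [h]
      refine ⟨fun γ => ?_, fun γ => ?_⟩
      · obtain ⟨δ, h1, h2⟩ := exists_act_refl β γ
        refine ⟨δ, fun v => ?_, ?_⟩
        · rw [h', h1]
        · rw [h2, h]
      · obtain ⟨δ, h1, h2⟩ := exists_act_refl β γ
        refine ⟨δ, fun v => ?_, ?_⟩
        · rw [h', ← Subgroup.coe_inv, β.refl_inv, h1]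
        · rw [h2, ← h, β.refl_inv]
    | one => exact ⟨fun γ => ⟨γ, fun _ => rfl, by
        rw [show (⟨1, _⟩ : affineWeylGroup R) = 1 from rfl]; simp⟩, fun γ => ⟨γ, fun _ => rfl, by
        rw [show (⟨1, _⟩ : affineWeylGroup R) = 1 from rfl]; simp⟩⟩
    | mul x y hx hy ihx ihy =>
      have hm : (⟨x * y, mul_mem hx hy⟩ : affineWeylGroup R) = ⟨x, hx⟩ * ⟨y, hy⟩ := rfl
      refine ⟨fun γ => ?_, fun γ => ?_⟩
      · obtain ⟨δ, h1, h2⟩ := ihy.1 γ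
        obtain ⟨ε, h3, h4⟩ := ihx.1 δ
        refine ⟨ε, fun v => ?_, ?_⟩
        · rw [Equiv.Perm.mul_apply, h3, h1]
        · rw [h4, h2, hm]; group
      · obtain ⟨δ, h1, h2⟩ := ihx.2 γ
        obtain ⟨ε, h3, h4⟩ := ihy.2 δ
        refine ⟨ε, fun v => ?_, ?_⟩
        · rw [mul_inv_rev, Equiv.Perm.mul_apply, h3, h1]
        · rw [h4, h2, hm]; group
    | inv x hx ih =>
      have hm : (⟨x⁻¹, inv_mem hx⟩ : affineWeylGroup R) = ⟨x, hx⟩⁻¹ := rfl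
      refine ⟨fun γ => ?_, fun γ => ?_⟩
      · obtain ⟨δ, h1, h2⟩ := ih.2 γ
        exact ⟨δ, h1, by rw [h2, hm, inv_inv]⟩
      · obtain ⟨δ, h1, h2⟩ := ih.1 γ
        exact ⟨δ, fun v => by rw [inv_inv, h1], by rw [h2, hm, inv_inv]⟩
  exact (key x.1 x.2).1 γ

/-- The action of the affine Weyl group on the affine roots. -/
def act (x : affineWeylGroup R) (γ : AffineRoot R) : AffineRoot R := (exists_act x γ).choose

theorem eval_act_apply (x : affineWeylGroup R) (γ : AffineRoot R) (v : N) :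
    (act x γ).eval (x.1 v) = γ.eval v := (exists_act x γ).choose_spec.1 v

theorem refl_act (x : affineWeylGroup R) (γ : AffineRoot R) :
    (act x γ).refl = x * γ.refl * x⁻¹ := (exists_act x γ).choose_spec.2

theorem eval_act (x : affineWeylGroup R) (γ : AffineRoot R) (v : N) :
    (act x γ).eval v = γ.eval (x⁻¹.1 v) := by
  rw [← eval_act_apply x γ, Subgroup.coe_inv]
  exact congrArg _ (x.1.apply_symm_apply v).symm

theorem act_mul (x y : affineWeylGroup R) (γ : AffineRoot R) : act (x * y) γ = act x (act y γ) :=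
  AffineRoot.eval_ext fun v => by
    rw [eval_act, eval_act, eval_act, mul_inv_rev]
    rfl

theorem act_refl_self (γ : AffineRoot R) : act γ.refl γ = γ.neg :=
  AffineRoot.eval_ext fun v => by
    rw [eval_act, γ.refl_inv, AffineRoot.eval_refl, AffineRoot.eval_neg, R.pairing_same]
    ring

theorem act_neg (x : affineWeylGroup R) (γ : AffineRoot R) : act x γ.neg = (act x γ).neg :=
  AffineRoot.eval_ext fun v => by
    rw [eval_act, AffineRoot.eval_neg, AffineRoot.eval_neg, eval_act]

/-- The reflection formula at the level of labels. It is the reason why `x ↦ x(α_s)` changes only by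
a multiple of the label along an edge. -/
theorem toWeight_act_refl (γ δ : AffineRoot R) :
    ∃ c : ℤ, (act γ.refl δ).toWeight = δ.toWeight - c • γ.toWeight := by
  obtain ⟨c, hc⟩ := exists_int_pairing (R := R) δ.1 γ.1
  exact ⟨c, AffineRoot.toWeight_eq_sub c fun v => by
    rw [eval_act, γ.refl_inv, AffineRoot.eval_refl, hc]⟩

end AffineRoots

/-! ### The base point in the fundamental alcove -/

section Alcove

variable {ι V N : Type u} [AddCommGroup V] [Module ℚ V] [AddCommGroup N] [Module ℚ N]
variable {R : RootPairing ι ℚ V N} (b : R.Base) [R.IsRootSystem]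

theorem heightFun_root (i : ι) : heightFun b (R.root i) = b.height i := by
  obtain ⟨f, -, -, hf⟩ := b.exists_root_eq_sum_int i
  rw [RootPairing.Base.height_eq_sum hf, hf, map_sum]
  push_cast
  refine Finset.sum_congr rfl fun j hj => ?_
  rw [map_zsmul, heightFun_simple b hj]
  simp

theorem isPosRoot_iff_isPos {i : ι} : IsPosRoot b i ↔ b.IsPos i := by
  rw [isPosRoot_iff, heightFun_root, RootPairing.Base.isPos_iff]
  exact Int.cast_pos

variable [Finite ι]

open Classical in
/-- A natural number that is greater than all heights. -/
def heightBound : ℕ :=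
  letI := Fintype.ofFinite ι
  1 + ∑ i, (b.height i).natAbs

theorem height_lt_heightBound (i : ι) : |b.height i| < heightBound b := by
  let := Fintype.ofFinite ι
  have := Finset.single_le_sum (f := fun i => (b.height i).natAbs) (fun _ _ => Nat.zero_le _)
    (Finset.mem_univ i)
  have h2 : (heightBound b : ℤ) = 1 + ((∑ i, (b.height i).natAbs : ℕ) : ℤ) := by
    simp [heightBound]
  rw [h2, Int.abs_eq_natAbs]
  omega

theorem heightBound_pos : 0 < (heightBound b : ℚ) := by
  have : 0 < heightBound b := by
    rw [heightBound]
    positivity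
  exact_mod_cast this

/-- A point of the fundamental alcove. -/
def basePoint : N := (heightBound b : ℚ)⁻¹ • coweight b

/-- The value of an affine root at the point `basePoint b`, up to a positive factor. -/
def level (γ : AffineRoot R) : ℤ := b.height γ.1 + γ.2 * heightBound b

theorem eval_basePoint (γ : AffineRoot R) :
    γ.eval (basePoint b) = (heightBound b : ℚ)⁻¹ * level b γ := by
  have h : R.toLinearMap (R.root γ.1) (coweight b) = b.height γ.1 := heightFun_root b γ.1
  have := heightBound_pos b
  rw [AffineRoot.eval, basePoint, map_smul, h, level, smul_eq_mul]
  push_cast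
  field_simp

theorem eval_basePoint_pos_iff {γ : AffineRoot R} : 0 < γ.eval (basePoint b) ↔ 0 < level b γ := by
  rw [eval_basePoint, mul_pos_iff_of_pos_left (inv_pos.2 (heightBound_pos b)), Int.cast_pos]

/-- All heights are smaller than `heightBound b` in absolute value, so a nonzero integer part
decides the sign of the level; if the integer part is zero, the level is the height of the root. -/
theorem isPosAffine_iff_level {γ : AffineRoot R} : IsPosAffine b γ ↔ 0 < level b γ := by
  rw [IsPosAffine, isPosRoot_iff_isPos, RootPairing.Base.isPos_iff, level]
  have h := abs_lt.1 (height_lt_heightBound b γ.1)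
  rcases lt_trichotomy γ.2 0 with h1 | h1 | h1
  · refine iff_of_false (by omega) ?_
    have : γ.2 * (heightBound b : ℤ) ≤ -1 * heightBound b :=
      mul_le_mul_of_nonneg_right (by omega) (by positivity)
    omega
  · simp [h1]
  · refine iff_of_true (Or.inl h1) ?_
    have : 1 * (heightBound b : ℤ) ≤ γ.2 * heightBound b :=
      mul_le_mul_of_nonneg_right (by omega) (by positivity)
    omega

/-- Positivity becomes a condition at a single point. Lengths and directions of edges will be read
off from the signs of affine roots at the images of this point. -/
theorem isPosAffine_iff {γ : AffineRoot R} : IsPosAffine b γ ↔ 0 < γ.eval (basePoint b) := by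
  rw [isPosAffine_iff_level, eval_basePoint_pos_iff]

theorem eval_basePoint_ne_zero (γ : AffineRoot R) : γ.eval (basePoint b) ≠ 0 := by
  have h := abs_lt.1 (height_lt_heightBound b γ.1)
  have h0 := b.height_ne_zero γ.1
  intro h1
  rw [eval_basePoint, mul_eq_zero, inv_eq_zero, Int.cast_eq_zero, level] at h1
  have h2 := h1.resolve_left (heightBound_pos b).ne'
  rcases lt_trichotomy γ.2 0 with h1 | h1 | h1
  · have : γ.2 * (heightBound b : ℤ) ≤ -1 * heightBound b :=
      mul_le_mul_of_nonneg_right (by omega) (by positivity)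
    omega
  · simp [h1] at h2
    omega
  · have : 1 * (heightBound b : ℤ) ≤ γ.2 * heightBound b :=
      mul_le_mul_of_nonneg_right (by omega) (by positivity)
    omega

variable [R.IsCrystallographic]

theorem isPosAffine_or_neg (γ : AffineRoot R) : IsPosAffine b γ ∨ IsPosAffine b γ.neg := by
  rw [isPosAffine_iff, isPosAffine_iff, AffineRoot.eval_neg, neg_pos]
  exact (eval_basePoint_ne_zero b γ).lt_or_gt.symm

theorem eval_apply_basePoint_ne_zero (γ : AffineRoot R) (x : affineWeylGroup R) :
    γ.eval (x.1 (basePoint b)) ≠ 0 := by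
  have := eval_act x⁻¹ γ (basePoint b)
  rw [inv_inv] at this
  rw [← this]
  exact eval_basePoint_ne_zero b _

variable [R.IsReduced]

/-- Each reflection displaces the base point by a negative multiple of its coroot, so the two
coroots are positively proportional. They agree because the root system is reduced, and the size of
the displacement then determines the integer. -/
theorem eq_of_refl_eq {γ δ : AffineRoot R} (hγ : IsPosAffine b γ) (hδ : IsPosAffine b δ)
    (h : γ.refl = δ.refl) : γ = δ := by
  rw [isPosAffine_iff] at hγ hδ
  have h1 : γ.eval (basePoint b) • R.coroot γ.1 = δ.eval (basePoint b) • R.coroot δ.1 := by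
    have := congrArg (fun x : affineWeylGroup R => x.1 (basePoint b)) h
    simp only [AffineRoot.refl_apply] at this
    exact sub_right_injective this
  set c := γ.eval (basePoint b) with hc
  set d := δ.eval (basePoint b) with hd
  have h2 : R.coroot γ.1 = (c⁻¹ * d) • R.coroot δ.1 := by
    rw [mul_smul, ← h1, smul_smul, inv_mul_cancel₀ hγ.ne', one_smul]
  have := IsAddTorsionFree.of_module_rat V
  have := IsAddTorsionFree.of_module_rat N
  have h3 := (R.coroot_eq_smul_coroot_iff).1 h2
  have hcd : 0 < c⁻¹ * d := mul_pos (inv_pos.2 hγ) hδ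
  have h4 : γ.1 = δ.1 := by
    by_contra hne
    have hdep : ¬ LinearIndependent ℚ ![R.root γ.1, R.root δ.1] := by
      rw [LinearIndependent.pair_iff]
      intro h5
      have := (h5 (c⁻¹ * d) (-1) (by rw [← h3]; module)).2
      norm_num at this
    rcases RootPairing.IsReduced.eq_or_eq_neg γ.1 δ.1 hdep with h6 | h6
    · exact hne (R.root.injective h6)
    · rw [h6] at h3
      have h7 : (1 + c⁻¹ * d) • R.root δ.1 = 0 := by
        conv_lhs => rw [add_smul, one_smul]
        rw [smul_neg] at h3
        nth_rewrite 1 [h3]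
        exact neg_add_cancel _
      rcases smul_eq_zero.1 h7 with h8 | h8
      · linarith
      · exact R.ne_zero _ h8
  have h5 : c = d := by
    rw [h4] at h1
    exact smul_left_injective ℚ (R.ne_zero' δ.1) h1
  refine Prod.ext h4 ?_
  rw [hc, hd, AffineRoot.eval, AffineRoot.eval, h4, add_right_inj] at h5
  exact_mod_cast h5

end Alcove

/-! ### Simple reflections, words and the exchange property -/

section Coxeter

variable {ι V N : Type u} [AddCommGroup V] [Module ℚ V] [AddCommGroup N] [Module ℚ N]
variable {R : RootPairing ι ℚ V N} (b : R.Base) [R.IsRootSystem] [Finite ι] [R.IsCrystallographic]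

theorem pairing_highest_nonneg {θ : ι} (hθ : IsHighestRoot b θ) {i : ι} (hi : i ∈ b.support) :
    0 ≤ R.pairing θ i := by
  refine pairing_simple_nonneg_of_isMax b (R.root θ) (by rw [sub_self]; exact zero_mem _)
    (fun j _ => ?_) hi
  have := heightFun_nonneg b (hθ j)
  rw [map_sub] at this
  linarith

theorem isPosRoot_highest {θ : ι} (hθ : IsHighestRoot b θ) : IsPosRoot b θ := by
  by_contra h
  have h1 := heightFun_le_neg_one b h
  have h2 := heightFun_nonneg b (hθ (R.reflectionPerm θ θ))
  simp at h2
  linarith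

variable [R.IsReduced]

/-- A simple reflection permutes the positive roots other than its own, and it does not change the
integer part because it fixes the origin. -/
theorem pos_eval_simple {i : ι} (hi : i ∈ b.support) {γ : AffineRoot R} (hγ : IsPosAffine b γ)
    (hne : γ ≠ (i, 0)) : 0 < γ.eval ((reflectionElt R i 0).1 (basePoint b)) := by
  let α : AffineRoot R := (i, 0)
  have hα : reflectionElt R i 0 = α.refl := rfl
  rw [hα]
  have h : AffineRoot.eval (R := R) (R.reflectionPerm i γ.1, γ.2) (basePoint b) =
      γ.eval (α.refl.1 (basePoint b)) := by
    rw [AffineRoot.eval_refl]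
    simp only [AffineRoot.eval, R.root_reflectionPerm, R.reflection_apply_root, α]
    simp
    ring
  rw [← h, ← isPosAffine_iff]
  rcases hγ with hγ | ⟨h1, h2⟩
  · exact Or.inl hγ
  · refine Or.inr ⟨h1, ?_⟩
    rw [isPosRoot_iff_isPos] at h2 ⊢
    exact h2.reflectionPerm hi fun h3 => hne (Prod.ext h3 h1)

/-- The positive affine root of `s_{θ,1}` is `(-θ, 1)`. With `m = ⟨γ, θ^∨⟩` a root `(γ, n)` is sent
to `(s_θ γ, n + m)`. Dominance of `θ` gives `m ≥ 0` for positive `γ`. For negative `γ` one has `m ≤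
0` and `n ≥ 1`; then `m = -1` leads to the root `θ + γ` of the cone, and `m ≤ -2` occurs only for `γ
= -θ`. -/
theorem pos_eval_highest {θ : ι} (hθ : IsHighestRoot b θ) {γ : AffineRoot R}
    (hγ : IsPosAffine b γ) (hne : γ ≠ AffineRoot.neg (R := R) (θ, -1)) :
    0 < γ.eval ((reflectionElt R θ 1).1 (basePoint b)) := by
  let α : AffineRoot R := (θ, -1)
  have hα : reflectionElt R θ 1 = α.refl := rfl
  rw [hα]
  obtain ⟨m, hm⟩ := exists_int_pairing (R := R) γ.1 θ
  have h : AffineRoot.eval (R := R) (R.reflectionPerm θ γ.1, γ.2 + m) (basePoint b) =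
      γ.eval (α.refl.1 (basePoint b)) := by
    rw [AffineRoot.eval_refl]
    simp only [AffineRoot.eval, R.root_reflectionPerm, R.reflection_apply_root, α, hm]
    simp
    ring
  have hr : R.root (R.reflectionPerm θ γ.1) = R.root γ.1 - m • R.root θ := by
    rw [R.root_reflectionPerm, R.reflection_apply_root, hm, Int.cast_smul_eq_zsmul]
  rw [← h, ← isPosAffine_iff]
  have hnn : ∀ x ∈ simpleCone b, 0 ≤ R.toLinearMap x (R.coroot θ) := fun x hx =>
    map_nonneg_of_simple b (f := R.toLinearMap.flip (R.coroot θ)) (fun i hi => by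
      have := pairing_nonneg_iff.1 (pairing_highest_nonneg b hθ hi)
      simpa using this) hx
  by_cases hp : IsPosRoot b γ.1
  · have h1 := hnn _ hp
    rw [R.root_coroot_eq_pairing, hm] at h1
    have h1' : 0 ≤ m := by exact_mod_cast h1
    have h2 : 0 ≤ γ.2 := by
      rcases hγ with h | ⟨h, -⟩ <;> omega
    rcases (add_nonneg h2 h1').lt_or_eq with h3 | h3
    · exact Or.inl h3
    · refine Or.inr ⟨h3.symm, ?_⟩
      have h4 : m = 0 := by omega
      rw [IsPosRoot, hr, h4, zero_smul, sub_zero]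
      exact hp
  · have hneg := (b.root_mem_or_neg_mem γ.1).resolve_left hp
    have h1 := hnn _ hneg
    rw [map_neg, LinearMap.neg_apply, R.root_coroot_eq_pairing, hm] at h1
    have h1' : m ≤ 0 := by
      have : (m : ℚ) ≤ 0 := by linarith
      exact_mod_cast this
    have h2 : 0 < γ.2 := hγ.resolve_right fun h => hp h.2
    have h3 : R.root θ + R.root γ.1 ∈ simpleCone b := by
      have := hθ (R.reflectionPerm γ.1 γ.1)
      simpa using this
    rcases h1'.lt_or_eq with hm0 | hm0
    swap
    · exact Or.inl (by simp only; omega)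
    rcases (show m ≤ -1 by omega).lt_or_eq with hm1 | hm1
    swap
    · rcases (show 1 ≤ γ.2 by omega).lt_or_eq with h4 | h4
      · exact Or.inl (by simp only; omega)
      · refine Or.inr ⟨by simp only; omega, ?_⟩
        rw [IsPosRoot, hr, hm1, neg_smul, one_smul, sub_neg_eq_add, add_comm]
        exact h3
    -- Compare heights: `s_θ γ` is at most as high as `θ`, and `γ` is at least as high as `-θ`. For
    -- `m ≤ -2` both hold only if `θ + γ` has height zero, that is, `γ = -θ`.
    · have h4 := heightFun_nonneg b (hθ (R.reflectionPerm θ γ.1))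
      have h5 := (isPosRoot_iff_one_le b).1 (isPosRoot_highest b hθ)
      have h6 := heightFun_nonneg b h3
      rw [hr, map_sub, map_sub, map_zsmul, zsmul_eq_mul] at h4
      rw [map_add] at h6
      have h7 : (m : ℚ) ≤ -2 := by exact_mod_cast (show m ≤ -2 by omega)
      have h8 : heightFun b (R.root θ + R.root γ.1) = 0 := by
        rw [map_add]
        nlinarith
      have h9 : R.root θ + R.root γ.1 = 0 := by
        refine (eq_zero_or_one_le_heightFun b h3).resolve_right fun h => ?_
        rw [h8] at h
        norm_num at h
      have h10 : γ.1 = R.reflectionPerm θ θ := R.root.injective (by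
        rw [R.root_reflectionPerm, R.reflection_apply_self]
        exact (neg_eq_of_add_eq_zero_right h9).symm)
      have h11 : m = -2 := by
        have : R.pairing (R.reflectionPerm θ θ) θ = -2 := by simp
        rw [← h10, hm] at this
        exact_mod_cast this
      have h12 : γ.2 ≠ 1 := fun h12 => hne (Prod.ext h10 (by simp [AffineRoot.neg, h12]))
      rcases (show 2 ≤ γ.2 by omega).lt_or_eq with h13 | h13
      · exact Or.inl (by simp only; omega)
      · refine Or.inr ⟨by simp only; omega, ?_⟩
        rw [IsPosRoot, hr, h11, ← neg_eq_of_add_eq_zero_right h9]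
        convert isPosRoot_highest b hθ using 1
        rw [IsPosRoot]
        congr! 1
        module

/-- The common form of the finite and the affine case: the hyperplane of `α` is the only one that
separates the base point from its image under `s`. -/
theorem exists_simpleRoot (s : simpleReflections b) : ∃ α : AffineRoot R, IsPosAffine b α ∧
    α.refl = s.1 ∧ ∀ γ : AffineRoot R, IsPosAffine b γ → γ ≠ α →
      0 < γ.eval (s.1.1 (basePoint b)) := by
  obtain ⟨s, ⟨i, hi, rfl⟩ | ⟨θ, hθ, rfl⟩⟩ := s
  · exact ⟨(i, 0), Or.inr ⟨rfl, simple_mem_simpleCone b hi⟩, rfl,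
      fun γ hγ hne => pos_eval_simple b hi hγ hne⟩
  · exact ⟨AffineRoot.neg (R := R) (θ, -1), Or.inl (by simp [AffineRoot.neg]),
      by rw [AffineRoot.refl_neg]; rfl,
      fun γ hγ hne => pos_eval_highest b hθ hγ hne⟩

variable {b} in
/-- The positive affine root of a simple reflection. -/
def simpleRoot (s : simpleReflections b) : AffineRoot R := (exists_simpleRoot b s).choose

variable {b} in
theorem isPosAffine_simpleRoot (s : simpleReflections b) : IsPosAffine b (simpleRoot s) :=
  (exists_simpleRoot b s).choose_spec.1

variable {b} in
theorem refl_simpleRoot (s : simpleReflections b) : (simpleRoot s).refl = s.1 :=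
  (exists_simpleRoot b s).choose_spec.2.1

variable {b} in
theorem simpleReflections_inv (s : simpleReflections b) : s.1⁻¹ = s.1 :=
  inv_eq_of_mul_eq_one_left (simpleReflections_mul_self b s)

variable {b} in
theorem isPosAffine_act_simple (s : simpleReflections b) {γ : AffineRoot R}
    (hγ : IsPosAffine b γ) (hne : γ ≠ simpleRoot s) : IsPosAffine b (act s.1 γ) := by
  rw [isPosAffine_iff, eval_act, simpleReflections_inv]
  exact (exists_simpleRoot b s).choose_spec.2.2 γ hγ hne

variable [R.IsIrreducible]

/-- Otherwise `γ` pairs nonpositively with the simple roots and nonnegatively with `θ`, so pairing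
with `γ^∨` is nonpositive on the cone. For positive `γ` this contradicts `⟨γ, γ^∨⟩ = 2`. For
negative `γ` it is applied to `θ + γ` and contradicts `⟨θ, γ^∨⟩ + 2 > 0`. -/
theorem exists_pairing_simpleRoot_pos (γ : AffineRoot R) :
    ∃ s : simpleReflections b, 0 < R.pairing γ.1 (simpleRoot s).1 := by
  by_contra! hcon
  have h1 : ∀ i ∈ b.support, R.pairing γ.1 i ≤ 0 := by
    intro i hi
    let s : simpleReflections b := ⟨reflectionElt R i 0, Or.inl ⟨i, hi, rfl⟩⟩
    have hs : simpleRoot s = (i, 0) := eq_of_refl_eq b (isPosAffine_simpleRoot s)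
      (Or.inr ⟨rfl, simple_mem_simpleCone b hi⟩) (refl_simpleRoot s)
    have := hcon s
    rwa [hs] at this
  obtain ⟨θ, hθ⟩ := exists_isHighestRoot b
  have h2 : 0 ≤ R.pairing γ.1 θ := by
    let s : simpleReflections b := ⟨reflectionElt R θ 1, Or.inr ⟨θ, hθ, rfl⟩⟩
    have hs : simpleRoot s = AffineRoot.neg (R := R) (θ, -1) :=
      eq_of_refl_eq b (isPosAffine_simpleRoot s) (Or.inl (by simp [AffineRoot.neg]))
        ((refl_simpleRoot s).trans (by rw [AffineRoot.refl_neg]; rfl))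
    have := hcon s
    rw [hs] at this
    simpa [AffineRoot.neg] using this
  have hnn : ∀ x ∈ simpleCone b, R.toLinearMap x (R.coroot γ.1) ≤ 0 := fun x hx => by
    have := map_nonneg_of_simple b (f := -R.toLinearMap.flip (R.coroot γ.1)) (fun i hi => by
      have := pairing_nonpos_iff.1 (h1 i hi)
      simpa using this) hx
    simpa using this
  have h3 := pairing_nonneg_iff.1 h2
  by_cases hp : IsPosRoot b γ.1
  · have := hnn _ hp
    rw [R.root_coroot_eq_pairing, R.pairing_same] at this
    norm_num at this
  · have h4 : R.root θ + R.root γ.1 ∈ simpleCone b := by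
      have := hθ (R.reflectionPerm γ.1 γ.1)
      simpa using this
    have := hnn _ h4
    rw [map_add, LinearMap.add_apply, R.root_coroot_eq_pairing, R.root_coroot_eq_pairing,
      R.pairing_same] at this
    linarith

/-- Descent on `level`: a simple reflection whose root pairs positively with `γ` lowers the level,
and it keeps `γ` positive unless `γ` is its root. Consequently the conjugates of simple reflections
in `BruhatStep` include all affine reflections. -/
theorem exists_conj_simple {γ : AffineRoot R} (hγ : IsPosAffine b γ) :
    ∃ (s : simpleReflections b) (L : List (simpleReflections b)),
      γ.refl = (L.map Subtype.val).prod * s.1 * (L.map Subtype.val).prod⁻¹ := by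
  induction hn : (level b γ).toNat using Nat.strong_induction_on generalizing γ with
  | _ n ih =>
  obtain ⟨s, hs⟩ := exists_pairing_simpleRoot_pos b γ
  by_cases hne : γ = simpleRoot s
  · exact ⟨s, [], by rw [hne, refl_simpleRoot]; simp⟩
  have h1 := isPosAffine_act_simple s hγ hne
  have h2 : level b (act s.1 γ) < level b γ := by
    have h3 : (act s.1 γ).eval (basePoint b) < γ.eval (basePoint b) := by
      rw [eval_act, simpleReflections_inv, ← refl_simpleRoot s, AffineRoot.eval_refl]
      have := mul_pos hs ((isPosAffine_iff b).1 (isPosAffine_simpleRoot s))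
      linarith
    rw [eval_basePoint, eval_basePoint, mul_lt_mul_iff_right₀ (inv_pos.2 (heightBound_pos b))] at h3
    exact_mod_cast h3
  have h4 := (isPosAffine_iff_level b).1 h1
  obtain ⟨t, L, hL⟩ := ih _ (by omega) h1 rfl
  refine ⟨t, s :: L, ?_⟩
  rw [refl_act] at hL
  rw [List.map_cons, List.prod_cons]
  have : γ.refl = s.1⁻¹ * (s.1 * γ.refl * s.1⁻¹) * s.1 := by group
  rw [mul_inv_rev, simpleReflections_inv, this, hL, simpleReflections_inv]
  simp only [mul_assoc]

/-- The generating reflections belong to positive affine roots and so are conjugates of simple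
reflections by words. In particular the infimum in `length` is taken over a nonempty set. -/
theorem exists_word (w : affineWeylGroup R) :
    ∃ L : List (simpleReflections b), (L.map Subtype.val).prod = w := by
  have hinv : ∀ L : List (simpleReflections b),
      (L.map Subtype.val).prod⁻¹ = (L.reverse.map Subtype.val).prod := by
    intro L
    rw [List.prod_inv_reverse, List.map_map, List.map_reverse]
    congr 2
    exact List.map_congr_left fun s _ => simpleReflections_inv s
  have key : ∀ g (hg : g ∈ affineWeylGroup R),
      ∃ L : List (simpleReflections b), (L.map Subtype.val).prod = (⟨g, hg⟩ : affineWeylGroup R) := by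
    intro g hg
    induction hg using Subgroup.closure_induction with
    | mem g hg =>
      obtain ⟨i, n, rfl⟩ := hg
      let β : AffineRoot R := (i, -n)
      have h : β.refl = ⟨affineReflection R i n, Subgroup.subset_closure ⟨i, n, rfl⟩⟩ := by
        simp [β, AffineRoot.refl, reflectionElt]
      obtain ⟨γ, hγ, hβ⟩ : ∃ γ, IsPosAffine b γ ∧ γ.refl = β.refl := by
        rcases isPosAffine_or_neg b β with h | h
        · exact ⟨β, h, rfl⟩
        · exact ⟨β.neg, h, β.refl_neg⟩
      obtain ⟨s, L, hL⟩ := exists_conj_simple b hγ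
      refine ⟨L ++ [s] ++ L.reverse, ?_⟩
      rw [← h, ← hβ, hL, hinv]
      simp [mul_assoc]
    | one => exact ⟨[], rfl⟩
    | mul x y hx hy ihx ihy =>
      obtain ⟨L, hL⟩ := ihx
      obtain ⟨L', hL'⟩ := ihy
      exact ⟨L ++ L', by rw [List.map_append, List.prod_append, hL, hL']; rfl⟩
    | inv x hx ih =>
      obtain ⟨L, hL⟩ := ih
      exact ⟨L.reverse, by rw [← hinv, hL]; rfl⟩
  exact key w.1 w.2

theorem length_prod_le (L : List (simpleReflections b)) :
    length b (L.map Subtype.val).prod ≤ L.length := Nat.sInf_le ⟨L, rfl, rfl⟩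

theorem exists_reduced_word (w : affineWeylGroup R) :
    ∃ L : List (simpleReflections b), L.length = length b w ∧ (L.map Subtype.val).prod = w :=
  Nat.sInf_mem (s := {n | ∃ L : List (simpleReflections b),
    L.length = n ∧ (L.map Subtype.val).prod = w}) <| by
    obtain ⟨L, hL⟩ := exists_word b w
    exact ⟨L.length, L, rfl, hL⟩

theorem length_one : length b (1 : affineWeylGroup R) = 0 :=
  Nat.le_zero.1 (length_prod_le b [])

/-- The strong exchange property. -/
theorem exchange (L : List (simpleReflections b)) {γ : AffineRoot R} (hγ : IsPosAffine b γ)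
    (h : γ.eval ((L.map Subtype.val).prod.1 (basePoint b)) < 0) :
    ∃ L' : List (simpleReflections b), L'.length + 1 = L.length ∧ L'.Sublist L ∧
      γ.refl * (L.map Subtype.val).prod = (L'.map Subtype.val).prod := by
  induction L generalizing γ with
  | nil => exact absurd ((isPosAffine_iff b).1 hγ) h.not_gt
  | cons s L ih =>
    rw [List.map_cons, List.prod_cons] at h ⊢
    -- If `γ` is the root of the first letter, this letter is deleted. Otherwise `γ` stays positive
    -- when it is moved past the letter, and the induction deletes a later one. The word need not be
    -- reduced.
    by_cases hne : γ = simpleRoot s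
    · refine ⟨L, rfl, List.sublist_cons_self s L, ?_⟩
      rw [hne, refl_simpleRoot, ← mul_assoc, simpleReflections_mul_self, one_mul]
    · obtain ⟨L', h1, h2, h3⟩ := ih (isPosAffine_act_simple s hγ hne) (by
        rw [eval_act, simpleReflections_inv]
        exact h)
      refine ⟨s :: L', by simp [h1], h2.cons_cons s, ?_⟩
      rw [List.map_cons, List.prod_cons, ← h3, refl_act, simpleReflections_inv]
      simp only [mul_assoc]
      rw [← mul_assoc s.1 s.1, simpleReflections_mul_self, one_mul]

/-- The exchange property for a reduced word of `w`. With its two converses below, the sign of `γ`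
at `w (basePoint b)` decides which of `w` and `s_γ w` is longer. -/
theorem length_refl_mul_lt {γ : AffineRoot R} (hγ : IsPosAffine b γ) {w : affineWeylGroup R}
    (h : γ.eval (w.1 (basePoint b)) < 0) : length b (γ.refl * w) < length b w := by
  obtain ⟨L, hL, rfl⟩ := exists_reduced_word b w
  obtain ⟨L', h1, -, h3⟩ := exchange b L hγ h
  rw [h3, ← hL, ← h1]
  exact Nat.lt_succ_of_le (length_prod_le b L')

theorem eval_refl_mul (γ : AffineRoot R) (w : affineWeylGroup R) (v : N) :
    γ.eval ((γ.refl * w).1 v) = -γ.eval (w.1 v) := by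
  change γ.eval (γ.refl.1 (w.1 v)) = _
  rw [AffineRoot.eval_refl, R.pairing_same]
  ring

theorem length_lt_refl_mul {γ : AffineRoot R} (hγ : IsPosAffine b γ) {w : affineWeylGroup R}
    (h : 0 < γ.eval (w.1 (basePoint b))) : length b w < length b (γ.refl * w) := by
  have := length_refl_mul_lt b hγ (w := γ.refl * w) (by rw [eval_refl_mul]; linarith)
  rwa [← mul_assoc, γ.refl_mul_self, one_mul] at this

theorem eval_pos_of_length_lt {γ : AffineRoot R} (hγ : IsPosAffine b γ) {w : affineWeylGroup R}
    (h : length b w < length b (γ.refl * w)) : 0 < γ.eval (w.1 (basePoint b)) := by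
  refine lt_of_not_ge fun h1 => ?_
  exact h.not_gt (length_refl_mul_lt b hγ (lt_of_le_of_ne h1 (eval_apply_basePoint_ne_zero b γ w)))

theorem length_mul_simple_le (w : affineWeylGroup R) (s : simpleReflections b) :
    length b (w * s.1) ≤ length b w + 1 := by
  obtain ⟨L, hL, rfl⟩ := exists_reduced_word b w
  have := length_prod_le b (L ++ [s])
  simpa [hL] using this

theorem mul_simple_mul_simple (w : affineWeylGroup R) (s : simpleReflections b) :
    w * s.1 * s.1 = w := by
  rw [mul_assoc, simpleReflections_mul_self, mul_one]

end Coxeter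

/-! ### Edges of the moment graph and the cosets `{x, xs}` -/

section Edges

variable {ι V N : Type u} [AddCommGroup V] [Module ℚ V] [AddCommGroup N] [Module ℚ N]
variable {R : RootPairing ι ℚ V N} {b : R.Base} [R.IsRootSystem] [Finite ι] [R.IsCrystallographic]
variable [R.IsReduced] [R.IsIrreducible]

theorem bruhatStep_refl_mul {γ : AffineRoot R} (hγ : IsPosAffine b γ) {w : affineWeylGroup R}
    (h : 0 < γ.eval (w.1 (basePoint b))) : BruhatStep b w (γ.refl * w) := by
  obtain ⟨s, L, hL⟩ := exists_conj_simple b hγ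
  exact ⟨length_lt_refl_mul b hγ h, s, _, by rw [← hL]⟩

theorem BruhatStep.exists_root {x y : affineWeylGroup R} (h : BruhatStep b x y) :
    ∃ γ : AffineRoot R, IsPosAffine b γ ∧ y = γ.refl * x ∧ 0 < γ.eval (x.1 (basePoint b)) := by
  obtain ⟨hlt, s, w, rfl⟩ := h
  obtain ⟨γ, hγ, h⟩ : ∃ γ, IsPosAffine b γ ∧ γ.refl = w * s.1 * w⁻¹ := by
    have h := refl_act w (simpleRoot s)
    rw [refl_simpleRoot] at h
    rcases isPosAffine_or_neg b (act w (simpleRoot s)) with h' | h'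
    · exact ⟨_, h', h⟩
    · exact ⟨_, h', by rw [AffineRoot.refl_neg, h]⟩
  rw [← h] at hlt
  exact ⟨γ, hγ, by rw [h], eval_pos_of_length_lt b hγ hlt⟩

namespace AffineEdge

theorem length_lt (E : AffineEdge b) : length b E.src < length b E.tgt :=
  (bruhatLE_length b E.src_le).resolve_left E.src_ne

theorem eval_pos (E : AffineEdge b) : 0 < E.root.eval (E.src.1 (basePoint b)) :=
  eval_pos_of_length_lt b E.pos (by rw [← E.eq_mul]; exact E.length_lt)

theorem refl_mul_tgt (E : AffineEdge b) : E.root.refl * E.tgt = E.src := by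
  rw [E.eq_mul, ← mul_assoc, AffineRoot.refl_mul_self, one_mul]

theorem eval_tgt_neg (E : AffineEdge b) : E.root.eval (E.tgt.1 (basePoint b)) < 0 := by
  rw [E.eq_mul, eval_refl_mul]
  linarith [E.eval_pos]

theorem eq_of_src_tgt {E D : AffineEdge b} (hs : E.src = D.src) (ht : E.tgt = D.tgt) : E = D :=
  AffineEdge.ext hs ht <| eq_of_refl_eq b E.pos D.pos <| by
    have h1 := E.eq_mul
    rw [ht, D.eq_mul, hs] at h1
    exact (mul_right_cancel h1).symm

/-- The edge from `x` to `s_γ x`. -/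
def ofRoot (γ : AffineRoot R) (hγ : IsPosAffine b γ) (x : affineWeylGroup R)
    (h : 0 < γ.eval (x.1 (basePoint b))) : AffineEdge b where
  src := x
  tgt := γ.refl * x
  root := γ
  pos := hγ
  src_le := .single (bruhatStep_refl_mul hγ h)
  src_ne := fun h' => (length_lt_refl_mul b hγ h).ne (congrArg _ h')
  eq_mul := rfl

end AffineEdge

theorem coe_mul_simple (s : simpleReflections b) (x : affineWeylGroup R) :
    ((x * s.1 : affineWeylGroup R) : Cosets b s) = x := by
  rw [eq_comm, QuotientGroup.eq, inv_mul_cancel_left]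
  exact Subgroup.mem_zpowers s.1

/-- If `x → s_γ x` is an edge and `s_γ x ≠ x s`, then `x s → s_γ x s` is an edge. -/
theorem eval_mul_simple_pos (s : simpleReflections b) {γ : AffineRoot R}
    {x : affineWeylGroup R} (h : 0 < γ.eval (x.1 (basePoint b)))
    (hne : ((γ.refl * x : affineWeylGroup R) : Cosets b s) ≠ x) :
    0 < γ.eval ((x * s.1).1 (basePoint b)) := by
  have h1 : ∀ v, γ.eval (x.1 v) = (act x⁻¹ γ).eval v := fun v => by rw [eval_act, inv_inv]
  change 0 < γ.eval (x.1 (s.1.1 (basePoint b)))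
  rw [h1, ← isPosAffine_iff] at h
  rw [h1]
  -- The root `x⁻¹ γ` is positive, and `s` can make it negative only if it is the simple root of
  -- `s`; but then `s_γ x = xs`.
  have h2 := isPosAffine_act_simple s h (by
    intro h3
    refine hne ?_
    have h4 : γ.refl * x = x * s.1 := by
      have h5 := refl_act x⁻¹ γ
      rw [h3, refl_simpleRoot, inv_inv] at h5
      rw [h5]
      group
    rw [h4, coe_mul_simple])
  rw [isPosAffine_iff, eval_act, simpleReflections_inv] at h2
  exact h2

/-- The edge `xs → ys` for an edge `x → y`. -/
def AffineEdge.mulSimple (s : simpleReflections b) (E : AffineEdge b)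
    (h : (E.src : Cosets b s) ≠ E.tgt) : AffineEdge b :=
  .ofRoot E.root E.pos (E.src * s.1)
    (eval_mul_simple_pos s E.eval_pos (by rw [← E.eq_mul]; exact h.symm))

theorem AffineEdge.tgt_mulSimple (s : simpleReflections b) (E : AffineEdge b)
    (h : (E.src : Cosets b s) ≠ E.tgt) : (E.mulSimple s h).tgt = E.tgt * s.1 := by
  rw [E.eq_mul, mul_assoc]
  rfl

/-- One edge over `E` exists by definition and its translate by `s` is another; their sources
exhaust the coset. Thus an edge of the quotient graph sees both elements of a coset. -/
theorem exists_edgesOver_src (s : simpleReflections b) (E : QuotientEdge b s)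
    (u : affineWeylGroup R) (hu : (u : Cosets b s) = E.src) :
    ∃ D ∈ edgesOver b s E, D.src = u := by
  obtain ⟨D, h1, h2, h3⟩ := E.exists_edge
  rcases eq_or_eq_mul b s D.src u (h1.trans hu.symm) with h | h
  · exact ⟨D, ⟨h1, h2, h3⟩, h.symm⟩
  · have hne : (D.src : Cosets b s) ≠ D.tgt := by
      rw [h1, h2]
      exact E.src_ne
    refine ⟨D.mulSimple s hne, ⟨?_, ?_, h3⟩, h.symm⟩
    · exact (coe_mul_simple s D.src).trans h1
    · rw [D.tgt_mulSimple, coe_mul_simple, h2]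

theorem exists_edgesOver_tgt (s : simpleReflections b) (E : QuotientEdge b s)
    (u : affineWeylGroup R) (hu : (u : Cosets b s) = E.tgt) :
    ∃ D ∈ edgesOver b s E, D.tgt = u := by
  obtain ⟨D, h1, h2, h3⟩ := E.exists_edge
  rcases eq_or_eq_mul b s D.tgt u (h2.trans hu.symm) with h | h
  · exact ⟨D, ⟨h1, h2, h3⟩, h.symm⟩
  · have hne : (D.src : Cosets b s) ≠ D.tgt := by
      rw [h1, h2]
      exact E.src_ne
    refine ⟨D.mulSimple s hne, ⟨?_, ?_, h3⟩, ?_⟩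
    · exact (coe_mul_simple s D.src).trans h1
    · rw [D.tgt_mulSimple, coe_mul_simple, h2]
    · rw [D.tgt_mulSimple, h]

theorem AffineEdge.mem_edgesOver_bar (s : simpleReflections b) (E : AffineEdge b)
    (h : (E.src : Cosets b s) ≠ E.tgt) : E ∈ edgesOver b s (E.bar s h) := ⟨rfl, rfl, rfl⟩

theorem AffineEdge.tgt_eq_mul_simple (s : simpleReflections b) (E : AffineEdge b)
    (h : (E.src : Cosets b s) = E.tgt) : E.tgt = E.src * s.1 :=
  (eq_or_eq_mul b s E.src E.tgt h).resolve_left E.src_ne.symm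

theorem AffineEdge.src_eq_mul_simple (s : simpleReflections b) (E : AffineEdge b)
    (h : (E.src : Cosets b s) = E.tgt) : E.src = E.tgt * s.1 := by
  rw [E.tgt_eq_mul_simple s h, mul_simple_mul_simple]

/-- Such an edge joins the two elements of its coset and points to the longer one. -/
theorem AffineEdge.eq_of_coset (s : simpleReflections b) {E D : AffineEdge b}
    (h : (E.src : Cosets b s) = E.tgt) (h' : (D.src : Cosets b s) = D.tgt)
    (hED : (E.src : Cosets b s) = D.src) : E = D := by
  rcases eq_or_eq_mul b s _ _ hED with h1 | h1
  · exact eq_of_src_tgt h1.symm (by rw [E.tgt_eq_mul_simple s h, D.tgt_eq_mul_simple s h', h1])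
  · have h2 : D.src = E.tgt := by rw [h1, E.tgt_eq_mul_simple s h]
    have h3 : D.tgt = E.src := by rw [D.tgt_eq_mul_simple s h', h2, E.src_eq_mul_simple s h]
    have h4 := D.length_lt
    rw [h2, h3] at h4
    exact absurd E.length_lt h4.not_gt

theorem exists_wallEdge (s : simpleReflections b) (c : Cosets b s) :
    ∃ E : AffineEdge b, (E.src : Cosets b s) = c ∧ (E.tgt : Cosets b s) = c := by
  obtain ⟨x, rfl⟩ := QuotientGroup.mk_surjective c
  obtain ⟨γ, hγ, h⟩ : ∃ γ, IsPosAffine b γ ∧ γ.refl = x * s.1 * x⁻¹ := by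
    have h := refl_act x (simpleRoot s)
    rw [refl_simpleRoot] at h
    rcases isPosAffine_or_neg b (act x (simpleRoot s)) with h' | h'
    · exact ⟨_, h', h⟩
    · exact ⟨_, h', by rw [AffineRoot.refl_neg, h]⟩
  have h1 : γ.refl * x = x * s.1 := by
    rw [h]
    group
  rcases (eval_apply_basePoint_ne_zero b γ x).lt_or_gt with h2 | h2
  · refine ⟨.ofRoot γ hγ (x * s.1) (by rw [← h1, eval_refl_mul]; linarith), coe_mul_simple s x, ?_⟩
    change ((γ.refl * (x * s.1) : affineWeylGroup R) : Cosets b s) = x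
    rw [← h1, ← mul_assoc, γ.refl_mul_self, one_mul]
  · refine ⟨.ofRoot γ hγ x h2, rfl, ?_⟩
    change ((γ.refl * x : affineWeylGroup R) : Cosets b s) = x
    rw [h1, coe_mul_simple]

/-- The edge that connects the two elements of a coset. -/
def wallEdge (s : simpleReflections b) (c : Cosets b s) : AffineEdge b :=
  (exists_wallEdge s c).choose

theorem wallEdge_src (s : simpleReflections b) (c : Cosets b s) :
    ((wallEdge s c).src : Cosets b s) = c := (exists_wallEdge s c).choose_spec.1

theorem wallEdge_tgt (s : simpleReflections b) (c : Cosets b s) :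
    ((wallEdge s c).tgt : Cosets b s) = c := (exists_wallEdge s c).choose_spec.2

theorem wallEdge_coset (s : simpleReflections b) (c : Cosets b s) :
    ((wallEdge s c).src : Cosets b s) = (wallEdge s c).tgt := by
  rw [wallEdge_src, wallEdge_tgt]

theorem eq_wallEdge (s : simpleReflections b) {c : Cosets b s} {E : AffineEdge b}
    (hs : (E.src : Cosets b s) = c) (ht : (E.tgt : Cosets b s) = c) : E = wallEdge s c :=
  E.eq_of_coset s (hs.trans ht.symm) (wallEdge_coset s c) (by rw [hs, wallEdge_src])

theorem eq_src_or_tgt (s : simpleReflections b) {c : Cosets b s} {x : affineWeylGroup R}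
    (hx : (x : Cosets b s) = c) : x = (wallEdge s c).src ∨ x = (wallEdge s c).tgt := by
  rw [AffineEdge.tgt_eq_mul_simple s _ (wallEdge_coset s c)]
  exact eq_or_eq_mul b s _ _ (by rw [wallEdge_src, hx])

end Edges

/-! ### The Bruhat order and the order on cosets -/

section Bruhat

variable {ι V N : Type u} [AddCommGroup V] [Module ℚ V] [AddCommGroup N] [Module ℚ N]
variable {R : RootPairing ι ℚ V N} {b : R.Base} [R.IsRootSystem] [Finite ι] [R.IsCrystallographic]
variable [R.IsReduced] [R.IsIrreducible] (s : simpleReflections b)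

theorem BruhatStep.mul_simple {x y : affineWeylGroup R} (h : BruhatStep b x y)
    (hne : (x : Cosets b s) ≠ y) : BruhatStep b (x * s.1) (y * s.1) := by
  obtain ⟨γ, hγ, rfl, h1⟩ := h.exists_root
  rw [mul_assoc]
  exact bruhatStep_refl_mul hγ (eval_mul_simple_pos s h1 hne.symm)

/-- A chain is multiplied by `s` step by step, where steps inside a coset are omitted. Together with
the lifting from the other end below, this shows that the image of an open set and the set of cosets
contained in it are both open. -/
theorem bruhatLE_lift_up {u v : affineWeylGroup R} (h : bruhatLE b u v) {u' : affineWeylGroup R}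
    (hu : (u' : Cosets b s) = u) :
    ∃ v' : affineWeylGroup R, (v' : Cosets b s) = v ∧ bruhatLE b u' v' := by
  induction h with
  | refl => exact ⟨u', hu, .refl⟩
  | @tail v w _ h ih =>
    obtain ⟨v', hv, h1⟩ := ih
    rcases eq_or_eq_mul b s v v' hv.symm with rfl | rfl
    · exact ⟨w, rfl, h1.tail h⟩
    · by_cases hne : (v : Cosets b s) = w
      · exact ⟨_, (coe_mul_simple s v).trans hne, h1⟩
      · exact ⟨w * s.1, coe_mul_simple s w, h1.tail (h.mul_simple s hne)⟩

theorem bruhatLE_lift_down {u v : affineWeylGroup R} (h : bruhatLE b u v) {v' : affineWeylGroup R}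
    (hv : (v' : Cosets b s) = v) :
    ∃ u' : affineWeylGroup R, (u' : Cosets b s) = u ∧ bruhatLE b u' v' := by
  induction h using Relation.ReflTransGen.head_induction_on with
  | refl => exact ⟨v', hv, .refl⟩
  | @head u w h _ ih =>
    obtain ⟨w', hw, h1⟩ := ih
    rcases eq_or_eq_mul b s w w' hw.symm with rfl | rfl
    · exact ⟨u, rfl, .head h h1⟩
    · by_cases hne : (u : Cosets b s) = w
      · exact ⟨_, (coe_mul_simple s w).trans hne.symm, h1⟩
      · exact ⟨u * s.1, coe_mul_simple s u, .head (h.mul_simple s hne) h1⟩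

variable (k : Type u) [Field k]

theorem quotient_le_of_bruhatLE {u v : affineWeylGroup R} (h : bruhatLE b u v) :
    (quotientGraph b k s).le (u : Cosets b s) (v : Cosets b s) := by
  by_cases hne : (u : Cosets b s) = v
  · exact Or.inl hne
  · exact Or.inr ⟨hne, u, v, rfl, rfl, h, fun h => hne (congrArg _ h)⟩

variable {k} in
theorem exists_bruhatLE_of_quotient_le {c d : Cosets b s} (h : (quotientGraph b k s).le c d) :
    ∃ u v : affineWeylGroup R, (u : Cosets b s) = c ∧ (v : Cosets b s) = d ∧ bruhatLE b u v := by
  rcases h with rfl | ⟨-, u, v, hu, hv, h, -⟩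
  · obtain ⟨x, rfl⟩ := QuotientGroup.mk_surjective c
    exact ⟨x, x, rfl, rfl, .refl⟩
  · exact ⟨u, v, hu, hv, h⟩

variable {k} in
theorem quotient_le_lift_up {c d : Cosets b s} (h : (quotientGraph b k s).le c d)
    {u : affineWeylGroup R} (hu : (u : Cosets b s) = c) :
    ∃ v : affineWeylGroup R, (v : Cosets b s) = d ∧ bruhatLE b u v := by
  obtain ⟨x, y, rfl, rfl, hxy⟩ := exists_bruhatLE_of_quotient_le s h
  exact bruhatLE_lift_up s hxy hu

variable {k} in
theorem quotient_le_lift_down {c d : Cosets b s} (h : (quotientGraph b k s).le c d)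
    {v : affineWeylGroup R} (hv : (v : Cosets b s) = d) :
    ∃ u : affineWeylGroup R, (u : Cosets b s) = c ∧ bruhatLE b u v := by
  obtain ⟨x, y, rfl, rfl, hxy⟩ := exists_bruhatLE_of_quotient_le s h
  exact bruhatLE_lift_down s hxy hv

theorem quotientGraph_isMomentGraph (hk : ringChar k ≠ 2) :
    (quotientGraph b k s).IsMomentGraph where
  label_ne_zero E := label_ne_zero k hk E.root
  le_refl _ := Or.inl rfl
  le_trans x y z h h' := by
    obtain ⟨u, v, rfl, hv, h1⟩ := exists_bruhatLE_of_quotient_le s h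
    obtain ⟨w, rfl, h2⟩ := quotient_le_lift_up s h' hv
    exact quotient_le_of_bruhatLE s k (h1.trans h2)
  le_antisymm x y h h' := by
    by_contra hne
    -- A chain `u < v < u'` raises the length by at least two, whereas `u'` lies in the coset of
    -- `u`, so it is `u` or `us`.
    obtain ⟨u, v, rfl, rfl, h1⟩ := exists_bruhatLE_of_quotient_le s h
    obtain ⟨u', hu', h2⟩ := quotient_le_lift_up s h' rfl
    obtain ⟨v', hv', h3⟩ := quotient_le_lift_up s h hu'
    have l1 := (bruhatLE_length b h1).resolve_left fun h => hne (congrArg _ h)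
    have l2 := (bruhatLE_length b h2).resolve_left fun h => hne (by rw [h, hu'])
    have l3 := (bruhatLE_length b h3).resolve_left fun h => hne (by rw [← hv', ← h, hu'])
    rcases eq_or_eq_mul b s u u' hu'.symm with rfl | rfl
    · omega
    · have := length_mul_simple_le b u s
      omega
  src_le_tgt E := by
    obtain ⟨D, h1, h2, -⟩ := E.exists_edge
    change (quotientGraph b k s).le E.src E.tgt
    rw [← h1, ← h2]
    exact quotient_le_of_bruhatLE s k D.src_le
  src_ne_tgt E := E.src_ne

end Bruhat

/-! ### The function `x ↦ x(α_s)` on the vertices -/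

section Labels

variable {ι V N : Type u} [AddCommGroup V] [Module ℚ V] [AddCommGroup N] [Module ℚ N]
variable {R : RootPairing ι ℚ V N} {b : R.Base} [R.IsRootSystem] [Finite ι] [R.IsCrystallographic]
variable [R.IsReduced] (k : Type u) [Field k] (s : simpleReflections b)

/-- The image of the simple affine root of `s` under `x`, as a label. -/
def wallLabel (x : affineWeylGroup R) : LabelSpace R k := 1 ⊗ₜ (act x (simpleRoot s)).toWeight

theorem wallLabel_mul_simple (x : affineWeylGroup R) :
    wallLabel k s (x * s.1) = -wallLabel k s x := by
  rw [wallLabel, wallLabel, act_mul, ← refl_simpleRoot s, act_refl_self, act_neg,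
    AffineRoot.toWeight_neg, TensorProduct.tmul_neg]

/-- The reflection formula for the affine root `x(α_s)`. It makes `x ↦ x(α_s)` a section of the
structure sheaf, which can be multiplied with sections of any sheaf. -/
theorem wallLabel_refl_mul (γ : AffineRoot R) (x : affineWeylGroup R) :
    ∃ c : k, wallLabel k s (γ.refl * x) = wallLabel k s x - c • (1 ⊗ₜ γ.toWeight) := by
  obtain ⟨c, hc⟩ := toWeight_act_refl γ (act x (simpleRoot s))
  refine ⟨(c : k), ?_⟩
  rw [wallLabel, act_mul, hc, TensorProduct.tmul_sub, TensorProduct.tmul_smul, wallLabel,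
    Int.cast_smul_eq_zsmul]

variable [R.IsIrreducible]

/-- The root of the edge and `x(α_s)` have the same reflection, so they agree up to sign; both are
positive at the image of the base point under the source `x`. -/
theorem label_eq_wallLabel (E : AffineEdge b) (h : (E.src : Cosets b s) = E.tgt) :
    (affineGraph b k).label E = wallLabel k s E.src := by
  have h1 : E.root.refl = (act E.src (simpleRoot s)).refl := by
    have h2 := E.eq_mul
    rw [E.tgt_eq_mul_simple s h] at h2
    rw [refl_act, refl_simpleRoot, h2, mul_inv_cancel_right]
  have h3 : 0 < (act E.src (simpleRoot s)).eval (E.src.1 (basePoint b)) := by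
    rw [eval_act_apply, ← isPosAffine_iff]
    exact isPosAffine_simpleRoot s
  suffices E.root = act E.src (simpleRoot s) by
    change (1 ⊗ₜ E.root.toWeight : LabelSpace R k) = _
    rw [this]
    rfl
  rcases isPosAffine_or_neg b (act E.src (simpleRoot s)) with h4 | h4
  · exact eq_of_refl_eq b E.pos h4 h1
  · have h5 := eq_of_refl_eq b E.pos h4 (by rw [AffineRoot.refl_neg, h1])
    have h6 := E.eval_pos
    rw [h5, AffineRoot.eval_neg] at h6
    linarith

end Labels

/-! ### Products of subsequences -/

section Subwords

variable {ι V N : Type u} [AddCommGroup V] [Module ℚ V] [AddCommGroup N] [Module ℚ N]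
variable {R : RootPairing ι ℚ V N} {b : R.Base}

theorem mem_subwordProducts_concat {L : List (simpleReflections b)} (s : simpleReflections b)
    {x : affineWeylGroup R} (hx : x ∈ subwordProducts L) : x ∈ subwordProducts (L ++ [s]) := by
  obtain ⟨σ, h, rfl⟩ := hx
  exact ⟨σ, h.trans (List.sublist_append_left L [s]), rfl⟩

theorem mul_mem_subwordProducts_concat {L : List (simpleReflections b)} (s : simpleReflections b)
    {x : affineWeylGroup R} (hx : x ∈ subwordProducts L) :
    x * s.1 ∈ subwordProducts (L ++ [s]) := by
  obtain ⟨σ, h, rfl⟩ := hx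
  exact ⟨σ ++ [s], h.append (List.Sublist.refl _), by simp⟩

variable [R.IsRootSystem] [Finite ι] [R.IsCrystallographic] [R.IsReduced] [R.IsIrreducible]

/-- The root of the edge is negative at the image of the base point under the target, so the
exchange property deletes a letter from any subsequence with product the target. Hence edges ending
in `subwordProducts L` also start there, and a GKM-hypothesis on this set applies to them. -/
theorem AffineEdge.src_mem_subwordProducts {L : List (simpleReflections b)} (E : AffineEdge b)
    (h : E.tgt ∈ subwordProducts L) : E.src ∈ subwordProducts L := by
  obtain ⟨σ, hσ, h⟩ := h
  obtain ⟨σ', -, h1, h2⟩ := exchange b σ E.pos (by rw [h]; exact E.eval_tgt_neg)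
  exact ⟨σ', h1.trans hσ, by rw [← h2, h, E.refl_mul_tgt]⟩

end Subwords

/-! ### Graded free modules over the symmetric algebra -/

section Algebra

variable {k U : Type u} [Field k] [AddCommGroup U] [Module k U]

instance : IsDomain (SymmetricAlgebra k U) :=
  (SymmetricAlgebra.equivMvPolynomial (Module.Free.chooseBasis k U)).toMulEquiv.isDomain _

/-- A nonzero vector is part of a basis, hence a variable of a polynomial ring. -/
theorem prime_ι {β : U} (hβ : β ≠ 0) : Prime (SymmetricAlgebra.ι k U β) := by
  have hli : LinearIndepOn k id ({β} : Set U) := LinearIndepOn.singleton hβ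
  let B := Module.Basis.extend hli
  let i : hli.extend (Set.subset_univ _) := ⟨β, hli.subset_extend _ (Set.mem_singleton β)⟩
  have hi : B i = β := Module.Basis.extend_apply_self hli i
  have h := SymmetricAlgebra.equivMvPolynomial_ι_apply B i
  rw [show B i = β from hi] at h
  rw [← MulEquiv.prime_iff (SymmetricAlgebra.equivMvPolynomial B), h]
  exact MvPolynomial.X_prime

/-- A functional that vanishes at `β` but not at `γ` extends to an algebra homomorphism to `k`,
which contradicts divisibility. -/
theorem not_dvd_ι {β γ : U} (h : ∀ c : k, γ ≠ c • β) :
    ¬ SymmetricAlgebra.ι k U β ∣ SymmetricAlgebra.ι k U γ := by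
  intro hdvd
  have hγ : γ ∉ Submodule.span k {β} := fun hmem => by
    obtain ⟨c, hc⟩ := Submodule.mem_span_singleton.1 hmem
    exact h c hc.symm
  obtain ⟨f, hf, hle⟩ := Submodule.exists_le_ker_of_notMem hγ
  have h1 := map_dvd (SymmetricAlgebra.lift f) hdvd
  have h2 : f β = 0 := hle (Submodule.mem_span_singleton_self β)
  rw [SymmetricAlgebra.lift_ι_apply, SymmetricAlgebra.lift_ι_apply, h2, zero_dvd_iff] at h1
  exact hf h1

theorem algebraMapInv_of_mem_symDeg {i : ℤ} (hi : i ≠ 0) {a : SymmetricAlgebra k U}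
    (ha : a ∈ symDeg k U i) : SymmetricAlgebra.algebraMapInv a = 0 := by
  unfold symDeg at ha
  split_ifs at ha with h
  · obtain ⟨n, hn⟩ : ∃ n, (i / 2).toNat = n + 1 := by
      obtain ⟨h0, m, rfl⟩ := h
      exact ⟨(m - 1).toNat, by omega⟩
    rw [hn, pow_succ] at ha
    refine Submodule.mul_induction_on ha ?_ fun x y hx hy => by rw [map_add, hx, hy, add_zero]
    rintro x _ y ⟨u, rfl⟩
    rw [map_mul, SymmetricAlgebra.algebraMapInv_ι, mul_zero]
  · rw [(Submodule.mem_bot k).1 ha, map_zero]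

theorem algebraMap_mem_symDeg (c : k) : algebraMap k (SymmetricAlgebra k U) c ∈ symDeg k U 0 := by
  rw [symDeg, if_pos (by decide)]
  exact Submodule.mem_one.2 ⟨c, by simp⟩

namespace GrMod

theorem IsFree.eq_zero_of_smul {M : GrMod k U} (hM : M.IsFree) {β : U} (hβ : β ≠ 0) {m : M}
    (h : SymmetricAlgebra.ι k U β • m = 0) : m = 0 := by
  obtain ⟨n, r, e, -⟩ := hM
  rw [← e.symm.map_eq_zero_iff] at h ⊢
  rw [map_smul] at h
  exact (smul_eq_zero.1 h).resolve_left (prime_ι hβ).ne_zero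

/-- In each coordinate, `ι β` is prime and does not divide `ι γ`. This is the algebraic form in
which the GKM-property is used: `γ` acts injectively on `M / β M`. -/
theorem IsFree.mem_mulSubmodule_of_smul {M : GrMod k U} (hM : M.IsFree) {β γ : U} (hβ : β ≠ 0)
    (hγ : ∀ c : k, γ ≠ c • β) {m : M} (h : SymmetricAlgebra.ι k U γ • m ∈ M.mulSubmodule β) :
    m ∈ M.mulSubmodule β := by
  obtain ⟨n, r, e, -⟩ := hM
  obtain ⟨m', hm'⟩ := h
  have h1 : ∀ j, SymmetricAlgebra.ι k U β ∣ e.symm m j := by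
    intro j
    have h2 : SymmetricAlgebra.ι k U β * e.symm m' j = SymmetricAlgebra.ι k U γ * e.symm m j := by
      have h3 := congrArg (fun x => e.symm x j) hm'
      change e.symm (SymmetricAlgebra.ι k U β • m') j = e.symm (SymmetricAlgebra.ι k U γ • m) j at h3
      rwa [map_smul, map_smul] at h3
    exact ((prime_ι hβ).dvd_or_dvd (Dvd.intro _ h2)).resolve_left (not_dvd_ι hγ)
  choose c hc using h1
  refine ⟨e c, ?_⟩
  change SymmetricAlgebra.ι k U β • e c = m
  rw [← map_smul, ← e.eq_symm_apply]
  exact funext fun j => (hc j).symm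

theorem deg_ext_comp {M : GrMod k U} {i : ℤ} {m : M} (h : ∀ j, j ≠ i → M.comp j m = 0) :
    m ∈ M.deg i := by
  obtain ⟨s, hs⟩ := M.exists_sum m
  rw [← hs]
  refine sum_mem fun j _ => ?_
  by_cases hj : j = i
  · rw [← hj]
    exact M.comp_mem j m
  · rw [h j hj]
    exact zero_mem _

theorem IsFree.mem_deg_of_smul_mem {M : GrMod k U} (hM : M.IsFree) {β : U} (hβ : β ≠ 0) {i : ℤ}
    {m : M} (h : SymmetricAlgebra.ι k U β • m ∈ M.deg i) : m ∈ M.deg (i - 2) := by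
  refine deg_ext_comp fun j hj => hM.eq_zero_of_smul hβ ?_
  rw [← M.smul_comp 2 j _ (ι_mem β), M.comp_ne _ i _ (by omega) h]

/-- Sign convention: the generator of `S⟨r⟩` has degree `-r`. -/
theorem FreeOn.single_mem {M : GrMod k U} {n : ℕ} {r : Fin n → ℤ}
    {e : (Fin n → SymmetricAlgebra k U) ≃ₗ[SymmetricAlgebra k U] M.carrier}
    (he : ∀ (i : ℤ) (f : Fin n → SymmetricAlgebra k U),
      (∀ j, f j ∈ symDeg k U (i + r j)) ↔ e f ∈ M.deg i) (j : Fin n) :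
    e (Pi.single j 1) ∈ M.deg (-r j) := by
  rw [← he]
  intro l
  by_cases hl : l = j
  · subst hl
    rw [Pi.single_eq_same, neg_add_cancel, ← map_one (algebraMap k _)]
    exact algebraMap_mem_symDeg 1
  · rw [Pi.single_eq_of_ne hl]
    exact zero_mem _

theorem sum_smul_single {M : GrMod k U} {n : ℕ}
    (e : (Fin n → SymmetricAlgebra k U) ≃ₗ[SymmetricAlgebra k U] M.carrier)
    (f : Fin n → SymmetricAlgebra k U) : ∑ j, f j • e (Pi.single j 1) = e f := by
  rw [← e.coe_coe, LinearMap.pi_apply_eq_sum_univ e.toLinearMap f]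
  refine Finset.sum_congr rfl fun j _ => ?_
  congr 2
  ext l
  simp [Pi.single_apply, eq_comm]

/-- The fibre product of free modules `A` and `B` over a module that is isomorphic to `B / β B`. -/
theorem freeOn_fibreProduct {A B C M : GrMod k U} (f : GrHom A C) (g : GrHom B C)
    (hg : Function.Surjective g) {β : U} (hβ : β ≠ 0)
    (hker : LinearMap.ker g.toLinearMap = B.mulSubmodule β) (p : GrHom M A) (q : GrHom M B)
    (hpq : ∀ m, f (p m) = g (q m)) (hlift : ∀ a c, f a = g c → ∃ m, p m = a ∧ q m = c)
    (hinj : ∀ m, p m = 0 → q m = 0 → m = 0)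
    (hdeg : ∀ i m, p m ∈ A.deg i → q m ∈ B.deg i → m ∈ M.deg i)
    {n n' : ℕ} {r : Fin n → ℤ} {r' : Fin n' → ℤ} (hA : A.FreeOn r) (hB : B.FreeOn r') :
    M.FreeOn (Fin.append r fun j => r' j - 2) := by
  have hBf : B.IsFree := ⟨_, _, hB⟩
  obtain ⟨e, he⟩ := hA
  obtain ⟨e', he'⟩ := hB
  have hgβ : ∀ c : B, g (SymmetricAlgebra.ι k U β • c) = 0 := fun c =>
    LinearMap.mem_ker.1 (hker ▸ ⟨c, rfl⟩)
  -- Generators of `A` are lifted to `M`; passing to a homogeneous component of an arbitrary lift in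
  -- `B` keeps the degree.
  have h1 : ∀ j, ∃ m, p m = e (Pi.single j 1) ∧ q m ∈ B.deg (-r j) := by
    intro j
    have hj := FreeOn.single_mem he j
    obtain ⟨c, hc⟩ := hg (f (e (Pi.single j 1)))
    obtain ⟨m, hm, hm'⟩ := hlift (e (Pi.single j 1)) (B.comp (-r j) c) (by
      rw [map_comp g, hc, C.comp_same _ _ (f.map_deg _ _ hj)])
    exact ⟨m, hm, hm' ▸ B.comp_mem _ _⟩
  -- The kernel of `p` is a copy of `β B`; as `β` has degree 2, its generators give the shifts `r' j
  -- - 2`.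
  have h2 : ∀ j, ∃ m, p m = 0 ∧ q m = SymmetricAlgebra.ι k U β • e' (Pi.single j 1) := by
    intro j
    exact hlift 0 _ (by rw [hgβ, map_zero])
  choose v hv hvd using h1
  choose w hw hwq using h2
  have hvdeg : ∀ j, v j ∈ M.deg (-r j) := fun j =>
    hdeg _ _ (hv j ▸ FreeOn.single_mem he j) (hvd j)
  have hwdeg : ∀ j, w j ∈ M.deg (-(r' j - 2)) := fun j =>
    hdeg _ _ (hw j ▸ zero_mem _) (by
      rw [hwq, show -(r' j - 2) = 2 + -r' j by ring]
      exact B.smul_mem _ _ _ _ (ι_mem β) (FreeOn.single_mem he' j))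
  let Ψ : (Fin (n + n') → SymmetricAlgebra k U) →ₗ[SymmetricAlgebra k U] M.carrier :=
    Fintype.linearCombination (SymmetricAlgebra k U) (Fin.append v w)
  have hΨ : ∀ x, Ψ x = ∑ j, x (Fin.castAdd n' j) • v j + ∑ j, x (Fin.natAdd n j) • w j := by
    intro x
    rw [Fintype.linearCombination_apply, Fin.sum_univ_add]
    simp
  have hpΨ : ∀ x, p (Ψ x) = e fun j => x (Fin.castAdd n' j) := by
    intro x
    rw [hΨ, map_add, map_sum, map_sum, ← sum_smul_single e]
    simp [hv, hw]
  have hqΨ : ∀ x, q (Ψ x) = ∑ j, x (Fin.castAdd n' j) • q (v j) +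
      SymmetricAlgebra.ι k U β • e' fun j => x (Fin.natAdd n j) := by
    intro x
    rw [hΨ, map_add, map_sum, map_sum, ← sum_smul_single e', Finset.smul_sum]
    simp [hwq, smul_comm (SymmetricAlgebra.ι k U β)]
  have hΨi : Function.Injective Ψ := by
    rw [← LinearMap.ker_eq_bot, LinearMap.ker_eq_bot']
    intro x hx
    have h3 := hpΨ x
    rw [hx, map_zero, eq_comm, e.map_eq_zero_iff] at h3
    have h4 := hqΨ x
    simp only [congrFun h3, Pi.zero_apply, zero_smul, Finset.sum_const_zero, zero_add] at h4
    rw [hx, map_zero, eq_comm] at h4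
    have h5 := hBf.eq_zero_of_smul hβ h4
    rw [e'.map_eq_zero_iff] at h5
    exact funext fun j => Fin.addCases (fun j => congrFun h3 j) (fun j => congrFun h5 j) j
  have hΨs : Function.Surjective Ψ := by
    intro m
    -- After subtraction of the lifted generators the component in `A` vanishes, so the component in
    -- `B` lies in the kernel of `g`.
    have h3 : q m - ∑ j, e.symm (p m) j • q (v j) ∈ B.mulSubmodule β := by
      rw [← hker, LinearMap.mem_ker, map_sub, map_sum]
      simp only [map_smul]
      simp only [← hpq, hv]
      have h := congrArg f.toLinearMap (sum_smul_single e (e.symm (p m)))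
      rw [map_sum, e.apply_symm_apply] at h
      simp only [map_smul] at h
      rw [h, sub_self]
    obtain ⟨c, hc⟩ := h3
    refine ⟨Fin.append (e.symm (p m)) (e'.symm c), ?_⟩
    rw [← sub_eq_zero]
    refine hinj _ ?_ ?_
    · rw [map_sub, hpΨ]
      simp
    · rw [map_sub, hqΨ]
      change SymmetricAlgebra.ι k U β • c = _ at hc
      simp [hc]
  refine ⟨LinearEquiv.ofBijective Ψ ⟨hΨi, hΨs⟩, fun i x => ?_⟩
  change _ ↔ Ψ x ∈ M.deg i
  constructor
  · intro hx
    rw [hΨ]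
    refine add_mem (sum_mem fun j _ => ?_) (sum_mem fun j _ => ?_)
    · have h3 := hx (Fin.castAdd n' j)
      rw [Fin.append_left] at h3
      have h4 := M.smul_mem _ _ _ _ h3 (hvdeg j)
      rwa [add_neg_cancel_right] at h4
    · have h3 := hx (Fin.natAdd n j)
      rw [Fin.append_right] at h3
      have h4 := M.smul_mem _ _ _ _ h3 (hwdeg j)
      rwa [add_neg_cancel_right] at h4
  · intro hx
    have h3 := p.map_deg i _ hx
    change p (Ψ x) ∈ _ at h3
    rw [hpΨ, ← he] at h3
    have h4 := q.map_deg i _ hx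
    change q (Ψ x) ∈ _ at h4
    rw [hqΨ] at h4
    have h5 : ∑ j, x (Fin.castAdd n' j) • q (v j) ∈ B.deg i := sum_mem fun j _ => by
      have h4 := B.smul_mem _ _ _ _ (h3 j) (hvd j)
      rwa [add_neg_cancel_right] at h4
    have h6 := hBf.mem_deg_of_smul_mem hβ ((add_mem_cancel_left h5).1 h4)
    rw [← he'] at h6
    intro j
    refine Fin.addCases (fun j => ?_) (fun j => ?_) j
    · rw [Fin.append_left]
      exact h3 j
    · rw [Fin.append_right]
      have := h6 j
      rwa [show i - 2 + r' j = i + (r' j - 2) by ring] at this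

/-- Modulo the augmentation ideal, the generators of degree `-d` on the two sides become bases of
vector spaces, and `E` induces an injective map between these. -/
theorem card_le_of_graded_equiv {n m : ℕ} {r : Fin n → ℤ} {r' : Fin m → ℤ}
    (E : (Fin n → SymmetricAlgebra k U) ≃ₗ[SymmetricAlgebra k U] (Fin m → SymmetricAlgebra k U))
    (hE : ∀ (i : ℤ) (f : Fin n → SymmetricAlgebra k U),
      (∀ j, f j ∈ symDeg k U (i + r j)) → ∀ j, E f j ∈ symDeg k U (i + r' j)) (d : ℤ) :
    Fintype.card {j // r j = d} ≤ Fintype.card {j // r' j = d} := by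
  let a : k →ₐ[k] SymmetricAlgebra k U := Algebra.ofId k _
  let ε : SymmetricAlgebra k U →ₐ[k] k := SymmetricAlgebra.algebraMapInv
  have hεa : ∀ c, ε (a c) = c := SymmetricAlgebra.algebraMap_leftInverse U
  let ext : ({j // r j = d} → k) → Fin n → SymmetricAlgebra k U :=
    fun v j => if h : r j = d then a (v ⟨j, h⟩) else 0
  have hext : ∀ v j, ext v j ∈ symDeg k U (-d + r j) := by
    intro v j
    by_cases h : r j = d
    · simp only [ext, dif_pos h]
      rw [h, neg_add_cancel]
      exact algebraMap_mem_symDeg _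
    · simp only [ext, dif_neg h]
      exact zero_mem _
  let Λ : ({j // r j = d} → k) →ₗ[k] ({j // r' j = d} → k) :=
    { toFun := fun v j => ε (E (ext v) j)
      map_add' := fun v w => by
        have h1 : ext (v + w) = ext v + ext w := by
          funext j
          by_cases h : r j = d <;> simp [ext, h]
        funext j
        rw [h1, map_add, Pi.add_apply, map_add, Pi.add_apply]
      map_smul' := fun c v => by
        have h1 : ext (c • v) = a c • ext v := by
          funext j
          by_cases h : r j = d <;> simp [ext, h]
        funext j
        rw [h1, map_smul, Pi.smul_apply, smul_eq_mul, map_mul, hεa]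
        rfl }
  have hΛ : Function.Injective Λ := by
    rw [← LinearMap.ker_eq_bot, LinearMap.ker_eq_bot']
    intro v hv
    -- The constant terms vanish by assumption where `r' j = d`; elsewhere the entry is homogeneous
    -- of degree `-d + r' j ≠ 0`.
    have h1 : ∀ j, ε (E (ext v) j) = 0 := by
      intro j
      by_cases h : r' j = d
      · exact congrFun hv ⟨j, h⟩
      · exact algebraMapInv_of_mem_symDeg (by omega) (hE _ _ (hext v) j)
    have h2 : ∀ l, ε (ext v l) = 0 := by
      intro l
      have h3 : ext v = ∑ j, E (ext v) j • E.symm (Pi.single j 1) := by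
        apply E.injective
        rw [map_sum]
        simp only [map_smul, E.apply_symm_apply]
        funext i
        simp [Finset.sum_apply, Pi.single_apply]
      rw [h3, Finset.sum_apply, map_sum]
      refine Finset.sum_eq_zero fun j _ => ?_
      rw [Pi.smul_apply, smul_eq_mul, map_mul, h1, zero_mul]
    funext j
    have h3 := h2 j.1
    simp only [ext, dif_pos j.2] at h3
    rw [hεa] at h3
    exact h3
  simpa using LinearMap.finrank_le_finrank_of_injective hΛ

/-- The bound in both directions shows that `M` determines how often each shift occurs. Hence the
choice made in `grk` is irrelevant. -/
theorem FreeOn.sum_eq {M : GrMod k U} {n m : ℕ} {r : Fin n → ℤ} {r' : Fin m → ℤ}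
    (h : M.FreeOn r) (h' : M.FreeOn r') :
    ∑ j, (LaurentPolynomial.T (r j) : LaurentPolynomial ℤ) = ∑ j, LaurentPolynomial.T (r' j) := by
  obtain ⟨e, he⟩ := h
  obtain ⟨e', he'⟩ := h'
  have hcard : ∀ d, Fintype.card {j // r j = d} = Fintype.card {j // r' j = d} := by
    intro d
    refine le_antisymm (card_le_of_graded_equiv (e.trans e'.symm) (fun i f hf => ?_) d)
      (card_le_of_graded_equiv (e'.trans e.symm) (fun i f hf => ?_) d)
    · rw [he'] 
      simpa using (he i f).1 hf
    · rw [he]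
      simpa using (he' i f).1 hf
  let σ : Fin n ≃ Fin m := Equiv.ofFiberEquiv fun d => Fintype.equivOfCardEq (hcard d)
  refine Fintype.sum_equiv σ _ _ fun j => ?_
  exact congrArg LaurentPolynomial.T (Equiv.ofFiberEquiv_map _ j).symm

theorem FreeOn.grk_eq {M : GrMod k U} {n : ℕ} {r : Fin n → ℤ} (h : M.FreeOn r) :
    M.grk = ∑ j, LaurentPolynomial.T (r j) := by
  have hM : M.IsFree := ⟨n, r, h⟩
  rw [grk, dif_pos hM]
  exact hM.choose_spec.choose_spec.sum_eq h

theorem freeOn_self : (self k U).FreeOn ![0] := by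
  refine ⟨LinearEquiv.funUnique (Fin 1) (SymmetricAlgebra k U) (SymmetricAlgebra k U), fun i f => ?_⟩
  simp only [Fin.forall_fin_one, Matrix.cons_val_zero, add_zero]
  rfl

theorem freeOn_of_subsingleton (M : GrMod k U) [Subsingleton M] : M.FreeOn ![] :=
  ⟨LinearEquiv.ofSubsingleton _ _, fun i f => by
    refine iff_of_true (fun j => j.elim0) ?_
    rw [Subsingleton.elim (LinearEquiv.ofSubsingleton _ _ f) (0 : M)]
    exact zero_mem _⟩

theorem grk_self : (self k U).grk = 1 := by
  rw [freeOn_self.grk_eq]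
  simp

theorem grk_of_subsingleton (M : GrMod k U) [Subsingleton M] : M.grk = 0 := by
  rw [M.freeOn_of_subsingleton.grk_eq]
  simp

end GrMod

end Algebra

/-! ### Translation onto the wall -/

section OntoWall

variable {ι V N : Type u} [AddCommGroup V] [Module ℚ V] [AddCommGroup N] [Module ℚ N]
variable {R : RootPairing ι ℚ V N} {b : R.Base} [R.IsRootSystem] [Finite ι] [R.IsCrystallographic]
variable [R.IsReduced] [R.IsIrreducible] {k : Type u} [Field k] (s : simpleReflections b)

/-- Multiplication of a section by the section `x ↦ x(α) - l` of the structure sheaf, where `α` is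
the simple affine root of `s`. -/
theorem smul_wallLabel_mem_sections {M : MGSheaf k (affineGraph b k)}
    {I : Set (affineWeylGroup R)} (l : LabelSpace R k) {m : ∀ x : I, M.stalk x.1}
    (hm : m ∈ M.sections I) :
    (fun x => SymmetricAlgebra.ι k (LabelSpace R k) (wallLabel k s x.1 - l) • m x) ∈
      M.sections I := by
  intro E hs ht
  obtain ⟨c, hc⟩ := wallLabel_refl_mul k s E.root E.src
  rw [← E.eq_mul] at hc
  simp only [map_smul]
  rw [hm E hs ht, ← sub_eq_zero, ← sub_smul, ← map_sub]
  -- The two factors differ by a multiple of the label, which annihilates the module on the edge.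
  have h1 : wallLabel k s E.src - l - (wallLabel k s E.tgt - l) =
      c • (affineGraph b k).label E := by
    rw [hc]
    abel
  change SymmetricAlgebra.ι k (LabelSpace R k)
    (wallLabel k s E.src - l - (wallLabel k s E.tgt - l)) • _ = _
  rw [h1, map_smul, Algebra.smul_def, mul_smul, (M.edge E).label_smul, smul_zero]

variable {P : MGSheaf k (affineGraph b k)}

theorem wallEdge_src_mem (c : Cosets b s) : (wallEdge s c).src ∈ cosetSet b s c :=
  wallEdge_src s c

theorem wallEdge_tgt_mem (c : Cosets b s) : (wallEdge s c).tgt ∈ cosetSet b s c :=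
  wallEdge_tgt s c

theorem mem_sections_cosetSet_iff {c : Cosets b s} {m : ∀ x : cosetSet b s c, P.stalk x.1} :
    m ∈ P.sections (cosetSet b s c) ↔
      (P.edge (wallEdge s c)).resSrc (m ⟨_, wallEdge_src_mem s c⟩) =
        (P.edge (wallEdge s c)).resTgt (m ⟨_, wallEdge_tgt_mem s c⟩) := by
  refine ⟨fun h => h (wallEdge s c) (wallEdge_src_mem s c) (wallEdge_tgt_mem s c),
    fun h E hs ht => ?_⟩
  obtain rfl : E = wallEdge s c := eq_wallEdge s hs ht
  exact h

theorem ext_cosetSet {c : Cosets b s} {m n : ∀ x : cosetSet b s c, P.stalk x.1}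
    (hs : m ⟨_, wallEdge_src_mem s c⟩ = n ⟨_, wallEdge_src_mem s c⟩)
    (ht : m ⟨_, wallEdge_tgt_mem s c⟩ = n ⟨_, wallEdge_tgt_mem s c⟩) : m = n := by
  funext ⟨x, hx⟩
  rcases eq_src_or_tgt s hx with rfl | rfl
  · exact hs
  · exact ht

theorem exists_cosetSet (c : Cosets b s) (u : P.stalk (wallEdge s c).src)
    (v : P.stalk (wallEdge s c).tgt) : ∃ m : ∀ x : cosetSet b s c, P.stalk x.1,
      m ⟨_, wallEdge_src_mem s c⟩ = u ∧ m ⟨_, wallEdge_tgt_mem s c⟩ = v := by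
  classical
  refine ⟨Function.update (Function.update (fun _ => 0) ⟨_, wallEdge_src_mem s c⟩ u)
    ⟨_, wallEdge_tgt_mem s c⟩ v, ?_, Function.update_self _ _ _⟩
  rw [Function.update_of_ne, Function.update_self]
  exact fun h => (wallEdge s c).src_ne (congrArg Subtype.val h)

/-- Sections over a coset extend to global sections. -/
theorem exists_global_extension (hk : ringChar k ≠ 2) (hP : P.IsProjective) {c : Cosets b s}
    {m : ∀ x : cosetSet b s c, P.stalk x.1} (hm : m ∈ P.sections (cosetSet b s c)) :
    ∃ g ∈ P.sections Set.univ, ∀ x : cosetSet b s c, g ⟨x.1, trivial⟩ = m x := by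
  set W := wallEdge s c with hW
  obtain ⟨g, hg, hgm⟩ := hP.generated W.src (m ⟨_, wallEdge_src_mem s c⟩)
  -- The section `g` is correct at the source of `W`. Its error at the target restricts to zero on
  -- `W`, so it is the label times some `a`, and `a` is the value of a global section `h`. The
  -- function `(x(α_s) - W.src(α_s)) / 2` vanishes at the source and is minus the label at the
  -- target; subtracting its product with `h` corrects `g`.
  have h1 : m ⟨_, wallEdge_tgt_mem s c⟩ - g ⟨W.tgt, trivial⟩ ∈
      (P.stalk W.tgt).mulSubmodule ((affineGraph b k).label W) := by
    rw [← hP.ker_resTgt W, LinearMap.mem_ker, map_sub, sub_eq_zero,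
      ← (mem_sections_cosetSet_iff s).1 hm]
    have := hg W trivial trivial
    rw [← hgm]
    exact this
  obtain ⟨a, ha⟩ := h1
  obtain ⟨h, hh, hha⟩ := hP.generated W.tgt a
  have h2 : (2 : k) ≠ 0 := Ring.two_ne_zero hk
  have h3 := smul_wallLabel_mem_sections s (wallLabel k s W.src) hh
  have h4 := Submodule.sub_mem _ hg 
    (Submodule.smul_mem _ (algebraMap k (SymmetricAlgebra k (LabelSpace R k)) (2⁻¹ : k)) h3)
  refine ⟨_, h4, fun x => ?_⟩
  revert x
  rw [← funext_iff (f := fun x : cosetSet b s c => _)]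
  refine ext_cosetSet s ?_ ?_
  · change g ⟨W.src, trivial⟩ - algebraMap k (SymmetricAlgebra k (LabelSpace R k)) (2⁻¹ : k) •
      SymmetricAlgebra.ι k (LabelSpace R k) (wallLabel k s W.src - wallLabel k s W.src) • _ = _
    rw [sub_self, map_zero, zero_smul, smul_zero, sub_zero, hgm]
  · change g ⟨W.tgt, trivial⟩ - algebraMap k (SymmetricAlgebra k (LabelSpace R k)) (2⁻¹ : k) •
      SymmetricAlgebra.ι k (LabelSpace R k) (wallLabel k s W.tgt - wallLabel k s W.src) • h ⟨W.tgt, trivial⟩ = _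
    rw [hha]
    have h5 : wallLabel k s W.tgt = -wallLabel k s W.src := by
      rw [W.tgt_eq_mul_simple s (wallEdge_coset s c), wallLabel_mul_simple]
    change SymmetricAlgebra.ι k (LabelSpace R k) _ • a = _ at ha
    rw [label_eq_wallLabel k s W (wallEdge_coset s c)] at ha
    have h6 : wallLabel k s W.tgt - wallLabel k s W.src = (-2 : k) • wallLabel k s W.src := by
      rw [h5, neg_smul, two_smul]
      abel
    rw [h6, map_smul, Algebra.smul_def, mul_smul, ha, smul_smul, ← map_mul, mul_neg,
      inv_mul_cancel₀ h2, map_neg, map_one, neg_smul, one_smul]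
    abel

/-- A section over the source coset extends to a global section, whose restriction to the target
coset is the required preimage. -/
theorem onCompatible (hk : ringChar k ≠ 2) (hP : P.IsProjective) : OnCompatible s P := by
  intro E m
  obtain ⟨g, hg, hgm⟩ := exists_global_extension s hk hP m.2
  refine ⟨⟨fun x => g ⟨x.1, trivial⟩, fun D _ _ => hg D trivial trivial⟩, ?_⟩
  funext D
  change (P.edge D.1).resTgt (g ⟨D.1.tgt, trivial⟩) = (P.edge D.1).resSrc (m.1 ⟨D.1.src, D.2.1⟩)
  rw [← hgm]
  exact (hg D.1 trivial trivial).symm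

variable {s} (h : OnCompatible s P)

theorem thetaOn_edge_eq_iff (E : QuotientEdge b s) (m : P.grSections (cosetSet b s E.src))
    (n : P.grSections (cosetSet b s E.tgt)) :
    ((thetaOn s P h).edge E).resSrc m = ((thetaOn s P h).edge E).resTgt n ↔
      ∀ D : edgesOver b s E, (P.edge D.1).resSrc (m.1 ⟨D.1.src, D.2.1⟩) =
        (P.edge D.1).resTgt (n.1 ⟨D.1.tgt, D.2.2.1⟩) :=
  Subtype.ext_iff.trans funext_iff

/-- A section of `P` over the preimage of a set of cosets gives a section of `thetaOn s P`. -/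
theorem exists_section_thetaOn {K : Set (Cosets b s)}
    {g : ∀ x : {x : affineWeylGroup R | (x : Cosets b s) ∈ K}, P.stalk x.1}
    (hg : g ∈ P.sections {x : affineWeylGroup R | (x : Cosets b s) ∈ K}) :
    ∃ m ∈ (thetaOn s P h).sections K, ∀ (c : K) (x : cosetSet b s c.1),
      (m c).1 x = g ⟨x.1, by rw [Set.mem_ofPred_eq, x.2]; exact c.2⟩ := by
  refine ⟨fun c => ⟨fun x => g ⟨x.1, by rw [Set.mem_ofPred_eq, x.2]; exact c.2⟩,
    fun E _ _ => hg E _ _⟩, ?_, fun _ _ => rfl⟩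
  intro E hs ht
  exact (thetaOn_edge_eq_iff h E _ _).2 fun D => hg D.1 _ _

/-- A section of `thetaOn s P` gives a section of `P` over the preimage. -/
theorem mem_sections_of_thetaOn {K : Set (Cosets b s)} {m : ∀ c : K, (thetaOn s P h).stalk c.1}
    (hm : m ∈ (thetaOn s P h).sections K) :
    (fun x : {x : affineWeylGroup R | (x : Cosets b s) ∈ K} => (m ⟨x.1, x.2⟩).1 ⟨x.1, rfl⟩) ∈
      P.sections {x : affineWeylGroup R | (x : Cosets b s) ∈ K} := by
  intro E hs ht
  by_cases hE : (E.src : Cosets b s) = E.tgt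
  · have key : ∀ (c d : Cosets b s) (hc : c ∈ K) (hd : d ∈ K) (hsc : (E.src : Cosets b s) = c)
        (htd : (E.tgt : Cosets b s) = d), c = d →
        (P.edge E).resSrc ((m ⟨c, hc⟩).1 ⟨E.src, hsc⟩) =
          (P.edge E).resTgt ((m ⟨d, hd⟩).1 ⟨E.tgt, htd⟩) := by
      rintro c d hc hd hsc htd rfl
      exact (m ⟨c, hc⟩).2 E hsc htd
    exact key _ _ hs ht rfl rfl hE
  · exact (thetaOn_edge_eq_iff h _ _ _).1 (hm (E.bar s hE) hs ht) ⟨E, E.mem_edgesOver_bar s hE⟩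

variable (s P) in
/-- The part of the GKM-property that is used for the translation through the `s`-wall: over the
support of the sheaf, the labels of the edges that connect two cosets are not proportional to the
labels inside of the cosets. -/
def WallGKM : Prop :=
  ∀ E D : AffineEdge b, (E.src : Cosets b s) ≠ E.tgt → (D.src : Cosets b s) = D.tgt →
    (D.src : Cosets b s) = E.tgt →
    (∃ x ∈ P.supp, (x : Cosets b s) = E.tgt) →
    ∀ c : k, (affineGraph b k).label E ≠ c • (affineGraph b k).label D ∧
      (affineGraph b k).label D ≠ c • (affineGraph b k).label E

theorem subsingleton_sections {c : Cosets b s} (hc : ¬ ∃ x ∈ P.supp, (x : Cosets b s) = c) :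
    Subsingleton (P.grSections (cosetSet b s c)) := by
  refine ⟨fun m n => Subtype.ext (funext fun x => ?_)⟩
  have : Subsingleton (P.stalk x.1) := by
    rw [← not_nontrivial_iff_subsingleton]
    exact fun hx => hc ⟨x.1, hx, x.2⟩
  exact Subsingleton.elim _ _

/-- Both elements of the target coset are targets of edges over `E`, so a section `m` in the kernel
is the label times a family `a`. It remains to see that `a` is a section over the coset, and here
the GKM-property allows the label to be cancelled on the edge inside the coset. -/
theorem ker_resTgt_thetaOn (hk : ringChar k ≠ 2) (hP : P.IsProjective) (hG : WallGKM s P)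
    (E : QuotientEdge b s) : LinearMap.ker ((thetaOn s P h).edge E).resTgt.toLinearMap =
      ((thetaOn s P h).stalk E.tgt).mulSubmodule ((quotientGraph b k s).label E) := by
  refine le_antisymm (fun m hm => ?_) ?_
  swap
  · rintro _ ⟨m, rfl⟩
    exact (((thetaOn s P h).edge E).resTgt.toLinearMap.map_smul _ m).trans
      (((thetaOn s P h).edge E).label_smul _)
  by_cases hne : ∃ x ∈ P.supp, (x : Cosets b s) = E.tgt
  swap
  · have := subsingleton_sections hne
    rw [Subsingleton.elim (α := P.grSections (cosetSet b s E.tgt)) m 0]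
    exact zero_mem _
  have h0 : ((thetaOn s P h).edge E).resTgt m = 0 := hm
  have h1 : ∀ D : edgesOver b s E, (P.edge D.1).resTgt (m.1 ⟨D.1.tgt, D.2.2.1⟩) = 0 :=
    fun D => congrFun (congrArg Subtype.val h0) D
  have h2 : ∀ x : cosetSet b s E.tgt, ∃ a : P.stalk x.1,
      SymmetricAlgebra.ι k (LabelSpace R k) ((quotientGraph b k s).label E) • a = m.1 x := by
    rintro ⟨x, hx⟩
    obtain ⟨D, hD, rfl⟩ := exists_edgesOver_tgt s E x hx
    have h3 : m.1 ⟨D.tgt, hx⟩ ∈ (P.stalk D.tgt).mulSubmodule ((affineGraph b k).label D) := by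
      rw [← hP.ker_resTgt D]
      exact h1 ⟨D, hD⟩
    have hl : (quotientGraph b k s).label E = (affineGraph b k).label D :=
      congrArg (fun γ : AffineRoot R => (1 ⊗ₜ γ.toWeight : LabelSpace R k)) hD.2.2.symm
    rw [hl]
    exact h3
  choose a ha using h2
  refine ⟨⟨a, (mem_sections_cosetSet_iff s).2 ?_⟩, Subtype.ext (funext fun x => ha x)⟩
  set W := wallEdge s E.tgt with hW
  obtain ⟨D, hD1, hD2, hD3⟩ := E.exists_edge
  have hl : (quotientGraph b k s).label E = (affineGraph b k).label D :=
    congrArg (fun γ : AffineRoot R => (1 ⊗ₜ γ.toWeight : LabelSpace R k)) hD3.symm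
  have hnp := fun c => (hG D W (by rw [hD1, hD2]; exact E.src_ne) (wallEdge_coset s _)
    (by rw [hD2, wallEdge_src]) (by rw [hD2]; exact hne) c).1
  rw [← sub_eq_zero]
  -- A lift `t` of the discrepancy of `a` along `W`. The label of `E` kills the discrepancy because
  -- `m` is a section, and it is not proportional to the label of `W`.
  obtain ⟨t, ht⟩ := hP.surjective_resTgt W ((P.edge W).resSrc (a ⟨_, wallEdge_src_mem s _⟩) -
    (P.edge W).resTgt (a ⟨_, wallEdge_tgt_mem s _⟩))
  rw [← ht, ← LinearMap.mem_ker, hP.ker_resTgt W]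
  refine (hP.free W.tgt).mem_mulSubmodule_of_smul (label_ne_zero k hk W.root) hnp ?_
  rw [← hl]
  have h4 : SymmetricAlgebra.ι k (LabelSpace R k) ((quotientGraph b k s).label E) • t ∈
      LinearMap.ker (P.edge W).resTgt.toLinearMap := by
    rw [LinearMap.mem_ker, map_smul, ht, smul_sub, ← map_smul, ← map_smul, ha, ha, sub_eq_zero]
    exact (mem_sections_cosetSet_iff s).1 m.2
  rw [hP.ker_resTgt W] at h4
  exact h4

/-- The stalk is the fibre product of the stalks of `P` at the two elements of the coset over the
module of the edge between them, and this module is the upper stalk modulo the label. -/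
theorem freeOn_stalk_thetaOn (hk : ringChar k ≠ 2) (hP : P.IsProjective) (c : Cosets b s)
    {n n' : ℕ} {r : Fin n → ℤ} {r' : Fin n' → ℤ} (hr : (P.stalk (wallEdge s c).src).FreeOn r)
    (hr' : (P.stalk (wallEdge s c).tgt).FreeOn r') :
    ((thetaOn s P h).stalk c).FreeOn (Fin.append r fun j => r' j - 2) := by
  let p : GrHom (P.grSections (cosetSet b s c)) (P.stalk (wallEdge s c).src) :=
    { toLinearMap := LinearMap.proj (⟨_, wallEdge_src_mem s c⟩ : cosetSet b s c) ∘ₗ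
        (P.sections _).subtype
      map_deg := fun i m hm => hm ⟨_, wallEdge_src_mem s c⟩ trivial }
  let q : GrHom (P.grSections (cosetSet b s c)) (P.stalk (wallEdge s c).tgt) :=
    { toLinearMap := LinearMap.proj (⟨_, wallEdge_tgt_mem s c⟩ : cosetSet b s c) ∘ₗ
        (P.sections _).subtype
      map_deg := fun i m hm => hm ⟨_, wallEdge_tgt_mem s c⟩ trivial }
  refine GrMod.freeOn_fibreProduct (M := P.grSections (cosetSet b s c))
    (P.edge (wallEdge s c)).resSrc (P.edge (wallEdge s c)).resTgt
    (hP.surjective_resTgt _) (label_ne_zero k hk (wallEdge s c).root) (hP.ker_resTgt _) p q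
    (fun m => (mem_sections_cosetSet_iff s).1 m.2) (fun u v huv => ?_) (fun m hm hm' => ?_)
    (fun i m hm hm' => ?_) hr hr'
  · obtain ⟨m, rfl, rfl⟩ := exists_cosetSet s c u v
    exact ⟨⟨m, (mem_sections_cosetSet_iff s).2 huv⟩, rfl, rfl⟩
  · exact Subtype.ext (ext_cosetSet s hm hm')
  · rintro ⟨x, hx⟩ -
    rcases eq_src_or_tgt s hx with rfl | rfl
    · exact hm
    · exact hm'

theorem grk_stalk_thetaOn (hk : ringChar k ≠ 2) (hP : P.IsProjective) (c : Cosets b s) :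
    ((thetaOn s P h).stalk c).grk = (P.stalk (wallEdge s c).src).grk +
      LaurentPolynomial.T (-2) * (P.stalk (wallEdge s c).tgt).grk := by
  obtain ⟨n, r, hr⟩ := hP.free (wallEdge s c).src
  obtain ⟨n', r', hr'⟩ := hP.free (wallEdge s c).tgt
  rw [(freeOn_stalk_thetaOn h hk hP c hr hr').grk_eq, hr.grk_eq, hr'.grk_eq, Fin.sum_univ_add,
    Finset.mul_sum]
  congr 1
  · simp
  · refine Finset.sum_congr rfl fun j _ => ?_
    rw [Fin.append_right, ← LaurentPolynomial.T_add, neg_add_eq_sub]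

theorem thetaOn_isProjective (hk : ringChar k ≠ 2) (hP : P.IsProjective) (hG : WallGKM s P) :
    (thetaOn s P h).IsProjective where
  finite_supp := by
    refine (hP.finite_supp.image fun x : affineWeylGroup R => (x : Cosets b s)).subset
      fun c hc => ?_
    by_contra hne
    have := subsingleton_sections (P := P) (c := c) fun ⟨x, hx, hxc⟩ => hne ⟨x, hx, hxc⟩
    exact not_nontrivial (P.grSections (cosetSet b s c)) hc
  free c := by
    obtain ⟨n, r, hr⟩ := hP.free (wallEdge s c).src
    obtain ⟨n', r', hr'⟩ := hP.free (wallEdge s c).tgt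
    exact ⟨_, _, freeOn_stalk_thetaOn h hk hP c hr hr'⟩
  surjective_resTgt E := by
    rintro ⟨_, m, rfl⟩
    exact ⟨m, rfl⟩
  ker_resTgt E := ker_resTgt_thetaOn h hk hP hG E
  generated c a := by
    obtain ⟨g, hg, hga⟩ := exists_global_extension s hk hP a.2
    obtain ⟨m, hm, hmg⟩ := exists_section_thetaOn h (K := Set.univ) (g := fun x => g ⟨x.1, trivial⟩)
      fun E _ _ => hg E trivial trivial
    refine ⟨m, hm, Subtype.ext (funext fun x => ?_)⟩
    rw [hmg, ← hga]
  flabby I' I hI hI' hIo m' hm' := by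
    -- The preimage of an open set of cosets is open, and sections of `thetaOn s P` are sections of
    -- `P` over the preimage.
    have hopen : ∀ K : Set (Cosets b s), (quotientGraph b k s).IsOpenSet K →
        (affineGraph b k).IsOpenSet {x : affineWeylGroup R | (x : Cosets b s) ∈ K} :=
      fun K hK x y hx hxy => hK _ _ hx (quotient_le_of_bruhatLE s k hxy)
    obtain ⟨g, hg, hgm⟩ := hP.flabby _ _ (fun x hx => hI hx) (hopen I' hI') (hopen I hIo) _
      (mem_sections_of_thetaOn h hm')
    obtain ⟨m, hm, hmg⟩ := exists_section_thetaOn h hg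
    refine ⟨m, hm, fun c => Subtype.ext (funext fun x => ?_)⟩
    rw [hmg]
    obtain ⟨c, hc⟩ := c
    obtain ⟨x, hx⟩ := x
    have hx' : (x : Cosets b s) = c := hx
    subst hx'
    exact hgm ⟨x, hc⟩

end OntoWall

/-! ### Edge modules along equalities of indices -/

section Transport

variable {k U X : Type u} [Field k] [AddCommGroup U] [Module k U] (f : X → GrMod k U)

/-- The identification of two members of a family of graded modules with equal indices. -/
def transport {x y : X} (h : x = y) : (f x).carrier →ₗ[SymmetricAlgebra k U] (f y).carrier :=
  h ▸ LinearMap.id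

theorem quotOfEq_eq_iff {x y : X} (h : x = y) (a : U) (m : f x) (n : f y) :
    (EdgeModule.quotOfEq f h a).resSrc m = (EdgeModule.quotOfEq f h a).resTgt n ↔
      ∃ d : f y, transport f h m - n = SymmetricAlgebra.ι k U a • d := by
  subst h
  refine (Submodule.Quotient.eq _).trans ?_
  exact exists_congr fun d => eq_comm

theorem quotOfEq_family {x y : X} (h : x = y) (a : U) (q : ∀ x, f x) :
    (EdgeModule.quotOfEq f h a).resSrc (q x) = (EdgeModule.quotOfEq f h a).resTgt (q y) := by
  subst h
  rfl

theorem quotOfEq_surjective {x y : X} (h : x = y) (a : U) :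
    Function.Surjective (EdgeModule.quotOfEq f h a).resTgt := by
  subst h
  exact Submodule.mkQ_surjective _

theorem quotOfEq_ker {x y : X} (h : x = y) (a : U) :
    LinearMap.ker (EdgeModule.quotOfEq f h a).resTgt.toLinearMap = (f y).mulSubmodule a := by
  subst h
  exact Submodule.ker_mkQ _

/-- Carries the section condition across the case distinction in `thetaOut`. -/
theorem EdgeModule.eq_iff_of_eq {A B : GrMod k U} {a : U} {e e' : EdgeModule A B a} (h : e = e')
    (m : A) (n : B) : e.resSrc m = e.resTgt n ↔ e'.resSrc m = e'.resTgt n := by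
  rw [h]

end Transport

/-! ### Translation out of the wall -/

section OutOfWall

variable {ι V N : Type u} [AddCommGroup V] [Module ℚ V] [AddCommGroup N] [Module ℚ N]
variable {R : RootPairing ι ℚ V N} {b : R.Base} [R.IsRootSystem] [Finite ι] [R.IsCrystallographic]
variable [R.IsReduced] [R.IsIrreducible] {k : Type u} [Field k] {s : simpleReflections b}
variable {Q : MGSheaf k (quotientGraph b k s)}

theorem thetaOut_edge_of_eq (E : AffineEdge b) (hE : (E.src : Cosets b s) = E.tgt) :
    (thetaOut s Q).edge E = EdgeModule.quotOfEq Q.stalk hE ((affineGraph b k).label E) :=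
  dif_pos hE

theorem thetaOut_edge_of_ne (E : AffineEdge b) (hE : (E.src : Cosets b s) ≠ E.tgt) :
    (thetaOut s Q).edge E = Q.edge (E.bar s hE) :=
  dif_neg hE

/-- A global section of a sheaf on the quotient graph gives a global section of its translation
out of the wall. -/
theorem pullback_mem_sections {q : ∀ c : (Set.univ : Set (Cosets b s)), Q.stalk c.1}
    (hq : q ∈ Q.sections Set.univ) :
    (fun x : (Set.univ : Set (affineWeylGroup R)) => q ⟨x.1, trivial⟩) ∈
      (thetaOut s Q).sections Set.univ := by
  intro E hs ht
  by_cases hE : (E.src : Cosets b s) = E.tgt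
  · exact (EdgeModule.eq_iff_of_eq (thetaOut_edge_of_eq E hE) _ _).2
      (quotOfEq_family Q.stalk hE _ fun c => q ⟨c, trivial⟩)
  · exact (EdgeModule.eq_iff_of_eq (thetaOut_edge_of_ne E hE) _ _).2
      (hq (E.bar s hE) trivial trivial)

variable {I : Set (affineWeylGroup R)} {m : ∀ x : I, (thetaOut s Q).stalk x.1}

/-- The value of a section at `x`, as an element of the stalk at the coset of `x`. -/
def valueAt (m : ∀ x : I, (thetaOut s Q).stalk x.1) {c : Cosets b s} (x : affineWeylGroup R)
    (hx : x ∈ I) (hc : (x : Cosets b s) = c) : Q.stalk c :=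
  transport Q.stalk hc (m ⟨x, hx⟩)

theorem valueAt_edge (hm : m ∈ (thetaOut s Q).sections I) (E : QuotientEdge b s) (D : AffineEdge b)
    (hD : D ∈ edgesOver b s E) (hs : D.src ∈ I) (ht : D.tgt ∈ I) :
    (Q.edge E).resSrc (valueAt m D.src hs hD.1) = (Q.edge E).resTgt (valueAt m D.tgt ht hD.2.1) := by
  -- After substitution of its ends and root, `E` becomes `D.bar`.
  obtain ⟨c, d, γ, hne, hex⟩ := E
  obtain ⟨h1, h2, h3⟩ := hD
  change (D.src : Cosets b s) = c at h1
  change (D.tgt : Cosets b s) = d at h2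
  change D.root = γ at h3
  subst h1 h2 h3
  exact (EdgeModule.eq_iff_of_eq (thetaOut_edge_of_ne D hne) _ _).1 (hm D hs ht)

/-- The values of a section at the two elements of a coset differ by a multiple of the label. -/
theorem exists_valueAt_sub (hm : m ∈ (thetaOut s Q).sections I) (c : Cosets b s)
    (hs : (wallEdge s c).src ∈ I) (ht : (wallEdge s c).tgt ∈ I) :
    ∃ d : Q.stalk c, valueAt m _ hs (wallEdge_src s c) - valueAt m _ ht (wallEdge_tgt s c) =
      SymmetricAlgebra.ι k (LabelSpace R k) ((affineGraph b k).label (wallEdge s c)) • d := by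
  have key : ∀ (E : AffineEdge b) (c : Cosets b s) (hsc : (E.src : Cosets b s) = c)
      (htc : (E.tgt : Cosets b s) = c) (hs : E.src ∈ I) (ht : E.tgt ∈ I),
      ∃ d : Q.stalk c, valueAt m _ hs hsc - valueAt m _ ht htc =
        SymmetricAlgebra.ι k (LabelSpace R k) ((affineGraph b k).label E) • d := by
    intro E c hsc htc hs ht
    subst htc
    exact (quotOfEq_eq_iff Q.stalk hsc _ _ _).1
      ((EdgeModule.eq_iff_of_eq (thetaOut_edge_of_eq E hsc) _ _).1 (hm E hs ht))
  exact key _ _ _ _ _ _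

/-- The form of `exists_valueAt_sub` that is symmetric in the two elements of the coset. -/
theorem exists_valueAt_sub_wallLabel (hm : m ∈ (thetaOut s Q).sections I) (c : Cosets b s)
    (hs : (wallEdge s c).src ∈ I) (ht : (wallEdge s c).tgt ∈ I) :
    ∃ d : Q.stalk c, ∀ (x y : affineWeylGroup R) (hx : x ∈ I) (hy : y ∈ I)
      (hxc : (x : Cosets b s) = c) (hyc : (y : Cosets b s) = c), y = x * s.1 →
      valueAt m x hx hxc - valueAt m y hy hyc =
        SymmetricAlgebra.ι k (LabelSpace R k) (wallLabel k s x) • d := by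
  obtain ⟨d, hd⟩ := exists_valueAt_sub hm c hs ht
  have hl := label_eq_wallLabel k s _ (wallEdge_coset s c)
  rw [hl] at hd
  refine ⟨d, fun x y hx hy hxc hyc hxy => ?_⟩
  rcases eq_src_or_tgt s hxc with h | h
  · have h' : y = (wallEdge s c).tgt := by
      rw [hxy, h, (wallEdge s c).tgt_eq_mul_simple s (wallEdge_coset s c)]
    subst h h'
    exact hd
  · have h' : y = (wallEdge s c).src := by
      rw [hxy, h, (wallEdge s c).src_eq_mul_simple s (wallEdge_coset s c)]
    have h2 : wallLabel k s x = -wallLabel k s (wallEdge s c).src := by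
      rw [← h', hxy, wallLabel_mul_simple, neg_neg]
    subst h h'
    rw [h2, map_neg, neg_smul, ← hd]
    exact (neg_sub _ _).symm

/-- The part of the GKM-property that is used for the translation out of the `s`-wall. -/
def OutGKM (Q : MGSheaf k (quotientGraph b k s)) : Prop :=
  ∀ E : QuotientEdge b s, Nontrivial (Q.stalk E.tgt) → ∀ c : k,
    (affineGraph b k).label (wallEdge s E.tgt) ≠ c • (quotientGraph b k s).label E

theorem smul_wallLabel_edge (E : QuotientEdge b s) (D : AffineEdge b) (hD : D ∈ edgesOver b s E)
    (m : (Q.edge E).mod) :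
    SymmetricAlgebra.ι k (LabelSpace R k) (wallLabel k s D.src) • m =
      SymmetricAlgebra.ι k (LabelSpace R k) (wallLabel k s D.tgt) • m := by
  obtain ⟨c, hc⟩ := wallLabel_refl_mul k s D.root D.src
  rw [← D.eq_mul, hD.2.2] at hc
  have h := (Q.edge E).label_smul m
  change SymmetricAlgebra.ι k (LabelSpace R k) (1 ⊗ₜ E.root.toWeight) • m = 0 at h
  rw [hc, map_sub, sub_smul, map_smul, Algebra.smul_def, mul_smul, h, smul_zero, sub_zero]

/-- The module on `E` is the stalk at the target modulo the label of `E`. At the target, `x(α_s)` is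
up to sign the label inside the coset, which by `OutGKM` acts injectively on this quotient. -/
theorem eq_zero_of_wallLabel_smul (hk : ringChar k ≠ 2) (hQ : Q.IsProjective) (hG : OutGKM Q)
    (E : QuotientEdge b s) (D : AffineEdge b) (hD : D ∈ edgesOver b s E) {δ : (Q.edge E).mod}
    (h : SymmetricAlgebra.ι k (LabelSpace R k) (wallLabel k s D.tgt) • δ = 0) : δ = 0 := by
  obtain ⟨t, rfl⟩ := hQ.surjective_resTgt E δ
  by_cases hne : Nontrivial (Q.stalk E.tgt)
  swap
  · rw [not_nontrivial_iff_subsingleton] at hne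
    rw [Subsingleton.elim t 0]
    exact map_zero _
  have h1 : SymmetricAlgebra.ι k (LabelSpace R k)
      ((affineGraph b k).label (wallEdge s E.tgt)) • (Q.edge E).resTgt t = 0 := by
    rw [label_eq_wallLabel k s _ (wallEdge_coset s _)]
    rcases eq_src_or_tgt s (c := E.tgt) hD.2.1 with h2 | h2
    · rwa [← h2]
    · have h3 : wallLabel k s (wallEdge s E.tgt).src = -wallLabel k s D.tgt := by
        rw [(wallEdge s E.tgt).src_eq_mul_simple s (wallEdge_coset s _), wallLabel_mul_simple, h2]
      rw [h3, map_neg, neg_smul, h, neg_zero]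
  rw [← map_smul] at h1
  have h2 : SymmetricAlgebra.ι k (LabelSpace R k)
      ((affineGraph b k).label (wallEdge s E.tgt)) • t ∈
        LinearMap.ker (Q.edge E).resTgt.toLinearMap := h1
  rw [hQ.ker_resTgt E] at h2
  have h3 := (hQ.free _).mem_mulSubmodule_of_smul (label_ne_zero k hk E.root) (hG E hne) h2
  have h4 := hQ.ker_resTgt E
  change t ∈ (Q.stalk E.tgt).mulSubmodule _ at h3
  exact LinearMap.mem_ker.1 (h4.symm ▸ h3 :
    t ∈ LinearMap.ker (Q.edge E).resTgt.toLinearMap)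

theorem wallEdge_mem_of_forall {c : Cosets b s} (hc : ∀ x : affineWeylGroup R,
    (x : Cosets b s) = c → x ∈ I) : (wallEdge s c).src ∈ I ∧ (wallEdge s c).tgt ∈ I :=
  ⟨hc _ (wallEdge_src s c), hc _ (wallEdge_tgt s c)⟩

/-- The differences of the values of a section over an open set, divided by the labels, extend to
a global section. -/
theorem exists_global_difference (hk : ringChar k ≠ 2) (hQ : Q.IsProjective) (hG : OutGKM Q)
    (hI : (affineGraph b k).IsOpenSet I) (hm : m ∈ (thetaOut s Q).sections I) :
    ∃ r ∈ Q.sections Set.univ, ∀ (c : Cosets b s) (x y : affineWeylGroup R) (hx : x ∈ I)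
      (hy : y ∈ I) (hxc : (x : Cosets b s) = c) (hyc : (y : Cosets b s) = c), y = x * s.1 →
      valueAt m x hx hxc - valueAt m y hy hyc =
        SymmetricAlgebra.ι k (LabelSpace R k) (wallLabel k s x) • r ⟨c, trivial⟩ := by
  let K : Set (Cosets b s) := {c | ∀ x : affineWeylGroup R, (x : Cosets b s) = c → x ∈ I}
  have hex : ∀ c : K, ∃ d : Q.stalk c.1, ∀ (x y : affineWeylGroup R) (hx : x ∈ I) (hy : y ∈ I)
      (hxc : (x : Cosets b s) = c.1) (hyc : (y : Cosets b s) = c.1), y = x * s.1 →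
      valueAt m x hx hxc - valueAt m y hy hyc =
        SymmetricAlgebra.ι k (LabelSpace R k) (wallLabel k s x) • d := fun c =>
    exists_valueAt_sub_wallLabel hm c.1 (wallEdge_mem_of_forall c.2).1
      (wallEdge_mem_of_forall c.2).2
  choose ρ hρ using hex
  have hρs : ρ ∈ Q.sections K := by
    intro E hs ht
    -- Subtracting the section conditions along `D` and along its translate by `s` gives the
    -- condition for `ρ` multiplied by `x(α_s)`. This factor acts in the same way from both ends of
    -- `D` and can be cancelled.
    obtain ⟨D, hD, -⟩ := exists_edgesOver_src s E _ (wallEdge_src s E.src)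
    have hne : (D.src : Cosets b s) ≠ D.tgt := by
      rw [hD.1, hD.2.1]
      exact E.src_ne
    have hD' : D.mulSimple s hne ∈ edgesOver b s E := by
      refine ⟨(coe_mul_simple s D.src).trans hD.1, ?_, hD.2.2⟩
      rw [D.tgt_mulSimple, coe_mul_simple, hD.2.1]
    have h1 := valueAt_edge hm E D hD (hs _ hD.1) (ht _ hD.2.1)
    have h2 := valueAt_edge hm E _ hD' (hs _ hD'.1) (ht _ hD'.2.1)
    have h3 := hρ ⟨_, hs⟩ _ _ (hs _ hD.1) (hs _ hD'.1) hD.1 hD'.1 rfl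
    have h4 := hρ ⟨_, ht⟩ _ _ (ht _ hD.2.1) (ht _ hD'.2.1) hD.2.1 hD'.2.1 (D.tgt_mulSimple s hne)
    have h5 : SymmetricAlgebra.ι k (LabelSpace R k) (wallLabel k s D.src) •
          (Q.edge E).resSrc (ρ ⟨_, hs⟩) =
        SymmetricAlgebra.ι k (LabelSpace R k) (wallLabel k s D.tgt) •
          (Q.edge E).resTgt (ρ ⟨_, ht⟩) := by
      rw [← map_smul, ← map_smul]
      refine (congrArg (Q.edge E).resSrc.toLinearMap h3.symm).trans
        (Eq.trans ?_ (congrArg (Q.edge E).resTgt.toLinearMap h4))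
      rw [map_sub, map_sub]
      exact congrArg₂ (· - ·) h1 h2
    rw [smul_wallLabel_edge E D hD, ← sub_eq_zero, ← smul_sub] at h5
    exact sub_eq_zero.1 (eq_zero_of_wallLabel_smul hk hQ hG E D hD h5)
  -- The set `K` of the cosets contained in `I` is open: an element of a bigger coset lies above
  -- some element of the smaller one.
  obtain ⟨r, hr, hrρ⟩ := hQ.flabby K Set.univ (Set.subset_univ K) (fun c d hc hcd x hx => by
      obtain ⟨u, hu, hux⟩ := quotient_le_lift_down s hcd hx
      exact hI u x (hc u hu) hux) (fun _ _ _ _ => trivial) ρ hρs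
  refine ⟨r, hr, fun c x y hx hy hxc hyc hxy => ?_⟩
  have hcK : c ∈ K := fun z hz => by
    rcases eq_or_eq_mul b s x z (hxc.trans hz.symm) with rfl | rfl
    · exact hx
    · rwa [← hxy]
  rw [hρ ⟨c, hcK⟩ x y hx hy hxc hyc hxy, ← hrρ]

/-- A section over an open set that takes the same value at the two elements of a coset comes from
a global section on the quotient graph. -/
theorem exists_global_of_valueAt_eq (hQ : Q.IsProjective)
    (hI : (affineGraph b k).IsOpenSet I) (hm : m ∈ (thetaOut s Q).sections I)
    (heq : ∀ (c : Cosets b s) (x y : affineWeylGroup R) (hx : x ∈ I) (hy : y ∈ I)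
      (hxc : (x : Cosets b s) = c) (hyc : (y : Cosets b s) = c), y = x * s.1 →
      valueAt m x hx hxc = valueAt m y hy hyc) :
    ∃ q ∈ Q.sections Set.univ, ∀ x : I, m x = q ⟨(x.1 : Cosets b s), trivial⟩ := by
  let K : Set (Cosets b s) := {c | ∃ x ∈ I, (x : Cosets b s) = c}
  choose u hu huc using fun c : K => c.2
  let q : ∀ c : K, Q.stalk c.1 := fun c => valueAt m (u c) (hu c) (huc c)
  have hqv : ∀ (c : K) (x : affineWeylGroup R) (hx : x ∈ I) (hxc : (x : Cosets b s) = c.1),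
      q c = valueAt m x hx hxc := by
    intro c x hx hxc
    rcases eq_or_eq_mul b s (u c) x ((huc c).trans hxc.symm) with h | h
    · subst h
      rfl
    · exact heq c.1 _ _ _ _ _ _ h
  have hq : q ∈ Q.sections K := by
    intro E hs ht
    -- An edge over `E` that starts at the chosen representative ends in `I`, as `I` is open, so the
    -- section condition along it is available.
    obtain ⟨D, hD, hDu⟩ := exists_edgesOver_src s E (u ⟨E.src, hs⟩) (huc ⟨E.src, hs⟩)
    have hDs : D.src ∈ I := hDu ▸ hu ⟨E.src, hs⟩
    have hDt : D.tgt ∈ I := hI _ _ hDs D.src_le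
    have h1 := hqv ⟨E.src, hs⟩ D.src hDs hD.1
    have h2 := hqv ⟨E.tgt, ht⟩ D.tgt hDt hD.2.1
    exact ((congrArg (Q.edge E).resSrc.toLinearMap h1).trans (valueAt_edge hm E D hD hDs hDt)).trans
      (congrArg (Q.edge E).resTgt.toLinearMap h2).symm
  obtain ⟨q', hq', hqq⟩ := hQ.flabby K Set.univ (Set.subset_univ K) (fun c d hc hcd => by
      obtain ⟨x, hx, hxc⟩ := hc
      obtain ⟨y, hy, hxy⟩ := quotient_le_lift_up s hcd hxc
      exact ⟨y, hI x y hx hxy, hy⟩) (fun _ _ _ _ => trivial) q hq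
  refine ⟨q', hq', fun x => ?_⟩
  have h1 := hqq ⟨(x.1 : Cosets b s), x.1, x.2, rfl⟩
  rw [hqv _ x.1 x.2 rfl] at h1
  exact h1.symm

/-- It is enough to extend to all vertices. If `r` extends the differences of `m` divided by
`x(α_s)`, then `x ↦ x(α_s) r / 2` is a global section with the same differences as `m`, because
`x(α_s)` changes sign under `x ↦ xs`. The remainder is symmetric and comes from the quotient graph.
-/
theorem flabby_thetaOut (hk : ringChar k ≠ 2) (hQ : Q.IsProjective) (hG : OutGKM Q) :
    (thetaOut s Q).Flabby := by
  intro I J hIJ hI _ m hm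
  suffices ∃ g ∈ (thetaOut s Q).sections Set.univ, ∀ x : I, g ⟨x.1, trivial⟩ = m x by
    obtain ⟨g, hg, hgm⟩ := this
    exact ⟨fun x => g ⟨x.1, trivial⟩, fun E _ _ => hg E trivial trivial, hgm⟩
  obtain ⟨r, hr, hrm⟩ := exists_global_difference hk hQ hG hI hm
  have h2 : (2 : k) ≠ 0 := Ring.two_ne_zero hk
  have hr' := smul_wallLabel_mem_sections s 0 (pullback_mem_sections
    (Submodule.smul_mem _ (algebraMap k (SymmetricAlgebra k (LabelSpace R k)) (2⁻¹ : k)) hr))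
  obtain ⟨g, hgr, hg⟩ : ∃ g ∈ (thetaOut s Q).sections Set.univ, ∀ x : affineWeylGroup R,
      g ⟨x, trivial⟩ = SymmetricAlgebra.ι k (LabelSpace R k) (wallLabel k s x - 0) •
        (show (thetaOut s Q).stalk x from algebraMap k (SymmetricAlgebra k (LabelSpace R k))
          (2⁻¹ : k) • r ⟨(x : Cosets b s), trivial⟩) :=
    ⟨_, hr', fun x => rfl⟩
  let m1 : ∀ x : I, (thetaOut s Q).stalk x.1 := m - fun x : I => g ⟨x.1, trivial⟩
  have hm1 : m1 ∈ (thetaOut s Q).sections I :=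
    Submodule.sub_mem _ hm fun E _ _ => hgr E trivial trivial
  have hval : ∀ (c : Cosets b s) (x : affineWeylGroup R) (hx : x ∈ I) (hxc : (x : Cosets b s) = c),
      valueAt m1 x hx hxc = valueAt m x hx hxc -
        SymmetricAlgebra.ι k (LabelSpace R k) (wallLabel k s x) •
          algebraMap k (SymmetricAlgebra k (LabelSpace R k)) (2⁻¹ : k) • r ⟨c, trivial⟩ := by
    intro c x hx hxc
    subst hxc
    change m ⟨x, hx⟩ - g ⟨x, trivial⟩ = _
    rw [hg, sub_zero]
    rfl
  obtain ⟨q, hq, hqm⟩ := exists_global_of_valueAt_eq hQ hI hm1 (by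
    intro c x y hx hy hxc hyc hxy
    rw [hval, hval, ← sub_eq_zero, sub_sub_sub_comm, hrm c x y hx hy hxc hyc hxy, hxy,
      wallLabel_mul_simple, ← sub_smul, ← map_sub, sub_neg_eq_add, ← two_smul k, map_smul,
      Algebra.smul_def, mul_comm, mul_smul, smul_smul (algebraMap _ _ (2 : k)), ← map_mul,
      mul_inv_cancel₀ h2, map_one, one_smul, sub_self])
  refine ⟨_, Submodule.add_mem _ (pullback_mem_sections hq) hgr, fun x => ?_⟩
  exact (congrArg (· + g ⟨x.1, trivial⟩) (hqm x).symm).trans (sub_add_cancel _ _)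

theorem thetaOut_isProjective (hk : ringChar k ≠ 2) (hQ : Q.IsProjective) (hG : OutGKM Q) :
    (thetaOut s Q).IsProjective where
  finite_supp := by
    refine Set.Finite.subset (hQ.finite_supp.biUnion fun c _ => Set.toFinite (cosetSet b s c))
      fun x hx => ?_
    exact Set.mem_biUnion (x := (x : Cosets b s)) hx rfl
  free x := hQ.free x
  surjective_resTgt E := by
    by_cases hE : (E.src : Cosets b s) = E.tgt
    · rw [thetaOut_edge_of_eq E hE]
      exact quotOfEq_surjective Q.stalk hE _
    · rw [thetaOut_edge_of_ne E hE]
      exact hQ.surjective_resTgt _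
  ker_resTgt E := by
    by_cases hE : (E.src : Cosets b s) = E.tgt
    · rw [thetaOut_edge_of_eq E hE]
      exact quotOfEq_ker Q.stalk hE _
    · rw [thetaOut_edge_of_ne E hE]
      exact hQ.ker_resTgt _
  generated x a := by
    obtain ⟨q, hq, hqa⟩ := hQ.generated (x : Cosets b s) a
    exact ⟨_, pullback_mem_sections hq, hqa⟩
  flabby := flabby_thetaOut hk hQ hG

end OutOfWall

/-! ### The GKM-property along the sequence, and the unit sheaf -/

section Induction

variable {ι V N : Type u} [AddCommGroup V] [Module ℚ V] [AddCommGroup N] [Module ℚ N]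
variable {R : RootPairing ι ℚ V N} {b : R.Base} [R.IsRootSystem] [Finite ι] [R.IsCrystallographic]
variable [R.IsReduced] [R.IsIrreducible] {k : Type u} [Field k] {s : simpleReflections b}
variable {P : MGSheaf k (affineGraph b k)}

theorem WallGKM.outGKM (hG : WallGKM s P) (h : OnCompatible s P) : OutGKM (thetaOn s P h) := by
  intro E hE c
  obtain ⟨D, hsrc, htgt, hroot⟩ := E.exists_edge
  have hsupp : ∃ x ∈ P.supp, (x : Cosets b s) = E.tgt := by
    by_contra hc
    have := subsingleton_sections (s := s) hc
    have hE' : Nontrivial (P.grSections (cosetSet b s E.tgt)) := hE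
    exact absurd this (not_subsingleton _)
  have hl : (quotientGraph b k s).label E = (affineGraph b k).label D :=
    congrArg (fun γ : AffineRoot R => (1 ⊗ₜ γ.toWeight : LabelSpace R k)) hroot.symm
  rw [hl]
  refine (hG D (wallEdge s E.tgt) ?_ (wallEdge_coset s _) ?_ ?_ c).2
  · rw [hsrc, htgt]
    exact E.src_ne
  · rw [wallEdge_src, htgt]
  · rwa [htgt]

theorem mem_subwordProducts_of_coset {L : List (simpleReflections b)} {x y : affineWeylGroup R}
    (hx : x ∈ subwordProducts L) (h : (x : Cosets b s) = y) :
    y ∈ subwordProducts (L ++ [s]) := by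
  rcases eq_or_eq_mul b s x y h with rfl | rfl
  · exact mem_subwordProducts_concat s hx
  · exact mul_mem_subwordProducts_concat s hx

/-- Cosets that meet the support of `P` lie in `subwordProducts (L ++ [s])`, and so do the sources
of edges that end in them. The edge between cosets and the edge inside the target coset share the
vertex `E.tgt`, so the GKM-property compares their labels. -/
theorem wallGKM_of_gkmOn {L : List (simpleReflections b)}
    (hG : (affineGraph b k).GKMOn k (subwordProducts (L ++ [s])))
    (hP : P.supp ⊆ subwordProducts L) : WallGKM s P := by
  rintro E D hE hD hDE ⟨x, hx, hxE⟩ c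
  have ht : E.tgt ∈ subwordProducts (L ++ [s]) := mem_subwordProducts_of_coset (hP hx) hxE
  have hs := E.src_mem_subwordProducts ht
  have hDs : D.src ∈ subwordProducts (L ++ [s]) :=
    mem_subwordProducts_of_coset (hP hx) (hxE.trans hDE.symm)
  have hDt : D.tgt ∈ subwordProducts (L ++ [s]) :=
    mem_subwordProducts_of_coset (hP hx) (hxE.trans (hDE.symm.trans hD))
  have hne : E ≠ D := by
    rintro rfl
    exact hE hD
  have hv : E.tgt = D.src ∨ E.tgt = D.tgt := by
    rcases eq_or_eq_mul b s D.src E.tgt hDE with h | h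
    · exact Or.inl h
    · exact Or.inr (h.trans (D.tgt_eq_mul_simple s hD).symm)
  refine ⟨hG D E hne.symm hDs hDt hs ht ?_ c, hG E D hne hs ht hDs hDt ?_ c⟩
  · rcases hv with h | h
    · exact Or.inr (Or.inl h.symm)
    · exact Or.inr (Or.inr (Or.inr h.symm))
  · rcases hv with h | h
    · exact Or.inr (Or.inr (Or.inl h))
    · exact Or.inr (Or.inr (Or.inr h))

theorem supp_thetaOut_thetaOn {L : List (simpleReflections b)} (hP : P.supp ⊆ subwordProducts L)
    (h : OnCompatible s P) : (thetaOut s (thetaOn s P h)).supp ⊆ subwordProducts (L ++ [s]) := by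
  intro x hx
  by_cases hc : ∃ y ∈ P.supp, (y : Cosets b s) = x
  · obtain ⟨y, hy, hyx⟩ := hc
    exact mem_subwordProducts_of_coset (hP hy) hyx
  · have := subsingleton_sections (s := s) hc
    have hx' : Nontrivial (P.grSections (cosetSet b s x)) := hx
    exact absurd this (not_subsingleton _)

variable (b k) in
theorem unitSheaf_stalk_one : (unitSheaf b k).stalk 1 = GrMod.self k (LabelSpace R k) := if_pos rfl

variable (k) in
theorem unitSheaf_stalk_subsingleton {x : affineWeylGroup R} (hx : x ≠ 1) :
    Subsingleton ((unitSheaf b k).stalk x) := by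
  have h : (unitSheaf b k).stalk x = GrMod.zero := if_neg hx
  rw [h]
  exact inferInstanceAs (Subsingleton PUnit)

theorem AffineEdge.tgt_ne_one (E : AffineEdge b) : E.tgt ≠ 1 := by
  intro h
  have h1 := E.length_lt
  rw [h, length_one] at h1
  exact Nat.not_lt_zero _ h1

variable (b k) in
theorem supp_unitSheaf_subset : (unitSheaf b k).supp ⊆ {1} := by
  intro x hx
  by_contra h
  have := unitSheaf_stalk_subsingleton k (b := b) h
  have hx' : Nontrivial ((unitSheaf b k).stalk x) := hx
  exact absurd this (not_subsingleton _)

variable (b k) in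
-- All modules on edges are zero, so every family is a section. The unit is never the target of an
-- edge, so the stalk at a target is zero and the kernel condition is trivial.
theorem unitSheaf_isProjective : (unitSheaf b k).IsProjective where
  finite_supp := (Set.finite_singleton _).subset (supp_unitSheaf_subset b k)
  free x := by
    by_cases hx : x = 1
    · subst hx
      rw [unitSheaf_stalk_one]
      exact ⟨_, _, GrMod.freeOn_self⟩
    · have := unitSheaf_stalk_subsingleton k (b := b) hx
      exact ⟨_, _, GrMod.freeOn_of_subsingleton _⟩
  surjective_resTgt E _ := ⟨0, rfl⟩
  ker_resTgt E := by
    have := unitSheaf_stalk_subsingleton k (b := b) (AffineEdge.tgt_ne_one E)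
    exact Subsingleton.elim (α := Submodule _ ((unitSheaf b k).stalk E.tgt)) _ _
  generated x a := by
    classical
    exact ⟨fun y => if h : x = y.1 then h ▸ a else 0, fun _ _ _ => rfl, dif_pos rfl⟩
  flabby I J hIJ _ _ m hm := by
    classical
    exact ⟨fun x => if h : x.1 ∈ I then m ⟨x.1, h⟩ else 0, fun _ _ _ => rfl,
      fun x => dif_pos x.2⟩

end Induction

/-! ### The Hecke algebra: multiplication by `H_s + v` on a coset -/

section HeckeAlgebra

open LaurentPolynomial (T)

variable {ι V N : Type u} [AddCommGroup V] [Module ℚ V] [AddCommGroup N] [Module ℚ N]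
variable {R : RootPairing ι ℚ V N} {b : R.Base}

variable (b) in
theorem heckeT_one : heckeT b 1 = 1 :=
  (RingQuot.mkAlgHom_rel _ HeckeRel.one).trans (map_one _)

theorem heckeT_mul {x y : affineWeylGroup R} (h : length b (x * y) = length b x + length b y) :
    heckeT b x * heckeT b y = heckeT b (x * y) :=
  (map_mul _ _ _).symm.trans (RingQuot.mkAlgHom_rel _ (HeckeRel.mul x y h))

theorem heckeT_mul_self (s : simpleReflections b) :
    heckeT b s.1 * heckeT b s.1 =
      (T (-2) : LaurentPolynomial ℤ) • 1 + (T (-2) - 1 : LaurentPolynomial ℤ) • heckeT b s.1 := by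
  rw [← heckeT_one b]
  refine (map_mul _ _ _).symm.trans ((RingQuot.mkAlgHom_rel _ (HeckeRel.quadratic s)).trans ?_)
  rw [map_add, map_smul, map_smul]
  rfl

theorem heckeH_mul {x : affineWeylGroup R} {s : simpleReflections b} (hs : length b s.1 = 1)
    (h : length b (x * s.1) = length b x + 1) :
    heckeH b x * heckeH b s.1 = heckeH b (x * s.1) := by
  rw [heckeH, heckeH, heckeH, smul_mul_smul_comm, heckeT_mul (by rw [h, hs]), h, hs,
    ← LaurentPolynomial.T_add, Nat.cast_add]

theorem heckeH_mul_self {s : simpleReflections b} (hs : length b s.1 = 1) :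
    heckeH b s.1 * heckeH b s.1 =
      1 + (T (-1) - T 1 : LaurentPolynomial ℤ) • heckeH b s.1 := by
  rw [heckeH, smul_mul_smul_comm, heckeT_mul_self, hs, smul_add, smul_smul, smul_smul, smul_smul,
    ← LaurentPolynomial.T_add]
  congr 1
  · rw [← LaurentPolynomial.T_add]
    simp
  · congr 1
    rw [mul_sub, sub_mul, ← LaurentPolynomial.T_add, ← LaurentPolynomial.T_add,
      ← LaurentPolynomial.T_add, mul_one]
    norm_num

/-- The contribution of a coset `{x, xs}` to the product with `H_s + v`. -/
theorem coset_mul {x : affineWeylGroup R} {s : simpleReflections b} (hs : length b s.1 = 1)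
    (h : length b (x * s.1) = length b x + 1) (p q : LaurentPolynomial ℤ) :
    ((T (-(length b x : ℤ)) * p) • heckeH b x +
        (T (-(length b (x * s.1) : ℤ)) * q) • heckeH b (x * s.1)) * (heckeH b s.1 + heckeV b) =
      heckeV b * ((T (-(length b x : ℤ)) * (p + T (-2) * q)) • heckeH b x +
        (T (-(length b (x * s.1) : ℤ)) * (p + T (-2) * q)) • heckeH b (x * s.1)) := by
  have hV : ∀ y : HeckeAlgebra b, y * heckeV b = (T 1 : LaurentPolynomial ℤ) • y := fun y => by
    rw [heckeV, ← Algebra.commutes, Algebra.smul_def]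
  have hV' : ∀ y : HeckeAlgebra b, heckeV b * y = (T 1 : LaurentPolynomial ℤ) • y := fun y => by
    rw [heckeV, Algebra.smul_def]
  have h2 : heckeH b (x * s.1) * heckeH b s.1 =
      heckeH b x + (T (-1) - T 1 : LaurentPolynomial ℤ) • heckeH b (x * s.1) := by
    rw [← heckeH_mul hs h, mul_assoc, heckeH_mul_self hs, mul_add, mul_one, mul_smul_comm]
  have ht : (T (-(length b (x * s.1) : ℤ)) : LaurentPolynomial ℤ) =
      T (-(length b x : ℤ)) * T (-1) := by
    rw [← LaurentPolynomial.T_add, h]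
    congr 1
    push_cast
    ring
  have e1 : (T 1 * T (-1) : LaurentPolynomial ℤ) = 1 := by
    rw [← LaurentPolynomial.T_add]
    exact LaurentPolynomial.T_zero
  have e2 : (T (-2) : LaurentPolynomial ℤ) = T (-1) * T (-1) := by
    rw [← LaurentPolynomial.T_add]
    norm_num
  rw [hV', mul_add, hV, add_mul, smul_mul_assoc, smul_mul_assoc, heckeH_mul hs h, h2, ht, e2]
  -- The only relation between powers of `v` needed to compare the coefficients of `H_x` and
  -- `H_{xs}` is `v w = 1`, where `w` is the inverse of `v`.
  generalize (T (-(length b x : ℤ)) : LaurentPolynomial ℤ) = t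
  generalize (T 1 : LaurentPolynomial ℤ) = v at *
  generalize (T (-1) : LaurentPolynomial ℤ) = w at *
  simp only [smul_add, smul_smul]
  have c1 : v * (t * (p + w * w * q)) = v * (t * p) + t * w * q := by
    linear_combination (t * w * q) * e1
  have c2 : v * (t * w * (p + w * w * q)) = t * p + t * w * q * (w - v) + v * (t * w * q) := by
    linear_combination (t * p + t * w * w * q) * e1
  rw [c1, c2]
  simp only [add_smul]
  abel

end HeckeAlgebra

/-! ### Characters of translated sheaves and the induction -/

section Character

open LaurentPolynomial (T)

variable {ι V N : Type u} [AddCommGroup V] [Module ℚ V] [AddCommGroup N] [Module ℚ N]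
variable {R : RootPairing ι ℚ V N} {b : R.Base} [R.IsRootSystem] [Finite ι] [R.IsCrystallographic]
variable [R.IsReduced] [R.IsIrreducible] {k : Type u} [Field k] {s : simpleReflections b}
variable {P : MGSheaf k (affineGraph b k)}

theorem length_wallEdge (s : simpleReflections b) (c : Cosets b s) :
    (wallEdge s c).tgt = (wallEdge s c).src * s.1 ∧
      length b ((wallEdge s c).src * s.1) = length b (wallEdge s c).src + 1 := by
  have h := (wallEdge s c).tgt_eq_mul_simple s (wallEdge_coset s c)
  refine ⟨h, le_antisymm (length_mul_simple_le b _ s) ?_⟩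
  rw [← h]
  exact (wallEdge s c).length_lt

theorem length_simple (s : simpleReflections b) : length b s.1 = 1 := by
  have h := length_mul_simple_le b 1 s
  rw [one_mul, length_one] at h
  refine le_antisymm h (Nat.one_le_iff_ne_zero.2 fun h0 => ?_)
  obtain ⟨L, hL, hLs⟩ := exists_reduced_word b s.1
  -- The two elements of a coset have different lengths, so multiplication by `s` is not the
  -- identity.
  have h2 := (length_wallEdge s ((1 : affineWeylGroup R) : Cosets b s)).2
  have hs1 : s.1 = 1 := by
    rw [h0, List.length_eq_zero_iff] at hL
    rw [← hLs, hL]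
    rfl
  have h3 := congrArg (fun y : affineWeylGroup R => length b ((wallEdge s ((1 : affineWeylGroup R) : Cosets b s)).src * y)) hs1
  rw [h2, mul_one] at h3
  exact Nat.succ_ne_self _ h3

/-- Each vertex is the source or the target of exactly one edge inside a coset, and never both. -/
theorem finsum_eq_finsum_coset {A : Type*} [AddCommMonoid A] (s : simpleReflections b)
    (f : affineWeylGroup R → A) (hf : f.support.Finite) :
    ∑ᶠ x, f x = ∑ᶠ c : Cosets b s, (f (wallEdge s c).src + f (wallEdge s c).tgt) := by
  have hs : Function.Injective fun c : Cosets b s => (wallEdge s c).src := fun c d hcd => by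
    rw [← wallEdge_src s c, ← wallEdge_src s d]
    exact congrArg _ hcd
  have ht : Function.Injective fun c : Cosets b s => (wallEdge s c).tgt := fun c d hcd => by
    rw [← wallEdge_tgt s c, ← wallEdge_tgt s d]
    exact congrArg _ hcd
  have hdisj : Disjoint (Set.range fun c : Cosets b s => (wallEdge s c).src)
      (Set.range fun c : Cosets b s => (wallEdge s c).tgt) := by
    rw [Set.disjoint_left]
    rintro _ ⟨c, rfl⟩ ⟨d, hd⟩
    change (wallEdge s d).tgt = (wallEdge s c).src at hd
    have hcd : c = d := by rw [← wallEdge_src s c, ← wallEdge_tgt s d, hd]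
    subst hcd
    exact (wallEdge s c).src_ne hd.symm
  have huniv : (Set.range fun c : Cosets b s => (wallEdge s c).src) ∪
      (Set.range fun c : Cosets b s => (wallEdge s c).tgt) = Set.univ := by
    refine Set.eq_univ_of_forall fun x => ?_
    rcases eq_src_or_tgt s (rfl : (x : Cosets b s) = x) with h | h
    · exact Or.inl ⟨_, h.symm⟩
    · exact Or.inr ⟨_, h.symm⟩
  rw [finsum_add_distrib (hf.preimage hs.injOn) (hf.preimage ht.injOn), ← finsum_mem_univ, ← huniv,
    finsum_mem_union' hdisj (hf.inter_of_right _) (hf.inter_of_right _),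
    finsum_mem_range hs, finsum_mem_range ht]

/-- The summand of the character that belongs to the vertex `x`. -/
def characterTerm (M : MGSheaf k (affineGraph b k)) (x : affineWeylGroup R) : HeckeAlgebra b :=
  (T (-(length b x : ℤ)) * (M.stalk x).grk : LaurentPolynomial ℤ) • heckeH b x

theorem characterTerm_of_notMem_supp (M : MGSheaf k (affineGraph b k)) {x : affineWeylGroup R}
    (hx : x ∉ M.supp) : characterTerm M x = 0 := by
  have : Subsingleton (M.stalk x) := not_nontrivial_iff_subsingleton.1 hx
  rw [characterTerm, GrMod.grk_of_subsingleton, mul_zero, zero_smul]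

theorem finite_support_characterTerm {M : MGSheaf k (affineGraph b k)} (hM : M.supp.Finite) :
    (characterTerm M).support.Finite :=
  hM.subset fun _ hx => by_contra fun h => hx (characterTerm_of_notMem_supp M h)

theorem character_eq_finsum_coset (s : simpleReflections b) {M : MGSheaf k (affineGraph b k)}
    (hM : M.supp.Finite) : character M = ∑ᶠ c : Cosets b s,
      (characterTerm M (wallEdge s c).src + characterTerm M (wallEdge s c).tgt) :=
  finsum_eq_finsum_coset s _ (finite_support_characterTerm hM)

theorem finite_support_characterTerm_coset (s : simpleReflections b)
    {M : MGSheaf k (affineGraph b k)} (hM : M.supp.Finite) :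
    (Function.support fun c : Cosets b s =>
      characterTerm M (wallEdge s c).src + characterTerm M (wallEdge s c).tgt).Finite := by
  refine (Set.Finite.image (fun x : affineWeylGroup R => (x : Cosets b s)) hM).subset fun c hc => by_contra fun h => hc ?_
  change characterTerm M (wallEdge s c).src + characterTerm M (wallEdge s c).tgt = 0
  rw [characterTerm_of_notMem_supp, characterTerm_of_notMem_supp, add_zero]
  · exact fun hx => h ⟨_, hx, wallEdge_tgt s c⟩
  · exact fun hx => h ⟨_, hx, wallEdge_src s c⟩

/-- Compared coset by coset: both stalks of the translated sheaf are the stalk of `thetaOn s P`,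
with character `p + v^{-2} q`, and `coset_mul` applies. -/
theorem heckeV_mul_character (hk : ringChar k ≠ 2) (hP : P.IsProjective) (h : OnCompatible s P)
    (hfin : (thetaOut s (thetaOn s P h)).supp.Finite) :
    heckeV b * character (thetaOut s (thetaOn s P h)) =
      character P * (heckeH b s.1 + heckeV b) := by
  rw [character_eq_finsum_coset s hfin, character_eq_finsum_coset s hP.finite_supp,
    mul_finsum' _ _ (finite_support_characterTerm_coset s hfin),
    finsum_mul' _ _ (finite_support_characterTerm_coset s hP.finite_supp)]
  refine finsum_congr fun c => ?_
  obtain ⟨h1, h2⟩ := length_wallEdge s c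
  have key := coset_mul (length_simple s) h2 (P.stalk (wallEdge s c).src).grk
    (P.stalk (wallEdge s c).tgt).grk
  rw [← h1] at key
  refine Eq.trans ?_ key.symm
  rw [← grk_stalk_thetaOn h hk hP c]
  unfold characterTerm
  have hg : ∀ x : affineWeylGroup R, (x : Cosets b s) = c →
      (thetaOut s (thetaOn s P h)).stalk x = (thetaOn s P h).stalk c := by
    rintro x rfl
    rfl
  rw [hg _ (wallEdge_src s c), hg _ (wallEdge_tgt s c)]

variable (b k) in
theorem character_unitSheaf : character (unitSheaf b k) = 1 := by
  change ∑ᶠ x, characterTerm (unitSheaf b k) x = 1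
  rw [finsum_eq_single _ 1 fun x hx => characterTerm_of_notMem_supp _ fun h =>
    hx (supp_unitSheaf_subset b k h)]
  rw [characterTerm, unitSheaf_stalk_one, GrMod.grk_self, heckeH, length_one, heckeT_one]
  simp

theorem bottSamelson_concat (L : List (simpleReflections b)) (s : simpleReflections b) :
    bottSamelson k (L ++ [s]) = (bottSamelson k L).bind (theta s) := by
  rw [bottSamelson, List.foldl_append]
  rfl

/-- The proof of `OnCompatible` chosen in `theta` is irrelevant, so the explicit sheaf is its value.
-/
theorem mem_theta (hk : ringChar k ≠ 2) (hP : P.IsProjective) (hG : WallGKM s P) :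
    thetaOut s (thetaOn s P (onCompatible s hk hP)) ∈ theta s P :=
  ⟨⟨hP, quotientGraph_isMomentGraph s k hk, onCompatible s hk hP,
    thetaOn_isProjective _ hk hP hG⟩, rfl⟩

theorem exists_bottSamelson (hk : ringChar k ≠ 2) (L : List (simpleReflections b))
    (hL : (affineGraph b k).GKMOn k (subwordProducts L)) :
    ∃ B ∈ bottSamelson k L, B.IsProjective ∧ B.supp ⊆ subwordProducts L ∧
      heckeV b ^ L.length * character B =
        (L.map fun t => heckeH b t.1 + heckeV b).prod := by
  -- The last entry is translated last, so it is the one to be split off.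
  induction L using List.reverseRecOn with
  | nil =>
    refine ⟨unitSheaf b k, Part.mem_some _, unitSheaf_isProjective b k, fun x hx => ?_, ?_⟩
    · rw [supp_unitSheaf_subset b k hx]
      exact ⟨[], List.Sublist.refl _, rfl⟩
    · rw [character_unitSheaf]
      simp
  | append_singleton L s ih =>
    -- The GKM-property passes to the shorter sequence, which has fewer products of subsequences.
    obtain ⟨P, hPL, hP, hsupp, hch⟩ := ih fun E D hne h1 h2 h3 h4 =>
      hL E D hne (mem_subwordProducts_concat s h1) (mem_subwordProducts_concat s h2)
        (mem_subwordProducts_concat s h3) (mem_subwordProducts_concat s h4)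
    have hG := wallGKM_of_gkmOn hL hsupp
    have hB := thetaOut_isProjective hk
      (thetaOn_isProjective (onCompatible s hk hP) hk hP hG) (hG.outGKM _)
    refine ⟨_, ?_, hB, supp_thetaOut_thetaOn hsupp _, ?_⟩
    · rw [bottSamelson_concat]
      exact Part.mem_bind hPL (mem_theta hk hP hG)
    · rw [List.length_append, List.length_singleton, pow_succ, mul_assoc,
        heckeV_mul_character hk hP _ hB.finite_supp, ← mul_assoc, hch, List.map_append,
        List.prod_append, List.map_singleton, List.prod_singleton]

end Character

end BottSamelson

end

theorem lemma9 {ι V N F : Type u} [Finite ι] [AddCommGroup V] [Module ℚ V] [AddCommGroup N]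
    [Module ℚ N] [Field F] (hF : ringChar F ≠ 2) (R : RootPairing ι ℚ V N) [R.IsRootSystem]
    [R.IsCrystallographic] [R.IsReduced] [R.IsIrreducible] (b : R.Base)
    (s : List (BottSamelson.simpleReflections b))
    (hs : (BottSamelson.affineGraph b F).GKMOn F (BottSamelson.subwordProducts s)) :
    ∃ B ∈ BottSamelson.bottSamelson F s,
      B.IsProjective ∧ B.supp ⊆ BottSamelson.subwordProducts s ∧
      BottSamelson.heckeV b ^ s.length * BottSamelson.character B =
        (s.map fun t => BottSamelson.heckeH b t.1 + BottSamelson.heckeV b).prod :=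
  BottSamelson.exists_bottSamelson hF s hs
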